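/- **Language.** Fix a set of data types $\delta$ and a set of injection labels; each label $i$ belongs to exactly one data type and either takes an argument of one fixed type $\tau$ (written $i:\tau\hookrightarrow\delta$; $\tau$ may mention any data types) or no argument ($i:\delta$). Assume that every data type has at least one closed value. LambdaPix has types $\tau ::= \mathsf{int}\mid\mathsf{boolean}\mid\delta\mid\{\ell_1:\tau_1,\dots,\ell_n:\tau_n\}\mid\tau_1\to\tau_2$ (distinct labels in a record), linear patterns $p ::= \_\mid x\mid\{\ell_k=p_k\}\mid x\ \mathtt{as}\ p\mid c\mid i\cdot p\mid i$, and expressions $$e ::= c\mid x\mid\{\ell_k=e_k\}\mid e\cdot\ell\mid i\cdot e\mid i\mid\mathtt{case}\ e\,\{p_1.e_1|\dots|p_n.e_n\}\mid\lambda x.e\mid e_1\,e_2\mid\mathtt{fix}\ x\ \mathtt{is}\ e\mid o,$$ where $c$ is an integer or boolean constant and $o\in\{+,-,*,<,>,\le,\ge\}$ takes a pair of integers. Typing $\Gamma\vdash e:\tau$ and $p::\tau\dashv\Gamma$ are the usual simple typing rules; $\Gamma_{\mathrm{initial}}$ contains only the types of the $o$. Evaluation $e\Mapsto v$ is left-to-right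 call-by-value, a case takes the first branch whose pattern matches, and $\mathtt{fix}\ x\ \mathtt{is}\ e\mapsto[\mathtt{fix}\ x\ \mathtt{is}\ e/x]e$; stuck and diverging expressions do not evaluate to a value. Weak head reduction $e\downarrow e'$ contracts call-by-name $\beta$-redexes and projections of records in head position (below the function part of applications and the record part of projections) as long as possible. **Formulas.** Terms $t$ are built from constants, variables, records, projections, injections, $\_$, $x\ \mathtt{as}\ t$, $o$ and $o\,t$; so patterns and some expressions are terms. Formulas are built by $\wedge,\vee,\Rightarrow,\neg$ from equivalences $t_1\equiv t_2$. After closed values are put in for the variables, $t_1\equiv t_2$ is syntactic equality, with projections and applications $o\,t$ computed, $\_\equiv t$ true, and $x\ \mathtt{as}\ t\equiv t'$ meaning $x\equiv t\wedge t\equiv t'$. A formula is *valid* for a context $\Gamma'$ if it is true for all closed values $v_x:\tau$ substituted for the variables $x:\tau$ in $\Gamma'$. **Formula generation.** The judgments $\Gamma\vdash e_1\overset{\sigma}{\Leftrightarrow}e_2:\tau\dashv\Gamma'$ and $\Gamma\vdash e_1\overset{\sigma}{\leftrightarrow}e_2:\tau\dashv\Gamma'$ (both presuppose $\Gamma\vdash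 e_1:\tau$ and $\Gamma\vdash e_2:\tau$; fresh variables are distinct from each other and from all variables in use, and $\Gamma'$ lists them with their types) are defined simultaneously by these rules, where premises are in context $\Gamma$ unless another is shown. 1. $e_1\Leftrightarrow^\sigma e_2:\tau\dashv\Gamma'$ if $e_1\downarrow e_1'$, $e_2\downarrow e_2'$ and $e_1'\leftrightarrow^\sigma e_2':\tau\dashv\Gamma'$. 2. *Atomic*: $e_1\leftrightarrow^{e_1\equiv e_2}e_2:\tau\dashv\cdot$ if $e_1,e_2$ are terms of type $\tau$. 3. *Record*: $\{\ell_k=e_k\}\leftrightarrow^{\bigwedge_k\sigma_k}\{\ell_k=e_k'\}:\{\ell_k:\tau_k\}\dashv\Gamma_1',\dots,\Gamma_n'$ if $e_k\Leftrightarrow^{\sigma_k}e_k':\tau_k\dashv\Gamma_k'$ for all $k$. 4. *Projection*: $e_1\cdot\ell_k\leftrightarrow^\sigma e_2\cdot\ell_k:\tau_k\dashv\Gamma'$ if $e_1\leftrightarrow^\sigma e_2:\{\dots,\ell_k:\tau_k,\dots\}\dashv\Gamma'$. 5. *Injection*: $i\cdot e_1\leftrightarrow^\sigma i\cdot e_2:\delta\dashv\Gamma'$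 if $i:\tau\hookrightarrow\delta$ and $e_1\Leftrightarrow^\sigma e_2:\tau\dashv\Gamma'$. 6. *Lambda*: $\lambda x_1.e_1\leftrightarrow^\sigma\lambda x_2.e_2:\tau\to\tau'\dashv x:\tau,\Gamma'$ if $x$ is fresh and $\Gamma,x:\tau\vdash[x/x_1]e_1\Leftrightarrow^\sigma[x/x_2]e_2:\tau'\dashv\Gamma'$. 7. *Fix*: $\mathtt{fix}\ x_1\ \mathtt{is}\ e_1\leftrightarrow^\sigma\mathtt{fix}\ x_2\ \mathtt{is}\ e_2:\tau\dashv x:\tau,\Gamma'$ if $x$ is fresh and $\Gamma,x:\tau\vdash[x/x_1]e_1\Leftrightarrow^\sigma[x/x_2]e_2:\tau\dashv\Gamma'$. 8. *Application*: $e_1\,e_1'\leftrightarrow^{\sigma\wedge\sigma'}e_2\,e_2':\tau'\dashv\Gamma',\Gamma''$ if $e_1\leftrightarrow^\sigma e_2:\tau\to\tau'\dashv\Gamma'$ and $e_1'\Leftrightarrow^{\sigma'}e_2':\tau\dashv\Gamma''$. 9. *Replaced application* (three rules and their three mirror images): for $f$ a variable, a primitive operation or a fixed point, $f\,a\leftrightarrow^\sigma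 e:\tau\dashv y:\tau,\Gamma'$ if $y$ is fresh and $\Gamma,y:\tau\vdash y\leftrightarrow^\sigma[y/(f\,a)]e:\tau\dashv\Gamma'$, where $[y/(f\,a)]e$ replaces all occurrences of $f\,a$ in $e$ by $y$; the mirror image has the two sides of conclusion and premise exchanged. 10. *Case, one side* (left, and its mirror image with the same premises): let $e:\tau'$ be a term, let $p_k'.e_k'$ be $p_k.e_k$ with the pattern variables renamed to fresh ones, let $p_k'::\tau'\dashv\Gamma_k$ and $\Gamma,\Gamma_k\vdash e_k'\Leftrightarrow^{\sigma_k}e':\tau\dashv\Gamma_k'$ for all $k\le n$. Then $\mathtt{case}\ e\,\{p_1.e_1|\dots|p_n.e_n\}\leftrightarrow^{\Phi}e':\tau\dashv\Gamma_1,\Gamma_1',\dots,\Gamma_n,\Gamma_n'$, where $\Phi=\bigwedge_k\big((\bigwedge_{j<k}e\not\equiv p_j')\wedge e\equiv p_k'\Rightarrow\sigma_k\big)$. 11. *Case, both sides*: $\mathtt{case}\ e\,\{M\}\leftrightarrow^{\sigma\wedge\sigma'}\mathtt{case}\ e'\,\{M'\}:\tau\dashv\Gamma',x:\tau',\Gamma''$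 if $e\leftrightarrow^\sigma e':\tau'\dashv\Gamma'$, $x$ is fresh and $\Gamma,x:\tau'\vdash\mathtt{case}\ x\,\{M\}\leftrightarrow^{\sigma'}\mathtt{case}\ x\,\{M'\}:\tau\dashv\Gamma''$. 12. *Shared patterns* (two rules, mirror images): for a variable $x:\tau'$ let $M,M'$ be freshened to $p_1.e_1|\dots|p_n.e_n$ and $p_1'.e_1'|\dots|p_m'.e_m'$ so that the first $s$ pairs of branches are alpha-varied to shared patterns $p_k=p_k'$ (a wildcard may be turned into a fresh variable, an $\mathtt{as}$ on one side may be added on the other; otherwise the two patterns have the same shape), the others being freshened separately. Let $p_k::\tau'\dashv\Gamma_k$, let $\Gamma,\Gamma_k\vdash e_k\Leftrightarrow^{\sigma_k}e_k':\tau\dashv\Gamma_k'$ for $k\le s$, and $\Gamma,\Gamma_k\vdash e_k\Leftrightarrow^{\sigma_k}\mathtt{case}\ x\,\{p_1'.e_1'|\dots|p_m'.e_m'\}:\tau\dashv\Gamma_k'$ for $s<k\le n$. Then $\mathtt{case}\ x\,\{M\}\leftrightarrow^\Psi\mathtt{case}\ x\,\{M'\}:\tau\dashv\Gamma_1,\Gamma_1',\dots,\Gamma_n,\Gamma_n'$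 with $\Psi=\bigwedge_{k\le s}\sigma_k\wedge\bigwedge_{s<k\le n}\big((\bigwedge_{j<k}x\not\equiv p_j)\wedge x\equiv p_k\Rightarrow\sigma_k\big)$. **Extensional equivalence.** $e_1\cong e_2:\tau$, for closed $e_1,e_2$, is the largest relation such that $e_1\cong e_2:\tau$ implies $\Gamma_{\mathrm{initial}}\vdash e_1:\tau$, $\Gamma_{\mathrm{initial}}\vdash e_2:\tau$ and, *whenever* $e_1\Mapsto v_1$ and $e_2\Mapsto v_2$: if $\tau=\tau_1\to\tau_2$, then $v_1\,a\cong v_2\,a:\tau_2$ for every closed $a:\tau_1$; if $\tau$ is not an arrow type, then for every pattern $p$ with $p::\tau\dashv\Delta$, either $v_1$ and $v_2$ both match $p$ and bind each variable $x:\tau'$ of $\Delta$ to values that are equivalent at $\tau'$, or neither matches $p$. (Nothing is claimed about a pair of expressions one of which does not evaluate to a value.) **Theorem (Soundness).** For all expressions $e_1,e_2$: if $\Gamma_{\mathrm{initial}}\vdash e_1\overset{\sigma}{\Leftrightarrow}e_2:\tau\dashv\Gamma'$ and $\sigma$ is valid for $\Gamma'$, then $e_1\cong e_2:\tau$. -/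

import Mathlib

namespace LambdaPix

universe u v

/-- Variables. -/
abbrev Var := ℕ

/-- Record labels. -/
abbrev Label := ℕ

inductive BaseTy where
  | int
  | bool

/-- Types over a set `D` of data types. The labels of a product type are pairwise distinct. -/
inductive Ty (D : Type u) : Type u where
  | base (b : BaseTy)
  | data (d : D)
  | record {n : ℕ} (l : Fin n ↪ Label) (t : Fin n → Ty D)
  | arrow (t₁ t₂ : Ty D)

/-- A fixed set of algebraic data types `D` with injection labels `I`. Each label `i` belongs to
exactly one data type `res i`, and `arg i` is the type of its argument, if it takes one. -/
structure Signature (D : Type u) (I : Type v) where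
  arg : I → Option (Ty D)
  res : I → D

inductive Const where
  | int (z : ℤ)
  | bool (b : Bool)

def Const.ty : Const → BaseTy
  | .int _ => .int
  | .bool _ => .bool

inductive PrimOp where
  | add | sub | mul | lt | gt | le | ge

/-- The labels `1`, `2` of a pair. -/
def pairLabels : Fin 2 ↪ Label := ⟨fun i => i.val + 1, fun _ _ h => Fin.ext (Nat.succ.inj h)⟩

/-- A primitive operation takes a pair of integers; this is its result type. -/
def PrimOp.resTy : PrimOp → BaseTy
  | .add | .sub | .mul => .int
  | .lt | .gt | .le | .ge => .bool

def PrimOp.ty {D : Type u} (o : PrimOp) : Ty D :=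
  .arrow (.record pairLabels fun _ => .base .int) (.base o.resTy)

def PrimOp.eval : PrimOp → ℤ → ℤ → Const
  | .add, a, b => .int (a + b)
  | .sub, a, b => .int (a - b)
  | .mul, a, b => .int (a * b)
  | .lt, a, b => .bool (decide (a < b))
  | .gt, a, b => .bool (decide (b < a))
  | .le, a, b => .bool (decide (a ≤ b))
  | .ge, a, b => .bool (decide (b ≤ a))

/-- Patterns. -/
inductive Pat (I : Type v) : Type v where
  | wild
  | var (x : Var)
  | record {n : ℕ} (l : Fin n ↪ Label) (p : Fin n → Pat I)
  /-- The pattern `x as p`. -/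
  | asP (x : Var) (p : Pat I)
  | const (c : Const)
  | inj (i : I) (p : Pat I)
  | inj₀ (i : I)

/-- Expressions. `case e p b` is `case e {p 0 . b 0 | … | p (n-1) . b (n-1)}`. -/
inductive Expr (I : Type v) : Type v where
  | const (c : Const)
  | var (x : Var)
  | record {n : ℕ} (l : Fin n ↪ Label) (e : Fin n → Expr I)
  | proj (e : Expr I) (k : Label)
  | inj (i : I) (e : Expr I)
  | inj₀ (i : I)
  | case (e : Expr I) {n : ℕ} (p : Fin n → Pat I) (b : Fin n → Expr I)
  | lam (x : Var) (e : Expr I)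
  | app (e₁ e₂ : Expr I)
  | fix (x : Var) (e : Expr I)
  | prim (o : PrimOp)

/-! ### Variables and capture-avoiding substitution -/

/-- The variables bound by a pattern, listed with multiplicity. -/
def Pat.vars {I : Type v} : Pat I → List Var
  | .wild => []
  | .var x => [x]
  | .record _ p => (List.ofFn fun i => (p i).vars).flatten
  | .asP x p => x :: p.vars
  | .const _ => []
  | .inj _ p => p.vars
  | .inj₀ _ => []

/-- No variable appears more than once in the pattern. -/
def Pat.Linear {I : Type v} (p : Pat I) : Prop := p.vars.Nodup

def Pat.rename {I : Type v} (f : Var → Var) : Pat I → Pat I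
  | .wild => .wild
  | .var x => .var (f x)
  | .record l p => .record l fun i => (p i).rename f
  | .asP x p => .asP (f x) (p.rename f)
  | .const c => .const c
  | .inj i p => .inj i (p.rename f)
  | .inj₀ i => .inj₀ i

/-- Free variables. -/
def Expr.fv {I : Type v} : Expr I → Finset Var
  | .const _ => ∅
  | .var x => {x}
  | .record _ e => Finset.univ.biUnion fun i => (e i).fv
  | .proj e _ => e.fv
  | .inj _ e => e.fv
  | .inj₀ _ => ∅
  | .case e p b => e.fv ∪ Finset.univ.biUnion fun i => (b i).fv \ (p i).vars.toFinset
  | .lam x e => e.fv \ {x}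
  | .app e₁ e₂ => e₁.fv ∪ e₂.fv
  | .fix x e => e.fv \ {x}
  | .prim _ => ∅

/-- All variables that occur, free, bound or binding. -/
def Expr.vars {I : Type v} : Expr I → Finset Var
  | .const _ => ∅
  | .var x => {x}
  | .record _ e => Finset.univ.biUnion fun i => (e i).vars
  | .proj e _ => e.vars
  | .inj _ e => e.vars
  | .inj₀ _ => ∅
  | .case e p b => e.vars ∪ Finset.univ.biUnion fun i => (b i).vars ∪ (p i).vars.toFinset
  | .lam x e => insert x e.vars
  | .app e₁ e₂ => e₁.vars ∪ e₂.vars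
  | .fix x e => insert x e.vars
  | .prim _ => ∅

/-- The amount by which the binders `xs` of a scope `e` have to be shifted so that none of them
captures a variable of the expressions that `s` puts in for the free variables of that scope;
it is `0` when nothing would be captured. -/
def bump {I : Type v} (s : Var → Expr I) (xs : List Var) (e : Expr I) : ℕ :=
  let avoid := (e.fv \ xs.toFinset).biUnion fun z => (s z).fv
  if ∃ x ∈ xs, x ∈ avoid then avoid.sup id + 1 else 0

/-- The substitution to be used below binders `xs` that are shifted by `k`. -/
def under {I : Type v} (s : Var → Expr I) (xs : List Var) (k : ℕ) : Var → Expr I :=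
  fun z => if z ∈ xs then .var (z + k) else s z

/-- Simultaneous capture-avoiding substitution. -/
def Expr.subst {I : Type v} (s : Var → Expr I) : Expr I → Expr I
  | .const c => .const c
  | .var x => s x
  | .record l e => .record l fun i => (e i).subst s
  | .proj e k => .proj (e.subst s) k
  | .inj i e => .inj i (e.subst s)
  | .inj₀ i => .inj₀ i
  | .case e p b =>
      .case (e.subst s)
        (fun i => (p i).rename fun x => x + bump s (p i).vars (b i))
        (fun i => (b i).subst (under s (p i).vars (bump s (p i).vars (b i))))
  | .lam x e => .lam (x + bump s [x] e) (e.subst (under s [x] (bump s [x] e)))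
  | .app e₁ e₂ => .app (e₁.subst s) (e₂.subst s)
  | .fix x e => .fix (x + bump s [x] e) (e.subst (under s [x] (bump s [x] e)))
  | .prim o => .prim o

/-- `e.subst₁ x e'` is `[e'/x]e`. -/
def Expr.subst₁ {I : Type v} (e : Expr I) (x : Var) (e' : Expr I) : Expr I :=
  e.subst (Function.update Expr.var x e')

/-- Bindings `v/x`. -/
abbrev Bindings (I : Type v) := List (Var × Expr I)

/-- `e.substB B` is `[B]e`. -/
def Expr.substB {I : Type v} (e : Expr I) (B : Bindings I) : Expr I :=
  e.subst fun x => (B.lookup x).getD (.var x)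

open Classical in
/-- `replaceApp f a y e` is `[y/(f a)]e`: every occurrence in `e` of the application `f a` is
replaced by the variable `y`. Below a binder of a free variable of `f a` there is none. -/
noncomputable def replaceApp {I : Type v} (f a : Expr I) (y : Var) : Expr I → Expr I
  | .const c => .const c
  | .var x => .var x
  | .record l e => .record l fun i => replaceApp f a y (e i)
  | .proj e k => .proj (replaceApp f a y e) k
  | .inj i e => .inj i (replaceApp f a y e)
  | .inj₀ i => .inj₀ i
  | .case e p b =>
      .case (replaceApp f a y e) p fun i =>
        if ∃ x ∈ (p i).vars, x ∈ (Expr.app f a).fv then b i else replaceApp f a y (b i)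
  | .lam x e => if x ∈ (Expr.app f a).fv then .lam x e else .lam x (replaceApp f a y e)
  | .app e₁ e₂ =>
      if e₁ = f ∧ e₂ = a then .var y
      else .app (replaceApp f a y e₁) (replaceApp f a y e₂)
  | .fix x e => if x ∈ (Expr.app f a).fv then .fix x e else .fix x (replaceApp f a y e)
  | .prim o => .prim o

/-! ### Static semantics -/

/-- Typing contexts for variables, the most recent entry first. The typings of the primitive
operations are the same in every context and are built into the rule `HasType.prim`, so the
initial context, which holds nothing else, is `[]`. The extension `Γ, Δ` is `Δ ++ Γ`. -/
abbrev Ctx (D : Type u) := List (Var × Ty D)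

def Ctx.dom {D : Type u} (Γ : Ctx D) : List Var := Γ.map Prod.fst

section Static

variable {D : Type u} {I : Type v}

/-- Pattern typing `p :: τ ⊣ Γ`. -/
inductive PatTy (S : Signature D I) : Pat I → Ty D → Ctx D → Prop
  | wild (τ : Ty D) : PatTy S .wild τ []
  | var (x : Var) (τ : Ty D) : PatTy S (.var x) τ [(x, τ)]
  | record {n : ℕ} (l : Fin n ↪ Label) (p : Fin n → Pat I) (τ : Fin n → Ty D)
      (Γ : Fin n → Ctx D) (h : ∀ i, PatTy S (p i) (τ i) (Γ i)) :
      PatTy S (.record l p) (.record l τ) (List.ofFn Γ).flatten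
  | asP (x : Var) (p : Pat I) (τ : Ty D) (Γ : Ctx D) (h : PatTy S p τ Γ) :
      PatTy S (.asP x p) τ ((x, τ) :: Γ)
  | const (c : Const) : PatTy S (.const c) (.base c.ty) []
  | inj₀ (i : I) (hi : S.arg i = none) : PatTy S (.inj₀ i) (.data (S.res i)) []
  | inj (i : I) (p : Pat I) (τ : Ty D) (Γ : Ctx D) (hi : S.arg i = some τ)
      (h : PatTy S p τ Γ) : PatTy S (.inj i p) (.data (S.res i)) Γ

/-- Expression typing `Γ ⊢ e : τ`. The patterns of a case expression are linear. -/
inductive HasType (S : Signature D I) : Ctx D → Expr I → Ty D → Prop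
  | const (Γ : Ctx D) (c : Const) : HasType S Γ (.const c) (.base c.ty)
  | var (Γ : Ctx D) (x : Var) (τ : Ty D) (h : Γ.lookup x = some τ) : HasType S Γ (.var x) τ
  | record (Γ : Ctx D) {n : ℕ} (l : Fin n ↪ Label) (e : Fin n → Expr I) (τ : Fin n → Ty D)
      (h : ∀ i, HasType S Γ (e i) (τ i)) : HasType S Γ (.record l e) (.record l τ)
  | proj (Γ : Ctx D) (e : Expr I) {n : ℕ} (l : Fin n ↪ Label) (τ : Fin n → Ty D) (i : Fin n)
      (h : HasType S Γ e (.record l τ)) : HasType S Γ (.proj e (l i)) (τ i)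
  | inj₀ (Γ : Ctx D) (i : I) (hi : S.arg i = none) :
      HasType S Γ (.inj₀ i) (.data (S.res i))
  | inj (Γ : Ctx D) (i : I) (e : Expr I) (τ : Ty D) (hi : S.arg i = some τ)
      (h : HasType S Γ e τ) : HasType S Γ (.inj i e) (.data (S.res i))
  | case (Γ : Ctx D) (e : Expr I) {n : ℕ} (p : Fin n → Pat I) (b : Fin n → Expr I)
      (τ τ' : Ty D) (Δ : Fin n → Ctx D) (he : HasType S Γ e τ)
      (hp : ∀ i, PatTy S (p i) τ (Δ i)) (hl : ∀ i, (p i).Linear)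
      (hb : ∀ i, HasType S (Δ i ++ Γ) (b i) τ') : HasType S Γ (.case e p b) τ'
  | lam (Γ : Ctx D) (x : Var) (e : Expr I) (τ₁ τ₂ : Ty D)
      (h : HasType S ((x, τ₁) :: Γ) e τ₂) : HasType S Γ (.lam x e) (.arrow τ₁ τ₂)
  | app (Γ : Ctx D) (e₁ e₂ : Expr I) (τ₁ τ₂ : Ty D) (h₁ : HasType S Γ e₁ (.arrow τ₁ τ₂))
      (h₂ : HasType S Γ e₂ τ₁) : HasType S Γ (.app e₁ e₂) τ₂
  | fix (Γ : Ctx D) (x : Var) (e : Expr I) (τ : Ty D)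
      (h : HasType S ((x, τ) :: Γ) e τ) : HasType S Γ (.fix x e) τ
  | prim (Γ : Ctx D) (o : PrimOp) : HasType S Γ (.prim o) o.ty

end Static

/-! ### Dynamic semantics -/

section Dynamic

variable {I : Type v}

/-- `e val`. -/
inductive Val : Expr I → Prop
  | const (c : Const) : Val (.const c)
  | record {n : ℕ} (l : Fin n ↪ Label) (e : Fin n → Expr I) (h : ∀ i, Val (e i)) :
      Val (.record l e)
  | inj (i : I) (e : Expr I) (h : Val e) : Val (.inj i e)
  | inj₀ (i : I) : Val (.inj₀ i)
  | lam (x : Var) (e : Expr I) : Val (.lam x e)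
  | prim (o : PrimOp) : Val (.prim o)

/-- The value `v` matches the pattern `p`, producing the bindings `B`. -/
inductive Matches : Expr I → Pat I → Bindings I → Prop
  | wild (v : Expr I) : Matches v .wild []
  | var (v : Expr I) (x : Var) : Matches v (.var x) [(x, v)]
  | const (c : Const) : Matches (.const c) (.const c) []
  | record {n : ℕ} (l : Fin n ↪ Label) (v : Fin n → Expr I) (p : Fin n → Pat I)
      (B : Fin n → Bindings I) (h : ∀ i, Matches (v i) (p i) (B i)) :
      Matches (.record l v) (.record l p) (List.ofFn B).flatten
  | asP (v : Expr I) (x : Var) (p : Pat I) (B : Bindings I) (h : Matches v p B) :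
      Matches v (.asP x p) ((x, v) :: B)
  | inj₀ (i : I) : Matches (.inj₀ i) (.inj₀ i) []
  | inj (i : I) (v : Expr I) (p : Pat I) (B : Bindings I) (h : Matches v p B) :
      Matches (.inj i v) (.inj i p) B

/-- The value `v` does not match the pattern `p`. -/
inductive NoMatch : Expr I → Pat I → Prop
  | const (c₁ c₂ : Const) (h : c₁ ≠ c₂) : NoMatch (.const c₁) (.const c₂)
  | record {n : ℕ} (l : Fin n ↪ Label) (v : Fin n → Expr I) (p : Fin n → Pat I) (i : Fin n)
      (h : NoMatch (v i) (p i)) : NoMatch (.record l v) (.record l p)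
  | asP (v : Expr I) (x : Var) (p : Pat I) (h : NoMatch v p) : NoMatch v (.asP x p)
  | inj₀ (i₁ i₂ : I) (h : i₁ ≠ i₂) : NoMatch (.inj₀ i₁) (.inj₀ i₂)
  | inj_ne (i₁ i₂ : I) (v : Expr I) (p : Pat I) (h : i₁ ≠ i₂) :
      NoMatch (.inj i₁ v) (.inj i₂ p)
  | inj (i : I) (v : Expr I) (p : Pat I) (h : NoMatch v p) : NoMatch (.inj i v) (.inj i p)
  | inj_inj₀ (i₁ i₂ : I) (v : Expr I) : NoMatch (.inj i₁ v) (.inj₀ i₂)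
  | inj₀_inj (i₁ i₂ : I) (p : Pat I) : NoMatch (.inj₀ i₁) (.inj i₂ p)

/-- The pair of integers `{1 = a, 2 = b}`. -/
def intPair (a b : ℤ) : Expr I := .record pairLabels ![.const (.int a), .const (.int b)]

/-- Small-step dynamics `e ↦ e'`. -/
inductive Step : Expr I → Expr I → Prop
  | record {n : ℕ} (l : Fin n ↪ Label) (e : Fin n → Expr I) (i : Fin n) (e' : Expr I)
      (hv : ∀ j, j < i → Val (e j)) (h : Step (e i) e') :
      Step (.record l e) (.record l (Function.update e i e'))
  | proj (e e' : Expr I) (k : Label) (h : Step e e') : Step (.proj e k) (.proj e' k)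
  | proj_record {n : ℕ} (l : Fin n ↪ Label) (e : Fin n → Expr I) (i : Fin n)
      (hv : Val (.record l e)) : Step (.proj (.record l e) (l i)) (e i)
  | inj (i : I) (e e' : Expr I) (h : Step e e') : Step (.inj i e) (.inj i e')
  | case (e e' : Expr I) {n : ℕ} (p : Fin n → Pat I) (b : Fin n → Expr I) (h : Step e e') :
      Step (.case e p b) (.case e' p b)
  | case_match (e : Expr I) {n : ℕ} (p : Fin n → Pat I) (b : Fin n → Expr I) (i : Fin n)
      (B : Bindings I) (hv : Val e) (hn : ∀ j, j < i → NoMatch e (p j))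
      (hm : Matches e (p i) B) : Step (.case e p b) ((b i).substB B)
  | app_left (e₁ e₁' e₂ : Expr I) (h : Step e₁ e₁') : Step (.app e₁ e₂) (.app e₁' e₂)
  | app_right (e₁ e₂ e₂' : Expr I) (hv : Val e₁) (h : Step e₂ e₂') :
      Step (.app e₁ e₂) (.app e₁ e₂')
  | beta (x : Var) (e e₂ : Expr I) (hv : Val e₂) : Step (.app (.lam x e) e₂) (e.subst₁ x e₂)
  | fix (x : Var) (e : Expr I) : Step (.fix x e) (e.subst₁ x (.fix x e))
  | prim (o : PrimOp) (a b : ℤ) : Step (.app (.prim o) (intPair a b)) (.const (o.eval a b))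

/-- Evaluation to a value. -/
inductive Evals : Expr I → Expr I → Prop
  | val (v : Expr I) (h : Val v) : Evals v v
  | step (e e' v : Expr I) (h : Step e e') (h' : Evals e' v) : Evals e v

/-! ### Weak head reduction -/

/-- One step of weak head reduction. -/
inductive WhStep : Expr I → Expr I → Prop
  | app (e₁ e₁' e₂ : Expr I) (h : WhStep e₁ e₁') : WhStep (.app e₁ e₂) (.app e₁' e₂)
  | beta (x : Var) (e₁ e₂ : Expr I) : WhStep (.app (.lam x e₁) e₂) (e₁.subst₁ x e₂)
  | proj (e e' : Expr I) (k : Label) (h : WhStep e e') : WhStep (.proj e k) (.proj e' k)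
  | proj_record {n : ℕ} (l : Fin n ↪ Label) (e : Fin n → Expr I) (i : Fin n) :
      WhStep (.proj (.record l e) (l i)) (e i)

/-- `e ↓ e'`: weak head reduction of `e` ends in `e'`. -/
inductive Whnf : Expr I → Expr I → Prop
  | step (e e' e'' : Expr I) (h : WhStep e e') (h' : Whnf e' e'') : Whnf e e''
  | done (e : Expr I) (h : ∀ e', ¬ WhStep e e') : Whnf e e

/-! ### Terms and formulas -/

/-- Base terms: they encode values, patterns and applications of primitive operations. -/
inductive Term (I : Type v) : Type v where
  | const (c : Const)
  | var (x : Var)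
  | record {n : ℕ} (l : Fin n ↪ Label) (t : Fin n → Term I)
  | proj (t : Term I) (k : Label)
  | inj (i : I) (t : Term I)
  | inj₀ (i : I)
  | wild
  | asP (x : Var) (t : Term I)
  | prim (o : PrimOp)
  | primApp (o : PrimOp) (t : Term I)

/-- Every pattern is a term. -/
def Pat.toTerm : Pat I → Term I
  | .wild => .wild
  | .var x => .var x
  | .record l p => .record l fun i => (p i).toTerm
  | .asP x p => .asP x p.toTerm
  | .const c => .const c
  | .inj i p => .inj i p.toTerm
  | .inj₀ i => .inj₀ i

/-- The expression `e` is a term, namely `t`. -/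
inductive IsTerm : Expr I → Term I → Prop
  | const (c : Const) : IsTerm (.const c) (.const c)
  | var (x : Var) : IsTerm (.var x) (.var x)
  | record {n : ℕ} (l : Fin n ↪ Label) (e : Fin n → Expr I) (t : Fin n → Term I)
      (h : ∀ i, IsTerm (e i) (t i)) : IsTerm (.record l e) (.record l t)
  | proj (e : Expr I) (t : Term I) (k : Label) (h : IsTerm e t) :
      IsTerm (.proj e k) (.proj t k)
  | inj (i : I) (e : Expr I) (t : Term I) (h : IsTerm e t) : IsTerm (.inj i e) (.inj i t)
  | inj₀ (i : I) : IsTerm (.inj₀ i) (.inj₀ i)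
  | prim (o : PrimOp) : IsTerm (.prim o) (.prim o)
  | primApp (o : PrimOp) (e : Expr I) (t : Term I) (h : IsTerm e t) :
      IsTerm (.app (.prim o) e) (.primApp o t)

/-- `t.Is s v`: after the substitution of `s x` for each variable `x`, the term `t` is equivalent to
the value `v`. This is syntactic equality, except that projections and applications of primitive
operations are computed, a wildcard is equivalent to everything, and `x as t` is equivalent to `v`
when `x` is equivalent to `t` and `t` is equivalent to `v`. -/
def Term.Is (s : Var → Expr I) : Term I → Expr I → Prop
  | .const c, v => v = .const c
  | .var x, v => v = s x
  | .record l t, v => ∃ w, v = .record l w ∧ ∀ i, (t i).Is s (w i)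
  | .proj t k, v =>
      ∃ (n : ℕ) (l : Fin n ↪ Label) (w : Fin n → Expr I) (i : Fin n),
        t.Is s (.record l w) ∧ l i = k ∧ v = w i
  | .inj i t, v => ∃ w, v = .inj i w ∧ t.Is s w
  | .inj₀ i, v => v = .inj₀ i
  | .wild, _ => True
  | .asP x t, v => t.Is s (s x) ∧ t.Is s v
  | .prim o, v => v = .prim o
  | .primApp o t, v => ∃ a b : ℤ, t.Is s (intPair a b) ∧ v = .const (o.eval a b)

/-- Logic formulas; `tru` is the empty conjunction. -/
inductive Formula (I : Type v) : Type v where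
  | equiv (t₁ t₂ : Term I)
  | tru
  | and (f g : Formula I)
  | or (f g : Formula I)
  | imp (f g : Formula I)
  | not (f : Formula I)

/-- Truth of a formula after the substitution of the values `s x` for the variables `x`. -/
def Formula.Holds (s : Var → Expr I) : Formula I → Prop
  | .equiv t₁ t₂ => ∃ v, t₁.Is s v ∧ t₂.Is s v
  | .tru => True
  | .and f g => f.Holds s ∧ g.Holds s
  | .or f g => f.Holds s ∨ g.Holds s
  | .imp f g => f.Holds s → g.Holds s
  | .not f => ¬ f.Holds s

/-- The conjunction of a family of formulas. -/
def Formula.conj {n : ℕ} (f : Fin n → Formula I) : Formula I :=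
  (List.ofFn f).foldr Formula.and .tru

/-- `t` is equivalent to the `i`-th of the patterns `p` and to none of those before it. -/
def Formula.guard {n : ℕ} (t : Term I) (p : Fin n → Pat I) (i : Fin n) : Formula I :=
  .and (.conj fun j : Fin i.val => .not (.equiv t (p (Fin.castLE i.isLt.le j)).toTerm))
    (.equiv t (p i).toTerm)

/-- Validity: truth under every substitution of closed values of the right types for the variables
of `Γ`. -/
def Formula.Valid {D : Type u} (S : Signature D I) (Γ : Ctx D) (f : Formula I) : Prop :=
  ∀ s : Var → Expr I, (∀ x τ, (x, τ) ∈ Γ → Val (s x) ∧ HasType S [] (s x) τ) → f.Holds s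

/-! ### Freshening

In the following judgments a variable is fresh if it is not in the finite set `L` of the variables
that are in use. That the fresh variables introduced at different places are distinct from one
another is required by the rules that use these judgments. -/

/-- `freshen p.e ↪ p'.e'`. -/
inductive Freshen (L : Finset Var) : Pat I → Expr I → Pat I → Expr I → Prop
  | wild (e : Expr I) : Freshen L .wild e .wild e
  | var (x y : Var) (e : Expr I) (hy : y ∉ L) :
      Freshen L (.var x) e (.var y) (e.subst₁ x (.var y))
  | record {n : ℕ} (l : Fin n ↪ Label) (p p' : Fin n → Pat I) (e : Fin (n + 1) → Expr I)
      (h : ∀ i : Fin n, Freshen L (p i) (e i.castSucc) (p' i) (e i.succ)) :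
      Freshen L (.record l p) (e 0) (.record l p') (e (Fin.last n))
  | asP (x y : Var) (p p' : Pat I) (e e' : Expr I) (hy : y ∉ L) (h : Freshen L p e p' e') :
      Freshen L (.asP x p) e (.asP y p') (e'.subst₁ x (.var y))
  | const (c : Const) (e : Expr I) : Freshen L (.const c) e (.const c) e
  | inj₀ (i : I) (e : Expr I) : Freshen L (.inj₀ i) e (.inj₀ i) e
  | inj (i : I) (p p' : Pat I) (e e' : Expr I) (h : Freshen L p e p' e') :
      Freshen L (.inj i p) e (.inj i p') e'

/-- `EB L p₁ e₁ p₂ e₂ p e₁' e₂'` is the judgment `EB (p₁.e₁, p₂.e₂) ↪ (p.e₁', p.e₂')`, which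
alpha-varies two bindings to a shared pattern. -/
inductive EB (L : Finset Var) :
    Pat I → Expr I → Pat I → Expr I → Pat I → Expr I → Expr I → Prop
  | wild_wild (e₁ e₂ : Expr I) : EB L .wild e₁ .wild e₂ .wild e₁ e₂
  | wild_var (x y : Var) (e₁ e₂ : Expr I) (hy : y ∉ L) :
      EB L .wild e₁ (.var x) e₂ (.var y) e₁ (e₂.subst₁ x (.var y))
  | var_wild (x y : Var) (e₁ e₂ : Expr I) (hy : y ∉ L) :
      EB L (.var x) e₁ .wild e₂ (.var y) (e₁.subst₁ x (.var y)) e₂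
  | var_var (x x' y : Var) (e₁ e₂ : Expr I) (hy : y ∉ L) :
      EB L (.var x) e₁ (.var x') e₂ (.var y) (e₁.subst₁ x (.var y)) (e₂.subst₁ x' (.var y))
  | as_left (x y : Var) (p₁ p₂ p' : Pat I) (e₁ e₂ e₁' e₂' : Expr I) (hy : y ∉ L)
      (h : EB L p₁ e₁ p₂ e₂ p' e₁' e₂') :
      EB L (.asP x p₁) e₁ p₂ e₂ (.asP y p') (e₁'.subst₁ x (.var y)) e₂'
  | as_right (x y : Var) (p₁ p₂ p' : Pat I) (e₁ e₂ e₁' e₂' : Expr I) (hy : y ∉ L)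
      (h : EB L p₁ e₁ p₂ e₂ p' e₁' e₂') :
      EB L p₁ e₁ (.asP x p₂) e₂ (.asP y p') e₁' (e₂'.subst₁ x (.var y))
  | record {n : ℕ} (l : Fin n ↪ Label) (p p' p'' : Fin n → Pat I) (e e' : Fin (n + 1) → Expr I)
      (h : ∀ i : Fin n,
        EB L (p i) (e i.castSucc) (p' i) (e' i.castSucc) (p'' i) (e i.succ) (e' i.succ)) :
      EB L (.record l p) (e 0) (.record l p') (e' 0) (.record l p'') (e (Fin.last n))
        (e' (Fin.last n))
  | const (c : Const) (e₁ e₂ : Expr I) : EB L (.const c) e₁ (.const c) e₂ (.const c) e₁ e₂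
  | inj₀ (i : I) (e₁ e₂ : Expr I) : EB L (.inj₀ i) e₁ (.inj₀ i) e₂ (.inj₀ i) e₁ e₂
  | inj (i : I) (p₁ p₂ p' : Pat I) (e₁ e₂ e₁' e₂' : Expr I)
      (h : EB L p₁ e₁ p₂ e₂ p' e₁' e₂') :
      EB L (.inj i p₁) e₁ (.inj i p₂) e₂ (.inj i p') e₁' e₂'

/-- `FT L M₁ M₂ M₁' M₂' s`: the branches `M₁`, `M₂` of two case expressions are freshened to `M₁'`,
`M₂'`, the first `s` of them to shared patterns. -/
inductive FT (L : Finset Var) : List (Pat I × Expr I) → List (Pat I × Expr I) →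
    List (Pat I × Expr I) → List (Pat I × Expr I) → ℕ → Prop
  | singleton (p₁ p₂ p : Pat I) (e₁ e₂ e₁' e₂' : Expr I) (h : EB L p₁ e₁ p₂ e₂ p e₁' e₂') :
      FT L [(p₁, e₁)] [(p₂, e₂)] [(p, e₁')] [(p, e₂')] 1
  | success (p₁ p₂ p : Pat I) (e₁ e₂ e₁' e₂' : Expr I) (r₁ r₂ r₁' r₂' : List (Pat I × Expr I))
      (s : ℕ) (h : EB L p₁ e₁ p₂ e₂ p e₁' e₂') (hr : FT L r₁ r₂ r₁' r₂' s) :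
      FT L ((p₁, e₁) :: r₁) ((p₂, e₂) :: r₂) ((p, e₁') :: r₁') ((p, e₂') :: r₂') (s + 1)
  | failure (M₁ M₂ M₁' M₂' : List (Pat I × Expr I))
      (h₁ : List.Forall₂ (fun m m' => Freshen L m.1 m.2 m'.1 m'.2) M₁ M₁')
      (h₂ : List.Forall₂ (fun m m' => Freshen L m.1 m.2 m'.1 m'.2) M₂ M₂') :
      FT L M₁ M₂ M₁' M₂' 0

end Dynamic

/-! ### Formula generation -/

section FormulaGeneration

variable {D : Type u} {I : Type v}

/-- The variables in use when `e₁` and `e₂` are compared in the context `Γ`. -/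
def inUse (Γ : Ctx D) (e₁ e₂ : Expr I) : Finset Var := Γ.dom.toFinset ∪ e₁.vars ∪ e₂.vars

/-- The function parts of the applications that may be replaced by a fresh variable: variables,
primitive operations and fixed points. -/
inductive Replaceable : Expr I → Prop
  | var (x : Var) : Replaceable (.var x)
  | prim (o : PrimOp) : Replaceable (.prim o)
  | fix (x : Var) (e : Expr I) : Replaceable (.fix x e)

/-- The formula `Ψ` for two case expressions on `x` the first `s` branches of which share their
patterns. -/
def Formula.shared {n : ℕ} (x : Var) (p : Fin n → Pat I) (s : ℕ) (f : Fin n → Formula I) :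
    Formula I :=
  .conj fun i => if i.val < s then f i else .imp (.guard (.var x) p i) (f i)

/-- The branches of a case expression as a list. -/
def branches {n : ℕ} (p : Fin n → Pat I) (b : Fin n → Expr I) : List (Pat I × Expr I) :=
  List.ofFn fun i => (p i, b i)

mutual

/-- `Γ ⊢ e₁ ⇔(σ) e₂ : τ ⊣ Γ'`.
It is a presupposition of this judgment and the next that `Γ ⊢ e₁ : τ` and `Γ ⊢ e₂ : τ`. -/
inductive Iso (S : Signature D I) :
    Ctx D → Expr I → Expr I → Formula I → Ty D → Ctx D → Prop
  | whnf (Γ : Ctx D) (e₁ e₂ e₁' e₂' : Expr I) (σ : Formula I) (τ : Ty D) (Γ' : Ctx D)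
      (ht₁ : HasType S Γ e₁ τ) (ht₂ : HasType S Γ e₂ τ)
      (h₁ : Whnf e₁ e₁') (h₂ : Whnf e₂ e₂') (h : IsoN S Γ e₁' e₂' σ τ Γ') :
      Iso S Γ e₁ e₂ σ τ Γ'

/-- `Γ ⊢ e₁ ↔(σ) e₂ : τ ⊣ Γ'`. -/
inductive IsoN (S : Signature D I) :
    Ctx D → Expr I → Expr I → Formula I → Ty D → Ctx D → Prop
  | atomic (Γ : Ctx D) (e₁ e₂ : Expr I) (t₁ t₂ : Term I) (τ : Ty D)
      (ht₁ : HasType S Γ e₁ τ) (ht₂ : HasType S Γ e₂ τ)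
      (h₁ : IsTerm e₁ t₁) (h₂ : IsTerm e₂ t₂) :
      IsoN S Γ e₁ e₂ (.equiv t₁ t₂) τ []
  | record (Γ : Ctx D) {n : ℕ} (l : Fin n ↪ Label) (e e' : Fin n → Expr I)
      (σ : Fin n → Formula I) (τ : Fin n → Ty D) (Γ' : Fin n → Ctx D)
      (ht₁ : HasType S Γ (.record l e) (.record l τ))
      (ht₂ : HasType S Γ (.record l e') (.record l τ))
      (h : ∀ i, Iso S Γ (e i) (e' i) (σ i) (τ i) (Γ' i))
      (hd : (Ctx.dom (List.ofFn Γ').flatten).Nodup) :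
      IsoN S Γ (.record l e) (.record l e') (.conj σ) (.record l τ) (List.ofFn Γ').flatten
  | proj (Γ : Ctx D) (e₁ e₂ : Expr I) {n : ℕ} (l : Fin n ↪ Label) (τ : Fin n → Ty D) (i : Fin n)
      (σ : Formula I) (Γ' : Ctx D)
      (ht₁ : HasType S Γ (.proj e₁ (l i)) (τ i)) (ht₂ : HasType S Γ (.proj e₂ (l i)) (τ i))
      (h : IsoN S Γ e₁ e₂ σ (.record l τ) Γ') :
      IsoN S Γ (.proj e₁ (l i)) (.proj e₂ (l i)) σ (τ i) Γ'
  | inj (Γ : Ctx D) (i : I) (e₁ e₂ : Expr I) (σ : Formula I) (τ : Ty D) (Γ' : Ctx D)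
      (ht₁ : HasType S Γ (.inj i e₁) (.data (S.res i)))
      (ht₂ : HasType S Γ (.inj i e₂) (.data (S.res i)))
      (hi : S.arg i = some τ) (h : Iso S Γ e₁ e₂ σ τ Γ') :
      IsoN S Γ (.inj i e₁) (.inj i e₂) σ (.data (S.res i)) Γ'
  | lam (Γ : Ctx D) (x x₁ x₂ : Var) (e₁ e₂ : Expr I) (σ : Formula I) (τ τ' : Ty D) (Γ' : Ctx D)
      (ht₁ : HasType S Γ (.lam x₁ e₁) (.arrow τ τ'))
      (ht₂ : HasType S Γ (.lam x₂ e₂) (.arrow τ τ'))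
      (hx : x ∉ inUse Γ (.lam x₁ e₁) (.lam x₂ e₂))
      (h : Iso S ((x, τ) :: Γ) (e₁.subst₁ x₁ (.var x)) (e₂.subst₁ x₂ (.var x)) σ τ' Γ') :
      IsoN S Γ (.lam x₁ e₁) (.lam x₂ e₂) σ (.arrow τ τ') ((x, τ) :: Γ')
  | fix (Γ : Ctx D) (x x₁ x₂ : Var) (e₁ e₂ : Expr I) (σ : Formula I) (τ : Ty D) (Γ' : Ctx D)
      (ht₁ : HasType S Γ (.fix x₁ e₁) τ) (ht₂ : HasType S Γ (.fix x₂ e₂) τ)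
      (hx : x ∉ inUse Γ (.fix x₁ e₁) (.fix x₂ e₂))
      (h : Iso S ((x, τ) :: Γ) (e₁.subst₁ x₁ (.var x)) (e₂.subst₁ x₂ (.var x)) σ τ Γ') :
      IsoN S Γ (.fix x₁ e₁) (.fix x₂ e₂) σ τ ((x, τ) :: Γ')
  | app (Γ : Ctx D) (e₁ e₁' e₂ e₂' : Expr I) (σ σ' : Formula I) (τ τ' : Ty D) (Γ' Γ'' : Ctx D)
      (ht₁ : HasType S Γ (.app e₁ e₁') τ') (ht₂ : HasType S Γ (.app e₂ e₂') τ')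
      (h : IsoN S Γ e₁ e₂ σ (.arrow τ τ') Γ') (h' : Iso S Γ e₁' e₂' σ' τ Γ'')
      (hd : (Ctx.dom (Γ' ++ Γ'')).Nodup) :
      IsoN S Γ (.app e₁ e₁') (.app e₂ e₂') (.and σ σ') τ' (Γ' ++ Γ'')
  /-- The rules for an application of a variable, a primitive operation or a fixed point on the
  left. -/
  | app_left (Γ : Ctx D) (y : Var) (f a e : Expr I) (σ : Formula I) (τ : Ty D) (Γ' : Ctx D)
      (ht₁ : HasType S Γ (.app f a) τ) (ht₂ : HasType S Γ e τ) (hf : Replaceable f)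
      (hy : y ∉ inUse Γ (.app f a) e)
      (h : IsoN S ((y, τ) :: Γ) (.var y) (replaceApp f a y e) σ τ Γ') :
      IsoN S Γ (.app f a) e σ τ ((y, τ) :: Γ')
  /-- The rules for an application of a variable, a primitive operation or a fixed point on the
  right. -/
  | app_right (Γ : Ctx D) (y : Var) (f a e : Expr I) (σ : Formula I) (τ : Ty D) (Γ' : Ctx D)
      (ht₁ : HasType S Γ e τ) (ht₂ : HasType S Γ (.app f a) τ) (hf : Replaceable f)
      (hy : y ∉ inUse Γ e (.app f a))
      (h : IsoN S ((y, τ) :: Γ) (replaceApp f a y e) (.var y) σ τ Γ') :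
      IsoN S Γ e (.app f a) σ τ ((y, τ) :: Γ')
  | case_left (Γ : Ctx D) (e : Expr I) (t : Term I) {n : ℕ} (p p' : Fin n → Pat I)
      (b b' : Fin n → Expr I) (e' : Expr I) (σ : Fin n → Formula I) (τ τ' : Ty D)
      (Δ Γ' : Fin n → Ctx D)
      (ht₁ : HasType S Γ (.case e p b) τ) (ht₂ : HasType S Γ e' τ)
      (ht : IsTerm e t) (hte : HasType S Γ e τ')
      (hf : ∀ i, Freshen (inUse Γ (.case e p b) e') (p i) (b i) (p' i) (b' i))
      (hp : ∀ i, PatTy S (p' i) τ' (Δ i))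
      (h : ∀ i, Iso S (Δ i ++ Γ) (b' i) e' (σ i) τ (Γ' i))
      (hd : (Ctx.dom (List.ofFn fun i => Δ i ++ Γ' i).flatten).Nodup) :
      IsoN S Γ (.case e p b) e' (.conj fun i => .imp (.guard t p' i) (σ i)) τ
        (List.ofFn fun i => Δ i ++ Γ' i).flatten
  | case_right (Γ : Ctx D) (e : Expr I) (t : Term I) {n : ℕ} (p p' : Fin n → Pat I)
      (b b' : Fin n → Expr I) (e' : Expr I) (σ : Fin n → Formula I) (τ τ' : Ty D)
      (Δ Γ' : Fin n → Ctx D)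
      (ht₁ : HasType S Γ e' τ) (ht₂ : HasType S Γ (.case e p b) τ)
      (ht : IsTerm e t) (hte : HasType S Γ e τ')
      (hf : ∀ i, Freshen (inUse Γ e' (.case e p b)) (p i) (b i) (p' i) (b' i))
      (hp : ∀ i, PatTy S (p' i) τ' (Δ i))
      (h : ∀ i, Iso S (Δ i ++ Γ) (b' i) e' (σ i) τ (Γ' i))
      (hd : (Ctx.dom (List.ofFn fun i => Δ i ++ Γ' i).flatten).Nodup) :
      IsoN S Γ e' (.case e p b) (.conj fun i => .imp (.guard t p' i) (σ i)) τ
        (List.ofFn fun i => Δ i ++ Γ' i).flatten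
  | case_case (Γ : Ctx D) (x : Var) (e e' : Expr I) {n m : ℕ} (p : Fin n → Pat I)
      (b : Fin n → Expr I) (p' : Fin m → Pat I) (b' : Fin m → Expr I) (σ σ' : Formula I)
      (τ τ' : Ty D) (Γ' Γ'' : Ctx D)
      (ht₁ : HasType S Γ (.case e p b) τ) (ht₂ : HasType S Γ (.case e' p' b') τ)
      (h : IsoN S Γ e e' σ τ' Γ')
      (hx : x ∉ inUse Γ (.case e p b) (.case e' p' b'))
      (h' : IsoN S ((x, τ') :: Γ) (.case (.var x) p b) (.case (.var x) p' b') σ' τ Γ'')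
      (hd : (Ctx.dom (Γ' ++ (x, τ') :: Γ'')).Nodup) :
      IsoN S Γ (.case e p b) (.case e' p' b') (.and σ σ') τ (Γ' ++ (x, τ') :: Γ'')
  | case_shared_left (Γ : Ctx D) (x : Var) {n m : ℕ} (p q : Fin n → Pat I) (b c : Fin n → Expr I)
      (p' q' : Fin m → Pat I) (b' c' : Fin m → Expr I) (s : ℕ) (hs : s ≤ m)
      (σ : Fin n → Formula I) (τ τ' : Ty D) (Δ Γ' : Fin n → Ctx D)
      (ht₁ : HasType S Γ (.case (.var x) p b) τ) (ht₂ : HasType S Γ (.case (.var x) p' b') τ)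
      (hx : HasType S Γ (.var x) τ')
      (hf : FT (inUse Γ (.case (.var x) p b) (.case (.var x) p' b'))
        (branches p b) (branches p' b') (branches q c) (branches q' c') s)
      (hp : ∀ i, PatTy S (q i) τ' (Δ i))
      (h : ∀ (i : Fin n) (hi : i.val < s),
        Iso S (Δ i ++ Γ) (c i) (c' ⟨i.val, hi.trans_le hs⟩) (σ i) τ (Γ' i))
      (h' : ∀ i : Fin n, s ≤ i.val →
        Iso S (Δ i ++ Γ) (c i) (.case (.var x) q' c') (σ i) τ (Γ' i))
      (hd : (Ctx.dom (List.ofFn fun i => Δ i ++ Γ' i).flatten).Nodup)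
      (hd' : ∀ j : Fin m, s ≤ j.val → ∀ i : Fin n, (q' j).vars.Disjoint (q i).vars)
      (hl : ∀ j : Fin m, (q' j).Linear) :
      IsoN S Γ (.case (.var x) p b) (.case (.var x) p' b') (.shared x q s σ) τ
        (List.ofFn fun i => Δ i ++ Γ' i).flatten
  | case_shared_right (Γ : Ctx D) (x : Var) {n m : ℕ} (p q : Fin n → Pat I)
      (b c : Fin n → Expr I) (p' q' : Fin m → Pat I) (b' c' : Fin m → Expr I) (s : ℕ)
      (hs : s ≤ m) (σ : Fin n → Formula I) (τ τ' : Ty D) (Δ Γ' : Fin n → Ctx D)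
      (ht₁ : HasType S Γ (.case (.var x) p' b') τ) (ht₂ : HasType S Γ (.case (.var x) p b) τ)
      (hx : HasType S Γ (.var x) τ')
      (hf : FT (inUse Γ (.case (.var x) p' b') (.case (.var x) p b))
        (branches p' b') (branches p b) (branches q' c') (branches q c) s)
      (hp : ∀ i, PatTy S (q i) τ' (Δ i))
      (h : ∀ (i : Fin n) (hi : i.val < s),
        Iso S (Δ i ++ Γ) (c i) (c' ⟨i.val, hi.trans_le hs⟩) (σ i) τ (Γ' i))
      (h' : ∀ i : Fin n, s ≤ i.val →
        Iso S (Δ i ++ Γ) (.case (.var x) q' c') (c i) (σ i) τ (Γ' i))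
      (hd : (Ctx.dom (List.ofFn fun i => Δ i ++ Γ' i).flatten).Nodup)
      (hd' : ∀ j : Fin m, s ≤ j.val → ∀ i : Fin n, (q' j).vars.Disjoint (q i).vars)
      (hl : ∀ j : Fin m, (q' j).Linear) :
      IsoN S Γ (.case (.var x) p' b') (.case (.var x) p b) (.shared x q s σ) τ
        (List.ofFn fun i => Δ i ++ Γ' i).flatten

end

/-! ### Extensional equivalence -/

/-- The defining clauses of extensional equivalence, for a relation `R` between closed expressions
of each type. Nothing is required of two expressions one of which does not evaluate to a value.
Two values of a type that is not an arrow type are compared by all patterns of that type: either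
both match and bind each variable to equivalent values, or neither matches. -/
def IsExtEq (S : Signature D I) (R : Ty D → Expr I → Expr I → Prop) : Prop :=
  ∀ τ e₁ e₂, R τ e₁ e₂ →
    HasType S [] e₁ τ ∧ HasType S [] e₂ τ ∧
    ∀ v₁ v₂, Evals e₁ v₁ → Evals e₂ v₂ →
      (∀ τ₁ τ₂, τ = .arrow τ₁ τ₂ →
        ∀ a, HasType S [] a τ₁ → R τ₂ (.app v₁ a) (.app v₂ a)) ∧
      ((∀ τ₁ τ₂, τ ≠ .arrow τ₁ τ₂) →
        ∀ p Δ, PatTy S p τ Δ → p.Linear →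
          (∃ B₁ B₂, Matches v₁ p B₁ ∧ Matches v₂ p B₂ ∧
            ∀ x τ', (x, τ') ∈ Δ →
              ∃ w₁ w₂, (x, w₁) ∈ B₁ ∧ (x, w₂) ∈ B₂ ∧ R τ' w₁ w₂) ∨
          (NoMatch v₁ p ∧ NoMatch v₂ p))

/-- Extensional equivalence `e₁ ≅ e₂ : τ`: the largest relation with the defining clauses. They are
not a recursion on `τ`, because data types may be recursive. -/
def ExtEq (S : Signature D I) (τ : Ty D) (e₁ e₂ : Expr I) : Prop :=
  ∃ R : Ty D → Expr I → Expr I → Prop, IsExtEq S R ∧ R τ e₁ e₂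

end FormulaGeneration

end LambdaPix

-- Extensional equivalence asks nothing of a pair of expressions one of which has no value, so the
-- invariant to carry through formula generation is not equality of meanings but coherence: nothing
-- that is known about one expression contradicts anything known about the other. An expression is
-- interpreted by `Sem` as a set of finite tokens, as in a filter model; a variable may stand for
-- any set of tokens, also the empty one. `Tok.Coh` relates two tokens at a type like a logical
-- relation, but by recursion on the token, since data types may be recursive. Two sets are coherent
-- if all pairs of their tokens are.
--
-- Coherence of sets passes to subsets, hence inclusions suffice throughout. Evaluation can only
-- lose tokens (`Step.sem_subset`); weak head reduction, replacement of an application by a variable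
-- and freshening can only gain them (`Whnf.sem_subset`, `sem_subset_replaceApp`,
-- `Refine.sem_subset`). So coherence of the reducts that formula generation compares gives
-- coherence of the original expressions, and this gives coherence of their values. The fundamental
-- lemma `HasType.cohSet` says that every typed expression is coherent with itself in coherent
-- environments.
--
-- The core is `Iso.sound`, an induction on the derivation. Its difficulty is that the formula
-- speaks of one closed value for each variable, while the rules for functions, fixed points,
-- replaced applications and two case expressions confront two different, merely coherent sets of
-- tokens for the same variable. `exists_extension` bridges this gap. Coherent tokens agree in
-- everything except their functions, so the variable can receive a single value of that common
-- shape with a fresh function, an `atom`, at every function position. The disagreement is moved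
-- into two coherent interpretations `θ₁`, `θ₂` of functions, which the formula cannot see.
--
-- For the case rules, a term has exactly one value under a substitution of values
-- (`IsTerm.exists_value`), and any token of that value decides which pattern is the first to match.
-- `exists_branch` turns the match into values for the pattern variables that make the guard of the
-- branch true, so the formula of the branch becomes available.
--
-- Finally, coherence of closed expressions satisfies the defining clauses of extensional
-- equivalence (`isExtEq_cohExpr`), hence is contained in the largest such relation.

namespace LambdaPix

universe u v

-- Token semantics: monotonicity, substitution, continuity.

section Semantics

variable {I : Type v}

/-- Finite pieces of information about a value. `fn` says that it is a function, and `arr A b` that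
it is a function that returns a value with `b` for every argument that has all of `A`. -/
inductive Tok (I : Type v) : Type v where
  | const (c : Const)
  | record {n : ℕ} (l : Fin n ↪ Label) (t : Fin n → Tok I)
  | inj (i : I) (t : Tok I)
  | inj₀ (i : I)
  | fn
  -- The family of arguments is never empty: under call-by-value an application has a token only if
  -- its argument has one.
  | arr {n : ℕ} (A : Fin (n + 1) → Tok I) (b : Tok I)

/-- Environments; a variable stands for the set of what is known about its value. -/
abbrev Env (I : Type v) := Var → Set (Tok I)

/-- The token suffices to see that a value matches the pattern. -/
inductive TMatch : Tok I → Pat I → Prop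
  | wild (t : Tok I) : TMatch t .wild
  | var (t : Tok I) (x : Var) : TMatch t (.var x)
  | record {n : ℕ} (l : Fin n ↪ Label) (t : Fin n → Tok I) (p : Fin n → Pat I)
      (h : ∀ i, TMatch (t i) (p i)) : TMatch (.record l t) (.record l p)
  | asP (t : Tok I) (x : Var) (p : Pat I) (h : TMatch t p) : TMatch t (.asP x p)
  | const (c : Const) : TMatch (.const c) (.const c)
  | inj (i : I) (t : Tok I) (p : Pat I) (h : TMatch t p) : TMatch (.inj i t) (.inj i p)
  | inj₀ (i : I) : TMatch (.inj₀ i) (.inj₀ i)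

/-- `TBind t p x w`: matching `t` against `p` binds `x` to `w`. -/
inductive TBind : Tok I → Pat I → Var → Tok I → Prop
  | var (t : Tok I) (x : Var) : TBind t (.var x) x t
  | record {n : ℕ} (l : Fin n ↪ Label) (t : Fin n → Tok I) (p : Fin n → Pat I) (i : Fin n)
      (x : Var) (w : Tok I) (h : TBind (t i) (p i) x w) : TBind (.record l t) (.record l p) x w
  | as_self (t : Tok I) (x : Var) (p : Pat I) : TBind t (.asP x p) x t
  | asP (t : Tok I) (x y : Var) (p : Pat I) (w : Tok I) (h : TBind t p y w) :
      TBind t (.asP x p) y w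
  | inj (i : I) (t : Tok I) (p : Pat I) (x : Var) (w : Tok I) (h : TBind t p x w) :
      TBind (.inj i t) (.inj i p) x w

/-- What matching a value with the tokens `P` against `p` says about `x`. -/
def bindSet (p : Pat I) (P : Set (Tok I)) (x : Var) : Set (Tok I) :=
  {w | ∃ t ∈ P, TBind t p x w}

open Classical in
/-- The environment for the branch of the pattern `p`. -/
noncomputable def bindEnv (ρ : Env I) (p : Pat I) (P : Set (Tok I)) : Env I :=
  fun x => if x ∈ p.vars then bindSet p P x else ρ x

/-- The least prefixed point. -/
def fixSet {α : Type*} (F : Set α → Set α) : Set α := {t | ∀ X, F X ⊆ X → t ∈ X}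

def pairTok (a b : ℤ) : Tok I := .record pairLabels ![.const (.int a), .const (.int b)]

/-- It suffices that one argument token is a pair of integers; the others are arbitrary. A family
with two different pairs yields both results, which does no harm because such families are excluded
by coherence in `primSet_coh`. -/
def primSet (o : PrimOp) : Set (Tok I) :=
  {t | t = .fn ∨ ∃ (n : ℕ) (A : Fin (n + 1) → Tok I) (a b : ℤ),
    (∃ i, A i = pairTok a b) ∧ t = .arr A (.const (o.eval a b))}

/-- The tokens of the value of an expression. -/
noncomputable def Sem : Expr I → Env I → Set (Tok I)
  | .const c, _ => {.const c}
  | .var x, ρ => ρ x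
  | .record l e, ρ => {t | ∃ u, t = .record l u ∧ ∀ i, u i ∈ Sem (e i) ρ}
  | .proj e k, ρ => {t | ∃ (n : ℕ) (l : Fin n ↪ Label) (u : Fin n → Tok I) (i : Fin n),
      .record l u ∈ Sem e ρ ∧ l i = k ∧ t = u i}
  | .inj i e, ρ => {t | ∃ u, t = .inj i u ∧ u ∈ Sem e ρ}
  | .inj₀ i, _ => {.inj₀ i}
  -- Every token carries the whole first-order shape of a value, so a single `u` decides which
  -- branch is the first to match. The bindings nevertheless collect what all tokens of the
  -- scrutinee say.
  | .case e p b, ρ => {t | ∃ i, (∃ u ∈ Sem e ρ, TMatch u (p i) ∧ ∀ j, j < i → ¬ TMatch u (p j)) ∧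
      t ∈ Sem (b i) (bindEnv ρ (p i) (Sem e ρ))}
  -- `.fn` belongs to every abstraction, so that even one whose body never returns has a token.
  | .lam x e, ρ => {t | t = .fn ∨ ∃ (n : ℕ) (A : Fin (n + 1) → Tok I) (b : Tok I),
      t = .arr A b ∧ b ∈ Sem e (Function.update ρ x (Set.range A))}
  | .app e₁ e₂, ρ => {t | ∃ (n : ℕ) (A : Fin (n + 1) → Tok I), .arr A t ∈ Sem e₁ ρ ∧
      ∀ i, A i ∈ Sem e₂ ρ}
  | .fix x e, ρ => fixSet fun X => Sem e (Function.update ρ x X)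
  | .prim o, _ => primSet o

theorem fixSet_mono {α : Type*} {F G : Set α → Set α} (h : ∀ X, F X ⊆ G X) :
    fixSet F ⊆ fixSet G := fun _ ht X hX => ht X ((h X).trans hX)

theorem fixSet_subset {α : Type*} {F : Set α → Set α} {X : Set α} (h : F X ⊆ X) :
    fixSet F ⊆ X := fun _ ht => ht X h

theorem fixSet_prefixed {α : Type*} {F : Set α → Set α} (hF : Monotone F) :
    F (fixSet F) ⊆ fixSet F := fun _ ht _ hX => hX (hF (fixSet_subset hX) ht)

theorem fixSet_postfixed {α : Type*} {F : Set α → Set α} (hF : Monotone F) :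
    fixSet F ⊆ F (fixSet F) := fixSet_subset (hF (fixSet_prefixed hF))

theorem TBind.mem_vars {t : Tok I} {p : Pat I} {x : Var} {w : Tok I} (h : TBind t p x w) :
    x ∈ p.vars := by
  induction h with
  | var => simp [Pat.vars]
  | record l t p i x w _ ih =>
    simp only [Pat.vars, List.mem_flatten, List.mem_ofFn]
    exact ⟨_, ⟨i, rfl⟩, ih⟩
  | as_self => simp [Pat.vars]
  | asP _ _ _ _ _ _ ih => simp [Pat.vars, ih]
  | inj _ _ _ _ _ _ ih => simpa [Pat.vars] using ih

theorem Pat.mem_vars_record {n : ℕ} {l : Fin n ↪ Label} {p : Fin n → Pat I} {x : Var} :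
    x ∈ (Pat.record l p).vars ↔ ∃ i, x ∈ (p i).vars := by
  simp only [Pat.vars, List.mem_flatten, List.mem_ofFn]
  constructor
  · rintro ⟨_, ⟨i, rfl⟩, h⟩; exact ⟨i, h⟩
  · rintro ⟨i, h⟩; exact ⟨_, ⟨i, rfl⟩, h⟩

theorem bindSet_mono (p : Pat I) {P Q : Set (Tok I)} (h : P ⊆ Q) (x : Var) :
    bindSet p P x ⊆ bindSet p Q x := fun _ ⟨t, ht, hb⟩ => ⟨t, h ht, hb⟩

/-- Monotonicity in the variables that are free in the expression. -/
theorem Sem_mono (e : Expr I) : ∀ {ρ ρ' : Env I}, (∀ x ∈ e.fv, ρ x ⊆ ρ' x) →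
    Sem e ρ ⊆ Sem e ρ' := by
  induction e with
  | const c => intro ρ ρ' _; exact subset_rfl
  | var x => intro ρ ρ' h; exact h x (by simp [Expr.fv])
  | record l e ih =>
    rintro ρ ρ' h t ⟨u, rfl, hu⟩
    exact ⟨u, rfl, fun i => ih i (fun x hx => h x (by
      simp only [Expr.fv, Finset.mem_biUnion, Finset.mem_univ, true_and]; exact ⟨i, hx⟩)) (hu i)⟩
  | proj e k ih =>
    rintro ρ ρ' h t ⟨n, l, u, i, hu, hl, ht⟩
    exact ⟨n, l, u, i, ih h hu, hl, ht⟩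
  | inj i e ih =>
    rintro ρ ρ' h t ⟨u, rfl, hu⟩
    exact ⟨u, rfl, ih h hu⟩
  | inj₀ i => intro ρ ρ' _; exact subset_rfl
  | case e p b ihe ihb =>
    rintro ρ ρ' h t ⟨i, ⟨u, hu, hm⟩, ht⟩
    have he : Sem e ρ ⊆ Sem e ρ' := ihe fun x hx => h x (by simp [Expr.fv, hx])
    refine ⟨i, ⟨u, he hu, hm⟩, ihb i (fun x hx => ?_) ht⟩
    by_cases hxp : x ∈ (p i).vars
    · simp only [bindEnv, hxp, if_true]; exact bindSet_mono _ he _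
    · simp only [bindEnv, hxp, if_false]
      refine h x ?_
      simp only [Expr.fv, Finset.mem_union, Finset.mem_biUnion, Finset.mem_univ, true_and]
      exact Or.inr ⟨i, by simp [hx, hxp]⟩
  | lam x e ih =>
    rintro ρ ρ' h t (rfl | ⟨n, A, b, rfl, hb⟩)
    · exact Or.inl rfl
    · refine Or.inr ⟨n, A, b, rfl, ih (fun y hy => ?_) hb⟩
      by_cases hyx : y = x
      · subst hyx; simp
      · simp only [Function.update_of_ne hyx]; exact h y (by simp [Expr.fv, hy, hyx])
  | app e₁ e₂ ih₁ ih₂ =>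
    rintro ρ ρ' h t ⟨n, A, hA, hi⟩
    exact ⟨n, A, ih₁ (fun x hx => h x (by simp [Expr.fv, hx])) hA,
      fun i => ih₂ (fun x hx => h x (by simp [Expr.fv, hx])) (hi i)⟩
  | fix x e ih =>
    intro ρ ρ' h
    refine fixSet_mono fun X => ih fun y hy => ?_
    by_cases hyx : y = x
    · subst hyx; simp
    · simp only [Function.update_of_ne hyx]; exact h y (by simp [Expr.fv, hy, hyx])
  | prim o => intro ρ ρ' _; exact subset_rfl

theorem Sem_congr (e : Expr I) {ρ ρ' : Env I} (h : ∀ x ∈ e.fv, ρ x = ρ' x) :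
    Sem e ρ = Sem e ρ' :=
  (Sem_mono e fun x hx => (h x hx).subset).antisymm (Sem_mono e fun x hx => (h x hx).superset)

theorem Sem_monotone (e : Expr I) : Monotone (Sem e) := fun _ _ h => Sem_mono e fun x _ => h x

theorem monotone_Sem_update (e : Expr I) (ρ : Env I) (x : Var) :
    Monotone fun X => Sem e (Function.update ρ x X) :=
  fun _ _ h => Sem_monotone e (update_le_update_iff.2 ⟨h, fun _ _ => le_rfl⟩)

theorem Sem_fix (x : Var) (e : Expr I) (ρ : Env I) :
    Sem e (Function.update ρ x (Sem (.fix x e) ρ)) = Sem (.fix x e) ρ :=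
  (fixSet_prefixed (monotone_Sem_update e ρ x)).antisymm
    (fixSet_postfixed (monotone_Sem_update e ρ x))

/-! ### Substitution -/

theorem Expr.fv_subset_vars (e : Expr I) : e.fv ⊆ e.vars := by
  induction e with
  | const | inj₀ | prim => simp [Expr.fv]
  | var => simp [Expr.fv, Expr.vars]
  | record l e ih =>
    simp only [Expr.fv, Expr.vars]
    exact Finset.biUnion_mono fun i _ => ih i
  | proj e k ih => simpa [Expr.fv, Expr.vars] using ih
  | inj i e ih => simpa [Expr.fv, Expr.vars] using ih
  | case e p b ihe ihb =>
    simp only [Expr.fv, Expr.vars]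
    refine Finset.union_subset_union ihe (Finset.biUnion_mono fun i _ => ?_)
    exact Finset.sdiff_subset.trans ((ihb i).trans Finset.subset_union_left)
  | lam x e ih =>
    simp only [Expr.fv, Expr.vars]
    exact Finset.sdiff_subset.trans (ih.trans (Finset.subset_insert _ _))
  | app e₁ e₂ ih₁ ih₂ => exact Finset.union_subset_union ih₁ ih₂
  | fix x e ih =>
    simp only [Expr.fv, Expr.vars]
    exact Finset.sdiff_subset.trans (ih.trans (Finset.subset_insert _ _))

theorem bump_notMem (s : Var → Expr I) (xs : List Var) (e : Expr I) {x z : Var} (hx : x ∈ xs)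
    (hz : z ∈ e.fv) (hzx : z ∉ xs) : x + bump s xs e ∉ (s z).fv := by
  intro h
  have hmem : x + bump s xs e ∈ (e.fv \ xs.toFinset).biUnion fun z => (s z).fv :=
    Finset.mem_biUnion.2 ⟨z, by simp [hz, hzx], h⟩
  simp only [bump] at hmem
  split_ifs at hmem with hc
  · have := Finset.le_sup (f := id) hmem
    exact Nat.not_le.2 (Nat.lt_of_lt_of_le (Nat.lt_succ_self _) (Nat.le_add_left _ _)) this
  · exact hc ⟨x, hx, hmem⟩

theorem TMatch_rename (f : Var → Var) (p : Pat I) :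
    ∀ t : Tok I, TMatch t (p.rename f) ↔ TMatch t p := by
  induction p with
  | wild => intro t; exact ⟨fun _ => .wild t, fun _ => .wild t⟩
  | var x => intro t; exact ⟨fun _ => .var t _, fun _ => .var t _⟩
  | record l p ih =>
    intro t
    constructor
    · rintro h; cases h with | record l t _ h => exact .record l t p fun i => (ih i _).1 (h i)
    · rintro h; cases h with | record l t _ h => exact .record l t _ fun i => (ih i _).2 (h i)
  | asP x p ih =>
    intro t
    constructor
    · rintro h; cases h with | asP _ _ _ h => exact .asP _ _ _ ((ih _).1 h)
    · rintro h; cases h with | asP _ _ _ h => exact .asP _ _ _ ((ih _).2 h)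
  | const c => intro t; rfl
  | inj i p ih =>
    intro t
    constructor
    · rintro h; cases h with | inj _ _ _ h => exact .inj _ _ _ ((ih _).1 h)
    · rintro h; cases h with | inj _ _ _ h => exact .inj _ _ _ ((ih _).2 h)
  | inj₀ i => intro t; rfl

theorem vars_rename (f : Var → Var) (p : Pat I) : (p.rename f).vars = p.vars.map f := by
  induction p with
  | record l p ih =>
    simp only [Pat.rename, Pat.vars, List.map_flatten, List.map_ofFn]
    congr 2
    funext i
    exact ih i
  | asP x p ih => simp [Pat.rename, Pat.vars, ih]
  | inj i p ih => simpa [Pat.rename, Pat.vars] using ih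
  | _ => simp [Pat.rename, Pat.vars]

theorem TBind.rename (f : Var → Var) {t : Tok I} {p : Pat I} {x : Var} {w : Tok I}
    (h : TBind t p x w) : TBind t (p.rename f) (f x) w := by
  induction h with
  | var t x => exact .var t _
  | record l t p i x w _ ih => exact .record l t _ i _ w ih
  | as_self t x p => exact .as_self t _ _
  | asP t x y p w _ ih => exact .asP t _ _ _ w ih
  | inj i t p x w _ ih => exact .inj i t _ _ w ih

theorem TBind.of_rename {f : Var → Var} (hf : Function.Injective f) (p : Pat I) :
    ∀ {t : Tok I} {x : Var} {w : Tok I}, TBind t (p.rename f) (f x) w → TBind t p x w := by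
  induction p with
  | wild | const | inj₀ => intro t x w h; cases h
  | var y =>
    intro t x w h
    generalize hz : f x = z at h
    cases h
    exact hf hz ▸ .var t _
  | record l p ih =>
    intro t x w h; cases h with | record l t _ i _ _ h => exact .record l t p i x w (ih i h)
  | asP y p ih =>
    intro t x w h
    generalize hz : f x = z at h
    cases h with
    | as_self => exact hf hz ▸ .as_self t _ _
    | asP _ _ _ _ _ h => subst hz; exact .asP _ _ _ _ _ (ih h)
  | inj i p ih =>
    intro t x w h; cases h with | inj _ t _ _ _ h => exact .inj i t p x w (ih h)

theorem bindSet_rename {f : Var → Var} (hf : Function.Injective f) (p : Pat I) (P : Set (Tok I))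
    (x : Var) : bindSet (p.rename f) P (f x) = bindSet p P x := by
  ext w
  exact ⟨fun ⟨t, ht, h⟩ => ⟨t, ht, h.of_rename hf⟩, fun ⟨t, ht, h⟩ => ⟨t, ht, h.rename f⟩⟩

/-- The bound variable finds `X` under its shifted name, and by `bump_notMem` no expression put in
for another variable of the body can see that name. -/
theorem Sem_under (ρ : Env I) (s : Var → Expr I) (x : Var) (e : Expr I) (X : Set (Tok I))
    (ih : ∀ (s : Var → Expr I) (ρ : Env I), Sem (e.subst s) ρ = Sem e fun z => Sem (s z) ρ) :
    Sem (e.subst (under s [x] (bump s [x] e))) (Function.update ρ (x + bump s [x] e) X) =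
      Sem e (Function.update (fun z => Sem (s z) ρ) x X) := by
  rw [ih]
  refine Sem_congr _ fun z hz => ?_
  by_cases hzx : z = x
  · subst hzx; simp [under, Sem]
  · simp only [under, List.mem_singleton, hzx, if_false, Function.update_of_ne hzx]
    refine Sem_congr _ fun y hy => Function.update_of_ne ?_ _ _
    rintro rfl
    exact bump_notMem s [x] e (by simp) hz (by simpa using hzx) hy

/-- The expressions put in need not be values, because an environment may hold any sets of tokens.
The unfolding of fixed points and call-by-name contraction depend on this. -/
theorem Sem_subst (e : Expr I) :
    ∀ (s : Var → Expr I) (ρ : Env I), Sem (e.subst s) ρ = Sem e fun z => Sem (s z) ρ := by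
  induction e with
  | const | inj₀ | prim => intro s ρ; simp [Expr.subst, Sem]
  | var x => intro s ρ; simp [Expr.subst, Sem]
  | record l e ih => intro s ρ; simp [Expr.subst, Sem, ih]
  | proj e k ih => intro s ρ; simp [Expr.subst, Sem, ih]
  | inj i e ih => intro s ρ; simp [Expr.subst, Sem, ih]
  | app e₁ e₂ ih₁ ih₂ => intro s ρ; simp [Expr.subst, Sem, ih₁, ih₂]
  | lam x e ih =>
    intro s ρ
    simp only [Expr.subst, Sem, Sem_under ρ s x e _ ih]
  | fix x e ih =>
    intro s ρ
    simp only [Expr.subst, Sem, Sem_under ρ s x e _ ih]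
  | case e p b ihe ihb =>
    intro s ρ
    have key : ∀ i P, Sem ((b i).subst (under s (p i).vars (bump s (p i).vars (b i))))
        (bindEnv ρ ((p i).rename fun x => x + bump s (p i).vars (b i)) P) =
        Sem (b i) (bindEnv (fun z => Sem (s z) ρ) (p i) P) := by
      intro i P
      set k := bump s (p i).vars (b i) with hk
      have hinj : Function.Injective fun x : Var => x + k := add_left_injective k
      rw [ihb]
      refine Sem_congr _ fun z hz => ?_
      by_cases hzx : z ∈ (p i).vars
      · have : z + k ∈ ((p i).rename fun x => x + k).vars := by
          rw [vars_rename]; exact List.mem_map.2 ⟨z, hzx, rfl⟩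
        simp only [under, hzx, if_true, Sem, bindEnv, this]
        exact bindSet_rename hinj (p i) P z
      · simp only [under, hzx, if_false, bindEnv]
        refine Sem_congr _ fun y hy => ?_
        rw [bindEnv, if_neg]
        rw [vars_rename]
        intro hmem
        obtain ⟨x, hx, rfl⟩ := List.mem_map.1 hmem
        exact bump_notMem s (p i).vars (b i) hx hz hzx hy
    simp only [Expr.subst, Sem, ihe, TMatch_rename, key]

theorem Sem_subst₁ (e : Expr I) (x : Var) (e' : Expr I) (ρ : Env I) :
    Sem (e.subst₁ x e') ρ = Sem e (Function.update ρ x (Sem e' ρ)) := by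
  rw [Expr.subst₁, Sem_subst]
  congr 1
  funext z
  by_cases h : z = x
  · subst h; simp
  · simp [Function.update_of_ne h, Sem]

/-! ### Continuity -/

/-- A union of two pointwise finite environments is pointwise finite, so approximation of single
tokens extends to finite sets of tokens. -/
theorem Sem_approx_finite {f : Env I → Set (Tok I)} (hf : Monotone f) {ρ : Env I}
    (h : ∀ t ∈ f ρ, ∃ ρ₀ : Env I, (∀ x, (ρ₀ x).Finite) ∧ ρ₀ ≤ ρ ∧ t ∈ f ρ₀)
    {T : Set (Tok I)} (hT : T.Finite) (hTf : T ⊆ f ρ) :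
    ∃ ρ₀ : Env I, (∀ x, (ρ₀ x).Finite) ∧ ρ₀ ≤ ρ ∧ T ⊆ f ρ₀ := by
  induction T, hT using Set.Finite.induction_on with
  | empty => exact ⟨fun _ => ∅, fun _ => Set.finite_empty, fun _ => Set.empty_subset _, by simp⟩
  | @insert a T _ _ ih =>
    obtain ⟨ρ₁, h₁, l₁, m₁⟩ := ih ((Set.subset_insert _ _).trans hTf)
    obtain ⟨ρ₂, h₂, l₂, m₂⟩ := h a (hTf (Set.mem_insert _ _))
    refine ⟨ρ₁ ⊔ ρ₂, fun x => (h₁ x).union (h₂ x), sup_le l₁ l₂, Set.insert_subset ?_ ?_⟩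
    · exact hf le_sup_right m₂
    · exact m₁.trans (hf le_sup_left)

/-- What the approximation has at `x` lies below `X` and not below `ρ x`; therefore it is recorded
separately as `X₀` and erased from `ρ₀`. -/
theorem approx_update {f : Env I → Set (Tok I)} {ρ : Env I} {x : Var}
    {X : Set (Tok I)} {t : Tok I}
    (h : ∃ ρ₀ : Env I, (∀ x, (ρ₀ x).Finite) ∧ ρ₀ ≤ Function.update ρ x X ∧ t ∈ f ρ₀) :
    ∃ (ρ₀ : Env I) (X₀ : Set (Tok I)), (∀ x, (ρ₀ x).Finite) ∧ X₀.Finite ∧ ρ₀ ≤ ρ ∧ X₀ ⊆ X ∧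
      t ∈ f (Function.update ρ₀ x X₀) := by
  obtain ⟨ρ₀, hfin, hle, ht⟩ := h
  refine ⟨Function.update ρ₀ x ∅, ρ₀ x, fun y => ?_, hfin x, fun y => ?_, ?_, ?_⟩
  · by_cases hy : y = x
    · subst hy; simp
    · simpa [Function.update_of_ne hy] using hfin y
  · by_cases hy : y = x
    · subst hy; simp
    · have := hle y
      simpa [Function.update_of_ne hy] using this
  · simpa using hle x
  · simpa using ht

/-- Continuity: a token of `e` has a finite reason, which consults only finitely many tokens of each
variable. This is what lets an argument be replaced by a finite family in a token `.arr A b`. -/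
theorem Sem_approx (e : Expr I) : ∀ (ρ : Env I) (t : Tok I), t ∈ Sem e ρ →
    ∃ ρ₀ : Env I, (∀ x, (ρ₀ x).Finite) ∧ ρ₀ ≤ ρ ∧ t ∈ Sem e ρ₀ := by
  have hbot : ∀ ρ : Env I, (fun _ => ∅ : Env I) ≤ ρ := fun ρ x => Set.empty_subset _
  induction e with
  | const | inj₀ | prim =>
    intro ρ t h
    exact ⟨fun _ => ∅, fun _ => Set.finite_empty, hbot ρ, h⟩
  | var x =>
    intro ρ t h
    refine ⟨fun y => if y = x then {t} else ∅, fun y => ?_, fun y => ?_, by simp [Sem]⟩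
    · dsimp only; split_ifs <;> simp
    · dsimp only
      split_ifs with hy
      · subst hy; exact Set.singleton_subset_iff.2 h
      · exact Set.empty_subset _
  | record l e ih =>
    rintro ρ t ⟨u, rfl, hu⟩
    choose r hr hle hm using fun i => ih i ρ (u i) (hu i)
    refine ⟨fun x => ⋃ i, r i x, fun x => Set.finite_iUnion fun i => hr i x,
      fun x => Set.iUnion_subset fun i => hle i x, u, rfl, fun i => ?_⟩
    exact Sem_monotone _ (fun x => Set.subset_iUnion (fun i => r i x) i) (hm i)
  | proj e k ih =>
    rintro ρ t ⟨n, l, u, i, hu, hl, ht⟩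
    obtain ⟨r, h₁, h₂, h₃⟩ := ih ρ _ hu
    exact ⟨r, h₁, h₂, n, l, u, i, h₃, hl, ht⟩
  | inj i e ih =>
    rintro ρ t ⟨u, rfl, hu⟩
    obtain ⟨r, h₁, h₂, h₃⟩ := ih ρ _ hu
    exact ⟨r, h₁, h₂, u, rfl, h₃⟩
  | app e₁ e₂ ih₁ ih₂ =>
    rintro ρ t ⟨n, A, hA, hi⟩
    obtain ⟨r, h₁, h₂, h₃⟩ := ih₁ ρ _ hA
    obtain ⟨r', h₁', h₂', h₃'⟩ := Sem_approx_finite (Sem_monotone e₂) (ih₂ ρ)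
      (Set.finite_range A) (Set.range_subset_iff.2 hi)
    exact ⟨r ⊔ r', fun x => (h₁ x).union (h₁' x), sup_le h₂ h₂', n, A,
      Sem_monotone _ le_sup_left h₃,
      fun i => Sem_monotone _ le_sup_right (h₃' (Set.mem_range_self i))⟩
  | lam x e ih =>
    rintro ρ t (rfl | ⟨n, A, b, rfl, hb⟩)
    · exact ⟨fun _ => ∅, fun _ => Set.finite_empty, hbot ρ, Or.inl rfl⟩
    · obtain ⟨r, X, h₁, -, h₂, h₃, h₄⟩ := approx_update (ih _ _ hb)
      exact ⟨r, h₁, h₂, Or.inr ⟨n, A, b, rfl, monotone_Sem_update e r x h₃ h₄⟩⟩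
  | fix x e ih =>
    intro ρ t ht
    -- The tokens that have a finite approximation form a prefixed set, so they include the least
    -- one.
    refine fixSet_subset
      (X := {t | ∃ ρ₀ : Env I, (∀ x, (ρ₀ x).Finite) ∧ ρ₀ ≤ ρ ∧ t ∈ Sem (.fix x e) ρ₀}) ?_ ht
    intro t ht
    obtain ⟨r, X, h₁, hX, h₂, h₃, h₄⟩ := approx_update (ih _ _ ht)
    have : ∃ ρ₀ : Env I, (∀ x, (ρ₀ x).Finite) ∧ ρ₀ ≤ ρ ∧ X ⊆ Sem (.fix x e) ρ₀ := by
      clear h₄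
      induction X, hX using Set.Finite.induction_on with
      | empty => exact ⟨fun _ => ∅, fun _ => Set.finite_empty, hbot ρ, by simp⟩
      | @insert a T _ _ ih =>
        obtain ⟨ρ₁, h₁, l₁, m₁⟩ := ih ((Set.subset_insert _ _).trans h₃)
        obtain ⟨ρ₂, h₂, l₂, m₂⟩ := h₃ (Set.mem_insert _ _)
        exact ⟨ρ₁ ⊔ ρ₂, fun x => (h₁ x).union (h₂ x), sup_le l₁ l₂, Set.insert_subset
          (Sem_monotone _ le_sup_right m₂) (m₁.trans (Sem_monotone _ le_sup_left))⟩
    obtain ⟨r', h₁', h₂', h₃'⟩ := this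
    refine ⟨r ⊔ r', fun x => (h₁ x).union (h₁' x), sup_le h₂ h₂', ?_⟩
    rw [← Sem_fix]
    refine Sem_monotone e (update_le_update_iff.2
      ⟨h₃'.trans (Sem_monotone _ le_sup_right), fun y _ => ?_⟩) h₄
    exact Set.subset_union_left
  | case e p b ihe ihb =>
    rintro ρ t ⟨i, ⟨u, hu, hm⟩, ht⟩
    obtain ⟨r, h₁, h₂, h₃⟩ := ihb i _ _ ht
    -- For each token of a pattern variable that the branch consults, choose a token of the
    -- scrutinee that binds it. The default `u` for all other pairs plays no role.
    have hex : ∀ x w, ∃ u, x ∈ (p i).vars → w ∈ r x → u ∈ Sem e ρ ∧ TBind u (p i) x w := by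
      intro x w
      by_cases hx : x ∈ (p i).vars ∧ w ∈ r x
      · have := h₂ x hx.2
        simp only [bindEnv, hx.1, if_true] at this
        obtain ⟨u, hu⟩ := this
        exact ⟨u, fun _ _ => hu⟩
      · exact ⟨u, fun h h' => absurd ⟨h, h'⟩ hx⟩
    choose g hg using hex
    have hT : (insert u (⋃ x ∈ (p i).vars.toFinset, g x '' r x)).Finite :=
      (Set.Finite.biUnion (Finset.finite_toSet _) fun x _ => (h₁ x).image _).insert _
    obtain ⟨r', h₁', h₂', h₃'⟩ := Sem_approx_finite (Sem_monotone e) (ihe ρ) hT (by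
      refine Set.insert_subset hu (Set.iUnion₂_subset fun x hx => ?_)
      rintro _ ⟨w, hw, rfl⟩
      exact (hg x w (by simpa using hx) hw).1)
    -- What the branch needs of its pattern variables is supplied by the scrutinee through `r'`, not
    -- by the environment.
    refine ⟨fun x => r' x ∪ if x ∈ (p i).vars then ∅ else r x, fun x => ?_, fun x => ?_, i,
      ⟨u, ?_, hm⟩, Sem_monotone (b i) (fun x => ?_) h₃⟩
    · refine (h₁' x).union ?_
      split_ifs
      exacts [Set.finite_empty, h₁ x]
    · refine Set.union_subset (h₂' x) ?_
      split_ifs with hx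
      · exact Set.empty_subset _
      · have := h₂ x
        simpa [bindEnv, hx] using this
    · exact Sem_monotone e (fun x => Set.subset_union_left) (h₃' (Set.mem_insert _ _))
    · intro w hw
      by_cases hx : x ∈ (p i).vars
      · simp only [bindEnv, hx, if_true]
        refine ⟨g x w, Sem_monotone e (fun x => Set.subset_union_left) (h₃' ?_), (hg x w hx hw).2⟩
        exact Set.mem_insert_of_mem _ (Set.mem_iUnion₂.2 ⟨x, by simpa using hx, w, hw, rfl⟩)
      · simp only [bindEnv, hx, if_false]
        exact Or.inr hw

/-- A token of `e` needs finitely many tokens of `x`, and not none if `X` has one. -/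
theorem Sem_update_approx (e : Expr I) (ρ : Env I) (x : Var) {X : Set (Tok I)}
    (hX : X.Nonempty) {t : Tok I} (ht : t ∈ Sem e (Function.update ρ x X)) :
    ∃ (n : ℕ) (A : Fin (n + 1) → Tok I), (∀ i, A i ∈ X) ∧
      t ∈ Sem e (Function.update ρ x (Set.range A)) := by
  obtain ⟨r, X₀, -, hfin, hr, hX₀, ht⟩ := approx_update (Sem_approx e _ _ ht)
  obtain ⟨a, ha⟩ := hX
  obtain ⟨n, A, hA⟩ := hfin.fin_param
  -- The extra token `a` keeps the family nonempty when `X₀` is empty.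
  refine ⟨n, Fin.cons a A, fun i => ?_, ?_⟩
  · refine Fin.cases ha (fun i => hX₀ ?_) i
    rw [← hA.2]; exact Set.mem_range_self i
  · refine Sem_monotone e (update_le_update_iff.2 ⟨?_, fun y _ => hr y⟩) ht
    rw [Fin.range_cons, hA.2]
    exact Set.subset_insert _ _

end Semantics

-- Association lists.

section Lookup

variable {α : Type*}

theorem mem_of_lookup {l : List (Var × α)} {x : Var} {a : α} (h : l.lookup x = some a) :
    (x, a) ∈ l := by
  obtain ⟨l₁, l₂, rfl, -⟩ := List.lookup_eq_some_iff.1 h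
  simp

theorem lookup_eq_none_iff' {l : List (Var × α)} {x : Var} :
    l.lookup x = none ↔ x ∉ l.map Prod.fst := by
  simp only [List.lookup_eq_none_iff, List.mem_map, not_exists, not_and, Prod.forall, bne_iff_ne,
    ne_eq]
  exact ⟨fun h a b hab hax => h a b hab hax.symm, fun h a b hab hxa => h a b hab hxa.symm⟩

theorem exists_lookup {l : List (Var × α)} {x : Var} (h : x ∈ l.map Prod.fst) :
    ∃ a, l.lookup x = some a := by
  cases hl : l.lookup x with
  | none => exact absurd h (lookup_eq_none_iff'.1 hl)
  | some a => exact ⟨a, rfl⟩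

theorem eq_of_mem_of_nodup {l : List (Var × α)} (hl : (l.map Prod.fst).Nodup) {x : Var} {a b : α}
    (ha : (x, a) ∈ l) (hb : (x, b) ∈ l) : a = b := by
  have := List.inj_on_of_nodup_map hl ha hb rfl
  exact (Prod.mk.inj this).2

theorem lookup_of_mem {l : List (Var × α)} (hl : (l.map Prod.fst).Nodup) {x : Var} {a : α}
    (ha : (x, a) ∈ l) : l.lookup x = some a := by
  obtain ⟨b, hb⟩ := exists_lookup (List.mem_map.2 ⟨_, ha, rfl⟩)
  rw [hb, eq_of_mem_of_nodup hl ha (mem_of_lookup hb)]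

end Lookup

section Operational

variable {I : Type v}

/-! ### Evaluation and weak head reduction -/

/-- This supplies the token that the semantics demands of an argument, and of every sibling
component when a record is projected or matched. -/
theorem Val.sem_nonempty {v : Expr I} (h : Val v) (ρ : Env I) : (Sem v ρ).Nonempty := by
  induction h with
  | const c => exact ⟨_, rfl⟩
  | record l e _ ih => choose u hu using ih; exact ⟨_, u, rfl, hu⟩
  | inj i e _ ih => obtain ⟨u, hu⟩ := ih; exact ⟨_, u, rfl, hu⟩
  | inj₀ i => exact ⟨_, rfl⟩
  | lam x e => exact ⟨_, Or.inl rfl⟩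
  | prim o => exact ⟨_, Or.inl rfl⟩

theorem Matches.tmatch {v : Expr I} {p : Pat I} {B : Bindings I} (h : Matches v p B) {ρ : Env I} :
    ∀ {t : Tok I}, t ∈ Sem v ρ → TMatch t p := by
  induction h with
  | wild v => intro t _; exact .wild t
  | var v x => intro t _; exact .var t x
  | const c => rintro t rfl; exact .const c
  | record l v p B _ ih => rintro t ⟨u, rfl, hu⟩; exact .record l u p fun i => ih i (hu i)
  | asP v x p B _ ih => intro t ht; exact .asP t x p (ih ht)
  | inj₀ i => rintro t rfl; exact .inj₀ i
  | inj i v p B _ ih => rintro t ⟨u, rfl, hu⟩; exact .inj i u p (ih hu)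

/-- Together with `Matches.tmatch`, this makes any single token of a value decide a match as
evaluation does. -/
theorem NoMatch.not_tmatch {v : Expr I} {p : Pat I} (h : NoMatch v p) {ρ : Env I} :
    ∀ {t : Tok I}, t ∈ Sem v ρ → ¬ TMatch t p := by
  induction h with
  | const c₁ c₂ h => rintro t rfl hm; cases hm; exact h rfl
  | record l v p i _ ih =>
    rintro t ⟨u, rfl, hu⟩ hm
    cases hm with | record _ _ _ h => exact ih (hu i) (h i)
  | asP v x p _ ih => intro t ht hm; cases hm with | asP _ _ _ h => exact ih ht h
  | inj₀ i₁ i₂ h => rintro t rfl hm; cases hm; exact h rfl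
  | inj_ne i₁ i₂ v p h => rintro t ⟨u, rfl, hu⟩ hm; cases hm; exact h rfl
  | inj i v p _ ih => rintro t ⟨u, rfl, hu⟩ hm; cases hm with | inj _ _ _ h => exact ih hu h
  | inj_inj₀ i₁ i₂ v => rintro t ⟨u, rfl, hu⟩ hm; cases hm
  | inj₀_inj i₁ i₂ p => rintro t rfl hm; cases hm

theorem Matches.map_fst {v : Expr I} {p : Pat I} {B : Bindings I} (h : Matches v p B) :
    B.map Prod.fst = p.vars := by
  induction h with
  | record l v p B _ ih =>
    simp only [Pat.vars, List.map_flatten, List.map_ofFn]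
    congr 2
    funext i
    exact ih i
  | asP v x p B _ ih => simp [Pat.vars, ih]
  | inj i v p B _ ih => simpa [Pat.vars] using ih
  | _ => simp [Pat.vars]

/-- A token of a bound subvalue extends to one of the whole value, because the sibling components
are values and have tokens of their own. -/
theorem Matches.exists_tbind {v : Expr I} {p : Pat I} {B : Bindings I} (h : Matches v p B)
    {ρ : Env I} {x : Var} {w : Expr I} {t : Tok I} (ht : t ∈ Sem w ρ) :
    Val v → (x, w) ∈ B → ∃ u ∈ Sem v ρ, TBind u p x t := by
  induction h with
  | wild v => intro _ h; simp at h
  | var v y =>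
    intro _ h
    simp only [List.mem_singleton, Prod.mk.injEq] at h
    obtain ⟨rfl, rfl⟩ := h
    exact ⟨t, ht, .var t x⟩
  | const c => intro _ h; simp at h
  | record l v p B _ ih =>
    intro hv h
    cases hv with
    | record _ _ hv =>
      obtain ⟨_, hB, hx⟩ := List.mem_flatten.1 h
      obtain ⟨i, rfl⟩ := List.mem_ofFn.1 hB
      obtain ⟨u, hu, hb⟩ := ih i (hv i) hx
      choose g hg using fun i => (hv i).sem_nonempty ρ
      refine ⟨.record l (Function.update g i u), ⟨_, rfl, fun j => ?_⟩, ?_⟩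
      · by_cases hj : j = i
        · subst hj; simpa using hu
        · simpa [Function.update_of_ne hj] using hg j
      · exact .record l _ p i x t (by simpa using hb)
  | asP v y p B _ ih =>
    intro hv h
    rcases List.mem_cons.1 h with h | h
    · simp only [Prod.mk.injEq] at h
      obtain ⟨rfl, rfl⟩ := h
      exact ⟨t, ht, .as_self t x p⟩
    · obtain ⟨u, hu, hb⟩ := ih hv h
      exact ⟨u, hu, .asP u y x p t hb⟩
  | inj₀ i => intro _ h; simp at h
  | inj i v p B _ ih =>
    intro hv h
    cases hv with
    | inj _ _ hv =>
      obtain ⟨u, hu, hb⟩ := ih hv h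
      exact ⟨_, ⟨u, rfl, hu⟩, .inj i u p x t hb⟩

theorem Sem_intPair (a b : ℤ) (ρ : Env I) : (pairTok a b : Tok I) ∈ Sem (intPair a b) ρ := by
  refine ⟨_, rfl, fun i => ?_⟩
  fin_cases i <;> exact rfl

/-- Evaluation loses nothing. -/
theorem Step.sem_subset {e e' : Expr I} (h : Step e e') (ρ : Env I) : Sem e' ρ ⊆ Sem e ρ := by
  induction h with
  | record l e i e' _ _ ih =>
    rintro t ⟨u, rfl, hu⟩
    refine ⟨u, rfl, fun j => ?_⟩
    have := hu j
    by_cases hj : j = i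
    · subst hj; exact ih (by simpa using this)
    · simpa [Function.update_of_ne hj] using this
  | proj e e' k _ ih =>
    rintro t ⟨n, l, u, i, hu, hl, ht⟩
    exact ⟨n, l, u, i, ih hu, hl, ht⟩
  | proj_record l e i hv =>
    intro t ht
    cases hv with
    | record _ _ hv =>
      choose g hg using fun i => (hv i).sem_nonempty ρ
      refine ⟨_, l, Function.update g i t, i, ⟨_, rfl, fun j => ?_⟩, rfl, by simp⟩
      by_cases hj : j = i
      · subst hj; simpa using ht
      · simpa [Function.update_of_ne hj] using hg j
  | inj i e e' _ ih =>
    rintro t ⟨u, rfl, hu⟩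
    exact ⟨u, rfl, ih hu⟩
  | case e e' p b _ ih =>
    rintro t ⟨i, ⟨u, hu, hm⟩, ht⟩
    refine ⟨i, ⟨u, ih hu, hm⟩, Sem_monotone (b i) (fun x => ?_) ht⟩
    simp only [bindEnv]
    split_ifs
    · exact bindSet_mono _ ih x
    · exact le_rfl
  | case_match e p b i B hv hn hm =>
    intro t ht
    obtain ⟨u, hu⟩ := hv.sem_nonempty ρ
    refine ⟨i, ⟨u, hu, hm.tmatch hu, fun j hj => (hn j hj).not_tmatch hu⟩, ?_⟩
    rw [Expr.substB, Sem_subst] at ht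
    refine Sem_monotone (b i) (fun x => ?_) ht
    by_cases hx : x ∈ (p i).vars
    · obtain ⟨w, hw⟩ := exists_lookup (hm.map_fst ▸ hx)
      simp only [hw, Option.getD_some, bindEnv, hx, if_true]
      exact fun t ht => hm.exists_tbind ht hv (mem_of_lookup hw)
    · have hw : B.lookup x = none := lookup_eq_none_iff'.2 (hm.map_fst ▸ hx)
      simp only [hw, Option.getD_none, bindEnv, hx, if_false]
      exact le_rfl
  | app_left e₁ e₁' e₂ _ ih =>
    rintro t ⟨n, A, hA, hi⟩
    exact ⟨n, A, ih hA, hi⟩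
  | app_right e₁ e₂ e₂' _ _ ih =>
    rintro t ⟨n, A, hA, hi⟩
    exact ⟨n, A, hA, fun i => ih (hi i)⟩
  | beta x e e₂ hv =>
    intro t ht
    rw [Sem_subst₁] at ht
    -- The body consults finitely many tokens of the argument, and the argument, being a value, has
    -- at least one; so they can be listed as a family `A`.
    obtain ⟨n, A, hA, ht⟩ := Sem_update_approx e ρ x (hv.sem_nonempty ρ) ht
    exact ⟨n, A, Or.inr ⟨n, A, t, rfl, ht⟩, hA⟩
  | fix x e =>
    rw [Sem_subst₁, Sem_fix]
  | prim o a b =>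
    rintro t rfl
    exact ⟨0, fun _ => pairTok a b, Or.inr ⟨0, _, a, b, ⟨0, rfl⟩, rfl⟩, fun _ => Sem_intPair a b ρ⟩

theorem Evals.sem_subset {e v : Expr I} (h : Evals e v) (ρ : Env I) : Sem v ρ ⊆ Sem e ρ := by
  induction h with
  | val => exact subset_rfl
  | step e e' v h _ ih => exact ih.trans (h.sem_subset ρ)

/-- The inclusion is opposite to that of `Step.sem_subset`: call-by-name contraction discards the
demand that an argument or a sibling component has a token. -/
theorem WhStep.sem_subset {e e' : Expr I} (h : WhStep e e') (ρ : Env I) : Sem e ρ ⊆ Sem e' ρ := by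
  induction h with
  | app e₁ e₁' e₂ _ ih =>
    rintro t ⟨n, A, hA, hi⟩
    exact ⟨n, A, ih hA, hi⟩
  | beta x e₁ e₂ =>
    rintro t ⟨n, A, hA | ⟨n', A', b, hA, hb⟩, hi⟩
    · cases hA
    · cases hA
      rw [Sem_subst₁]
      exact monotone_Sem_update e₁ ρ x (Set.range_subset_iff.2 hi) hb
  | proj e e' k _ ih =>
    rintro t ⟨n, l, u, i, hu, hl, ht⟩
    exact ⟨n, l, u, i, ih hu, hl, ht⟩
  | proj_record l e i =>
    rintro t ⟨n, l', u, i', ⟨u', hr, hu⟩, hl, rfl⟩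
    cases hr
    obtain rfl := l.injective hl
    exact hu _

theorem Whnf.sem_subset {e e' : Expr I} (h : Whnf e e') (ρ : Env I) : Sem e ρ ⊆ Sem e' ρ := by
  induction h with
  | step e e' e'' h _ ih => exact (h.sem_subset ρ).trans ih
  | done => exact subset_rfl

/-! ### Replaced applications -/

theorem update_mono_on {ρ ρ' : Env I} {x : Var} {X : Set (Tok I)} {s : Finset Var}
    (h : ∀ z ∈ s \ {x}, ρ z ⊆ ρ' z) :
    ∀ z ∈ s, Function.update ρ x X z ⊆ Function.update ρ' x X z := by
  intro z hz
  by_cases hzx : z = x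
  · subst hzx; simp
  · simpa [Function.update_of_ne hzx] using h z (by simp [hz, hzx])

theorem bindEnv_mono_on {ρ ρ' : Env I} {p : Pat I} {P Q : Set (Tok I)} {s : Finset Var}
    (h : ∀ z ∈ s \ p.vars.toFinset, ρ z ⊆ ρ' z) (hP : P ⊆ Q) :
    ∀ z ∈ s, bindEnv ρ p P z ⊆ bindEnv ρ' p Q z := by
  intro z hz
  by_cases hzx : z ∈ p.vars
  · simpa [bindEnv, hzx] using bindSet_mono p hP z
  · simpa [bindEnv, hzx] using h z (by simp [hz, hzx])

/-- An occurrence that is replaced finds all tokens of `f a` at `y`. Below a binder that is not free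
in `f a` the meaning of `f a` is unchanged, and below any other binder nothing is replaced. The
second environment is free to be larger, as it is after the variable `y` has been realized by a
value. -/
theorem sem_subset_replaceApp (f a : Expr I) (y : Var) (e : Expr I) :
    ∀ {ρ ρ' : Env I}, y ∉ e.vars → (∀ z ∈ e.fv, ρ z ⊆ ρ' z) → Sem (.app f a) ρ ⊆ ρ' y →
      Sem e ρ ⊆ Sem (replaceApp f a y e) ρ' := by
  have bind : ∀ {x : Var} {e : Expr I} {ρ ρ' : Env I} (X : Set (Tok I)),
      (∀ {ρ ρ' : Env I}, y ∉ e.vars → (∀ z ∈ e.fv, ρ z ⊆ ρ' z) → Sem (.app f a) ρ ⊆ ρ' y →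
        Sem e ρ ⊆ Sem (replaceApp f a y e) ρ') →
      y ∉ (insert x e.vars : Finset Var) → (∀ z ∈ (e.fv \ {x} : Finset Var), ρ z ⊆ ρ' z) →
      Sem (.app f a) ρ ⊆ ρ' y → x ∉ (Expr.app f a).fv →
      Sem e (Function.update ρ x X) ⊆ Sem (replaceApp f a y e) (Function.update ρ' x X) := by
    intro x e ρ ρ' X ih hy hz hfa hx
    simp only [Finset.mem_insert, not_or] at hy
    refine ih hy.2 (update_mono_on hz) ?_
    rw [Function.update_of_ne hy.1]
    have : Sem (.app f a) (Function.update ρ x X) = Sem (.app f a) ρ := by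
      refine Sem_congr _ fun w hw => ?_
      rw [Function.update_of_ne]
      rintro rfl
      exact hx hw
    exact this.subset.trans hfa
  induction e with
  | const | inj₀ | prim => intro ρ ρ' _ _ _; exact subset_rfl
  | var x => intro ρ ρ' _ h _; exact h x (by simp [Expr.fv])
  | record l e ih =>
    rintro ρ ρ' hy h hfa t ⟨u, rfl, hu⟩
    simp only [Expr.vars, Expr.fv, Finset.mem_biUnion, Finset.mem_univ, true_and,
      not_exists] at hy h
    exact ⟨u, rfl, fun i => ih i (hy i) (fun x hx => h x ⟨i, hx⟩) hfa (hu i)⟩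
  | proj e k ih =>
    rintro ρ ρ' hy h hfa t ⟨n, l, u, i, hu, hl, ht⟩
    exact ⟨n, l, u, i, ih hy h hfa hu, hl, ht⟩
  | inj i e ih =>
    rintro ρ ρ' hy h hfa t ⟨u, rfl, hu⟩
    exact ⟨u, rfl, ih hy h hfa hu⟩
  | case e p b ihe ihb =>
    rintro ρ ρ' hy h hfa t ⟨i, ⟨u, hu, hm⟩, ht⟩
    simp only [Expr.vars, Expr.fv, Finset.mem_union, Finset.mem_biUnion, Finset.mem_univ, true_and,
      not_or, not_exists, List.mem_toFinset] at hy h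
    have he := ihe hy.1 (fun z hz => h z (Or.inl hz)) hfa
    have hb : ∀ z ∈ (b i).fv \ (p i).vars.toFinset, ρ z ⊆ ρ' z :=
      fun z hz => h z (Or.inr ⟨i, hz⟩)
    refine ⟨i, ⟨u, he hu, hm⟩, ?_⟩
    have hbe := bindEnv_mono_on hb he
    dsimp only
    split_ifs with hc
    · exact Sem_mono _ hbe ht
    · refine ihb i (hy.2 i).1 hbe ?_ ht
      simp only [bindEnv, (hy.2 i).2, if_false]
      refine (Sem_congr _ fun z hz => ?_).subset.trans hfa
      exact if_neg fun hzp => hc ⟨z, hzp, hz⟩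
  | lam x e ih =>
    intro ρ ρ' hy h hfa
    simp only [replaceApp]
    split_ifs with hx
    · exact Sem_mono _ h
    · rintro t (rfl | ⟨n, A, b, rfl, hb⟩)
      · exact Or.inl rfl
      · exact Or.inr ⟨n, A, b, rfl, bind _ ih hy h hfa hx hb⟩
  | fix x e ih =>
    intro ρ ρ' hy h hfa
    simp only [replaceApp]
    split_ifs with hx
    · exact Sem_mono _ h
    · exact fixSet_mono fun X => bind X ih hy h hfa hx
  | app e₁ e₂ ih₁ ih₂ =>
    intro ρ ρ' hy h hfa
    simp only [replaceApp]
    split_ifs with hc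
    · obtain ⟨rfl, rfl⟩ := hc
      exact hfa
    · simp only [Expr.vars, Expr.fv, Finset.mem_union, not_or] at hy h
      rintro t ⟨n, A, hA, hi⟩
      exact ⟨n, A, ih₁ hy.1 (fun z hz => h z (Or.inl hz)) hfa hA,
        fun i => ih₂ hy.2 (fun z hz => h z (Or.inr hz)) hfa (hi i)⟩

/-! ### Freshening -/

/-- What `Freshen` and either side of `EB` have in common: the variables of a pattern are renamed
to fresh ones, and fresh variables may be added to it. -/
inductive Refine (L : Finset Var) : Pat I → Expr I → Pat I → Expr I → Prop
  | wild (e : Expr I) : Refine L .wild e .wild e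
  | wild_var (y : Var) (e : Expr I) (hy : y ∉ L) : Refine L .wild e (.var y) e
  | var (x y : Var) (e : Expr I) (hy : y ∉ L) :
      Refine L (.var x) e (.var y) (e.subst₁ x (.var y))
  | record {n : ℕ} (l : Fin n ↪ Label) (p p' : Fin n → Pat I) (e : Fin (n + 1) → Expr I)
      (h : ∀ i : Fin n, Refine L (p i) (e i.castSucc) (p' i) (e i.succ)) :
      Refine L (.record l p) (e 0) (.record l p') (e (Fin.last n))
  | asP (x y : Var) (p p' : Pat I) (e e' : Expr I) (hy : y ∉ L) (h : Refine L p e p' e') :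
      Refine L (.asP x p) e (.asP y p') (e'.subst₁ x (.var y))
  | as_add (y : Var) (p p' : Pat I) (e e' : Expr I) (hy : y ∉ L) (h : Refine L p e p' e') :
      Refine L p e (.asP y p') e'
  | const (c : Const) (e : Expr I) : Refine L (.const c) e (.const c) e
  | inj₀ (i : I) (e : Expr I) : Refine L (.inj₀ i) e (.inj₀ i) e
  | inj (i : I) (p p' : Pat I) (e e' : Expr I) (h : Refine L p e p' e') :
      Refine L (.inj i p) e (.inj i p') e'

theorem Freshen.refine {L : Finset Var} {p p' : Pat I} {e e' : Expr I} (h : Freshen L p e p' e') :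
    Refine L p e p' e' := by
  induction h with
  | wild e => exact .wild e
  | var x y e hy => exact .var x y e hy
  | record l p p' e _ ih => exact .record l p p' e ih
  | asP x y p p' e e' hy _ ih => exact .asP x y p p' e e' hy ih
  | const c e => exact .const c e
  | inj₀ i e => exact .inj₀ i e
  | inj i p p' e e' _ ih => exact .inj i p p' e e' ih

theorem EB.refine {L : Finset Var} {p₁ p₂ p : Pat I} {e₁ e₂ e₁' e₂' : Expr I}
    (h : EB L p₁ e₁ p₂ e₂ p e₁' e₂') : Refine L p₁ e₁ p e₁' ∧ Refine L p₂ e₂ p e₂' := by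
  induction h with
  | wild_wild e₁ e₂ => exact ⟨.wild e₁, .wild e₂⟩
  | wild_var x y e₁ e₂ hy => exact ⟨.wild_var y e₁ hy, .var x y e₂ hy⟩
  | var_wild x y e₁ e₂ hy => exact ⟨.var x y e₁ hy, .wild_var y e₂ hy⟩
  | var_var x x' y e₁ e₂ hy => exact ⟨.var x y e₁ hy, .var x' y e₂ hy⟩
  | as_left x y p₁ p₂ p' e₁ e₂ e₁' e₂' hy _ ih =>
    exact ⟨.asP x y _ _ _ _ hy ih.1, .as_add y _ _ _ _ hy ih.2⟩
  | as_right x y p₁ p₂ p' e₁ e₂ e₁' e₂' hy _ ih =>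
    exact ⟨.as_add y _ _ _ _ hy ih.1, .asP x y _ _ _ _ hy ih.2⟩
  | record l p p' p'' e e' _ ih =>
    exact ⟨.record l p p'' e fun i => (ih i).1, .record l p' p'' e' fun i => (ih i).2⟩
  | const c e₁ e₂ => exact ⟨.const c e₁, .const c e₂⟩
  | inj₀ i e₁ e₂ => exact ⟨.inj₀ i e₁, .inj₀ i e₂⟩
  | inj i p₁ p₂ p' e₁ e₂ e₁' e₂' _ ih => exact ⟨.inj i _ _ _ _ ih.1, .inj i _ _ _ _ ih.2⟩

theorem Refine.notMem {L : Finset Var} {p p' : Pat I} {e e' : Expr I} (h : Refine L p e p' e') :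
    ∀ y ∈ p'.vars, y ∉ L := by
  induction h with
  | wild | const | inj₀ => simp [Pat.vars]
  | wild_var y e hy => simpa [Pat.vars] using hy
  | var x y e hy => simpa [Pat.vars] using hy
  | record l p p' e _ ih =>
    intro y hy
    obtain ⟨i, hi⟩ := Pat.mem_vars_record.1 hy
    exact ih i y hi
  | asP x y p p' e e' hy _ ih => simpa [Pat.vars, hy] using ih
  | as_add y p p' e e' hy _ ih => simpa [Pat.vars, hy] using ih
  | inj i p p' e e' _ ih => simpa [Pat.vars] using ih

theorem Refine.tmatch_iff {L : Finset Var} {p p' : Pat I} {e e' : Expr I}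
    (h : Refine L p e p' e') : ∀ t : Tok I, TMatch t p' ↔ TMatch t p := by
  induction h with
  | wild | const | inj₀ => intro t; rfl
  | wild_var y e hy => intro t; exact ⟨fun _ => .wild t, fun _ => .var t y⟩
  | var x y e hy => intro t; exact ⟨fun _ => .var t x, fun _ => .var t y⟩
  | record l p p' e _ ih =>
    intro t
    constructor
    · rintro h; cases h with | record l t _ h => exact .record l t p fun i => (ih i _).1 (h i)
    · rintro h; cases h with | record l t _ h => exact .record l t _ fun i => (ih i _).2 (h i)
  | asP x y p p' e e' hy _ ih =>
    intro t
    constructor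
    · rintro h; cases h with | asP _ _ _ h => exact .asP _ _ _ ((ih _).1 h)
    · rintro h; cases h with | asP _ _ _ h => exact .asP _ _ _ ((ih _).2 h)
  | as_add y p p' e e' hy _ ih =>
    intro t
    constructor
    · rintro h; cases h with | asP _ _ _ h => exact (ih _).1 h
    · rintro h; exact .asP _ _ _ ((ih _).2 h)
  | inj i p p' e e' _ ih =>
    intro t
    constructor
    · rintro h; cases h with | inj _ _ _ h => exact .inj _ _ _ ((ih _).1 h)
    · rintro h; cases h with | inj _ _ _ h => exact .inj _ _ _ ((ih _).2 h)

theorem Pat.Linear.of_record {n : ℕ} {l : Fin n ↪ Label} {p : Fin n → Pat I}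
    (h : (Pat.record l p).Linear) (i : Fin n) : (p i).Linear := by
  have := (List.nodup_flatten.1 h).1
  exact this _ (List.mem_ofFn.2 ⟨i, rfl⟩)

theorem Pat.Linear.eq_of_mem {n : ℕ} {l : Fin n ↪ Label} {p : Fin n → Pat I}
    (h : (Pat.record l p).Linear) {i j : Fin n} {x : Var} (hi : x ∈ (p i).vars)
    (hj : x ∈ (p j).vars) : i = j := by
  have := (List.nodup_flatten.1 h).2
  rw [List.pairwise_ofFn] at this
  by_contra hne
  rcases lt_or_gt_of_ne hne with hlt | hlt
  · exact this hlt hi hj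
  · exact this hlt hj hi

/-- The components of the record tokens in `P`. -/
def compSet {n : ℕ} (l : Fin n ↪ Label) (P : Set (Tok I)) (i : Fin n) : Set (Tok I) :=
  {t | ∃ u : Fin n → Tok I, .record l u ∈ P ∧ t = u i}

theorem bindSet_record_subset {n : ℕ} {l : Fin n ↪ Label} {p : Fin n → Pat I}
    {P : Set (Tok I)} (hp : (Pat.record l p).Linear) {i : Fin n} {x : Var}
    (hx : x ∈ (p i).vars) : bindSet (.record l p) P x ⊆ bindSet (p i) (compSet l P i) x := by
  rintro w ⟨t, ht, hb⟩
  cases hb with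
  | record _ u _ j _ _ hb =>
    cases hp.eq_of_mem hx hb.mem_vars
    exact ⟨_, ⟨u, ht, rfl⟩, hb⟩

theorem subset_bindSet_record {n : ℕ} {l : Fin n ↪ Label} {p : Fin n → Pat I}
    {P : Set (Tok I)} {i : Fin n} {x : Var} :
    bindSet (p i) (compSet l P i) x ⊆ bindSet (.record l p) P x := by
  rintro w ⟨_, ⟨u, hu, rfl⟩, hb⟩
  exact ⟨_, hu, .record l u p i x w hb⟩

/-- A branch means at least as much after its variables are freshened. -/
theorem Refine.sem_subset {L : Finset Var} {p p' : Pat I} {e e' : Expr I}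
    (h : Refine L p e p' e') : ∀ {P : Set (Tok I)} {ρ : Env I}, p.Linear → (∀ x ∈ p.vars, x ∈ L) →
      (∀ y ∈ p'.vars, bindSet p' P y ⊆ ρ y) → Sem e (bindEnv ρ p P) ⊆ Sem e' ρ := by
  induction h with
  | wild | const | inj₀ =>
    intro P ρ _ _ _
    exact Sem_monotone _ fun x => by simp [bindEnv, Pat.vars]
  | wild_var y e hy =>
    intro P ρ _ _ _
    exact Sem_monotone _ fun x => by simp [bindEnv, Pat.vars]
  | var x y e hy =>
    intro P ρ _ _ h
    rw [Sem_subst₁]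
    refine Sem_monotone _ fun z => ?_
    by_cases hz : z = x
    · subst hz
      simp only [bindEnv, Pat.vars, List.mem_singleton, if_true, Function.update_self, Sem]
      rintro w ⟨t, ht, hb⟩
      cases hb
      exact h y (by simp [Pat.vars]) ⟨_, ht, .var _ y⟩
    · simp [bindEnv, Pat.vars, hz]
  | record l p p' e hr ih =>
    rename_i n
    intro P ρ hp hL h
    -- The components are freshened one after the other. In `e k` the old variables of the
    -- components from `k` on are still present and bound to what the record says; those of earlier
    -- components have been replaced. The induction runs down from the last stage.
    have key : ∀ k : Fin (n + 1), Sem (e k) (fun z => open Classical in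
        if ∃ j : Fin n, k ≤ j.castSucc ∧ z ∈ (p j).vars then bindSet (.record l p) P z else ρ z) ⊆
        Sem (e (Fin.last n)) ρ := by
      intro k
      induction k using Fin.reverseInduction with
      | last =>
        refine Sem_monotone _ fun z => ?_
        rw [if_neg]
        rintro ⟨j, hj, -⟩
        exact absurd hj (not_le.2 (Fin.castSucc_lt_last j))
      | cast i ih' =>
        refine Set.Subset.trans ?_ ih'
        refine Set.Subset.trans (Sem_monotone _ fun z => ?_)
          (ih i (P := compSet l P i) (hp.of_record i)
            (fun x hx => hL x (Pat.mem_vars_record.2 ⟨i, hx⟩)) ?_)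
        · by_cases hz : z ∈ (p i).vars
          · rw [if_pos ⟨i, le_rfl, hz⟩]
            simp only [bindEnv, hz, if_true]
            exact bindSet_record_subset hp hz
          · simp only [bindEnv, hz, if_false]
            by_cases hj : ∃ j : Fin n, i.castSucc ≤ j.castSucc ∧ z ∈ (p j).vars
            · rw [if_pos hj, if_pos]
              obtain ⟨j, hj, hzj⟩ := hj
              refine ⟨j, ?_, hzj⟩
              rcases eq_or_lt_of_le (Fin.castSucc_le_castSucc_iff.1 hj) with rfl | hlt
              · exact absurd hzj hz
              · exact Fin.succ_le_castSucc_iff.2 hlt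
            · rw [if_neg hj, if_neg]
              rintro ⟨j, hij, hzj⟩
              exact hj ⟨j, (Fin.castSucc_le_succ i).trans hij, hzj⟩
        -- A fresh variable of component `i` is none of the old variables, so the environment at
        -- this stage still has the value of `ρ` there.
        · intro y hy
          rw [if_neg]
          · exact subset_bindSet_record.trans (h y (Pat.mem_vars_record.2 ⟨i, hy⟩))
          · rintro ⟨j, -, hj⟩
            exact (hr i).notMem y hy (hL y (Pat.mem_vars_record.2 ⟨j, hj⟩))
    refine Set.Subset.trans (Sem_monotone _ fun z => ?_) (key 0)
    by_cases hz : z ∈ (Pat.record l p).vars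
    · obtain ⟨j, hj⟩ := Pat.mem_vars_record.1 hz
      rw [if_pos ⟨j, Fin.zero_le _, hj⟩]
      simp [bindEnv, hz]
    · rw [if_neg fun ⟨j, _, hj⟩ => hz (Pat.mem_vars_record.2 ⟨j, hj⟩)]
      simp [bindEnv, hz]
  | asP x y p p' e e' hy hr ih =>
    intro P ρ hp hL h
    have hp' : x ∉ p.vars ∧ p.vars.Nodup := by simpa [Pat.Linear, Pat.vars] using hp
    rw [Sem_subst₁]
    refine Set.Subset.trans (Sem_monotone _ fun z => ?_) (ih (P := P) hp'.2
      (fun z hz => hL z (by simp [Pat.vars, hz])) fun z hz => ?_)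
    · by_cases hzx : z = x
      · subst hzx
        simp only [bindEnv, Pat.vars, List.mem_cons, true_or, if_true, hp'.1, if_false,
          Function.update_self, Sem]
        rintro w ⟨t, ht, hb⟩
        cases hb with
        | as_self => exact h y (by simp [Pat.vars]) ⟨_, ht, .as_self _ y p'⟩
        | asP _ _ _ _ _ hb => exact absurd hb.mem_vars hp'.1
      · by_cases hz : z ∈ p.vars
        · simp only [bindEnv, Pat.vars, List.mem_cons, hz, or_true, if_true]
          rintro w ⟨t, ht, hb⟩
          cases hb with
          | as_self => exact absurd rfl hzx
          | asP _ _ _ _ _ hb => exact ⟨t, ht, hb⟩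
        · simp [bindEnv, Pat.vars, hz, hzx]
    · have hzx : z ≠ x := by
        rintro rfl
        exact hr.notMem z hz (hL z (by simp [Pat.vars]))
      rw [Function.update_of_ne hzx]
      refine Set.Subset.trans ?_ (h z (by simp [Pat.vars, hz]))
      rintro w ⟨t, ht, hb⟩
      exact ⟨t, ht, .asP _ _ _ _ _ hb⟩
  | as_add y p p' e e' hy hr ih =>
    intro P ρ hp hL h
    refine ih hp hL fun z hz => Set.Subset.trans ?_ (h z (by simp [Pat.vars, hz]))
    rintro w ⟨t, ht, hb⟩
    exact ⟨t, ht, .asP _ _ _ _ _ hb⟩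
  | inj i p p' e e' hr ih =>
    intro P ρ hp hL h
    refine Set.Subset.trans (Sem_monotone _ fun z => ?_) (ih (P := {t | .inj i t ∈ P}) hp hL
      fun z hz => Set.Subset.trans ?_ (h z hz))
    · by_cases hz : z ∈ p.vars
      · simp only [bindEnv, Pat.vars, hz, if_true]
        rintro w ⟨t, ht, hb⟩
        cases hb with | inj _ t _ _ _ hb => exact ⟨t, ht, hb⟩
      · simp [bindEnv, Pat.vars, hz]
    · rintro w ⟨t, ht, hb⟩
      exact ⟨_, ht, TBind.inj _ _ _ _ _ hb⟩

/-- The branches of a case expression may be freshened. -/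
theorem sem_case_subset_of_refine {L : Finset Var} {e : Expr I} {n : ℕ} {p p' : Fin n → Pat I}
    {b b' : Fin n → Expr I} (h : ∀ i, Refine L (p i) (b i) (p' i) (b' i))
    (hp : ∀ i, (p i).Linear) (hL : (Expr.case e p b).vars ⊆ L) (ρ : Env I) :
    Sem (.case e p b) ρ ⊆ Sem (.case e p' b') ρ := by
  have hvars : ∀ i, ∀ x ∈ (b i).vars ∪ (p i).vars.toFinset, x ∈ L := fun i x hx => hL (by
    simp only [Expr.vars]
    exact Finset.mem_union_right _ (Finset.mem_biUnion.2 ⟨i, Finset.mem_univ _, hx⟩))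
  rintro t ⟨i, ⟨u, hu, hm, hn⟩, ht⟩
  refine ⟨i, ⟨u, hu, ((h i).tmatch_iff u).2 hm, fun j hj hm' =>
    hn j hj (((h j).tmatch_iff u).1 hm')⟩, ?_⟩
  refine (h i).sem_subset (P := Sem e ρ) (hp i)
    (fun x hx => hvars i x (by simp [hx])) (fun y hy => by simp [bindEnv, hy]) ?_
  refine Sem_mono _ (fun x hx => ?_) ht
  by_cases hxp : x ∈ (p i).vars
  · simp [bindEnv, hxp]
  · have : x ∉ (p' i).vars := fun hx' => (h i).notMem x hx'
      (hvars i x (Finset.mem_union_left _ ((b i).fv_subset_vars hx)))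
    simp [bindEnv, hxp, this]

theorem FT.refine {L : Finset Var} {M₁ M₂ M₁' M₂' : List (Pat I × Expr I)} {s : ℕ}
    (h : FT L M₁ M₂ M₁' M₂' s) :
    List.Forall₂ (fun m m' => Refine L m.1 m.2 m'.1 m'.2) M₁ M₁' ∧
    List.Forall₂ (fun m m' => Refine L m.1 m.2 m'.1 m'.2) M₂ M₂' ∧
    ∀ k, k < s → ∃ p e₁ e₂, M₁'[k]? = some (p, e₁) ∧ M₂'[k]? = some (p, e₂) := by
  induction h with
  | singleton p₁ p₂ p e₁ e₂ e₁' e₂' h =>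
    refine ⟨.cons h.refine.1 .nil, .cons h.refine.2 .nil, fun k hk => ?_⟩
    obtain rfl : k = 0 := by omega
    exact ⟨p, e₁', e₂', rfl, rfl⟩
  | success p₁ p₂ p e₁ e₂ e₁' e₂' r₁ r₂ r₁' r₂' s h _ ih =>
    refine ⟨.cons h.refine.1 ih.1, .cons h.refine.2 ih.2.1, fun k hk => ?_⟩
    cases k with
    | zero => exact ⟨p, e₁', e₂', rfl, rfl⟩
    | succ k => simpa using ih.2.2 k (by omega)
  | failure M₁ M₂ M₁' M₂' h₁ h₂ =>
    exact ⟨h₁.imp fun _ _ h => h.refine, h₂.imp fun _ _ h => h.refine, fun k hk => by omega⟩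

theorem forall₂_branches {R : Pat I × Expr I → Pat I × Expr I → Prop} {n : ℕ}
    {p q : Fin n → Pat I} {b c : Fin n → Expr I}
    (h : List.Forall₂ R (branches p b) (branches q c)) (i : Fin n) : R (p i, b i) (q i, c i) := by
  have := (List.forall₂_iff_get.1 h).2 i (by simp [branches]) (by simp [branches])
  simpa [branches] using this

theorem FT.shared {L : Finset Var} {n m : ℕ} {p q : Fin n → Pat I} {b c : Fin n → Expr I}
    {p' q' : Fin m → Pat I} {b' c' : Fin m → Expr I} {s : ℕ}
    (h : FT L (branches p b) (branches p' b') (branches q c) (branches q' c') s)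
    {i : Fin n} {j : Fin m} (hij : i.val = j.val) (hi : i.val < s) : q i = q' j := by
  obtain ⟨r, e₁, e₂, h₁, h₂⟩ := h.refine.2.2 i hi
  rw [branches, List.getElem?_ofFn] at h₁ h₂
  simp only [hij, j.isLt, dite_true, Option.some.injEq, Prod.mk.injEq] at h₂
  simp only [i.isLt, dite_true, Option.some.injEq, Prod.mk.injEq, Fin.eta] at h₁
  rw [h₁.1, ← h₂.1]

end Operational

-- Substitution and preservation of types.

section Typing

variable {D : Type u} {I : Type v} {S : Signature D I}

theorem PatTy.map_fst {p : Pat I} {τ : Ty D} {Δ : Ctx D} (h : PatTy S p τ Δ) :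
    Δ.map Prod.fst = p.vars := by
  induction h with
  | record l p τ Γ _ ih =>
    simp only [Pat.vars, List.map_flatten, List.map_ofFn]
    congr 2
    funext i
    exact ih i
  | asP x p τ Γ _ ih => simp [Pat.vars, ih]
  | inj i p τ Γ _ _ ih => simpa [Pat.vars] using ih
  | _ => simp [Pat.vars]

theorem PatTy.mem_vars {p : Pat I} {τ : Ty D} {Δ : Ctx D} (h : PatTy S p τ Δ) {x : Var}
    {τ' : Ty D} (hx : (x, τ') ∈ Δ) : x ∈ p.vars :=
  h.map_fst ▸ List.mem_map.2 ⟨_, hx, rfl⟩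

theorem PatTy.lookup_append {p : Pat I} {τ : Ty D} {Δ : Ctx D} (h : PatTy S p τ Δ) (Γ : Ctx D)
    {x : Var} (hx : x ∉ p.vars) : (Δ ++ Γ).lookup x = Γ.lookup x := by
  rw [List.lookup_append, lookup_eq_none_iff'.2 (h.map_fst ▸ hx), Option.none_or]

theorem PatTy.mem_of_lookup_append {p : Pat I} {τ τ' : Ty D} {Δ : Ctx D} (h : PatTy S p τ Δ)
    {Γ : Ctx D} {x : Var} (hx : x ∈ p.vars) (hl : (Δ ++ Γ).lookup x = some τ') : (x, τ') ∈ Δ := by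
  obtain ⟨a, ha⟩ := exists_lookup (h.map_fst ▸ hx)
  rw [List.lookup_append, ha, Option.some_or] at hl
  cases hl
  exact mem_of_lookup ha

theorem PatTy.rename (f : Var → Var) {p : Pat I} {τ : Ty D} {Δ : Ctx D} (h : PatTy S p τ Δ) :
    PatTy S (p.rename f) τ (Δ.map (Prod.map f id)) := by
  induction h with
  | wild τ => exact .wild τ
  | var x τ => exact .var _ τ
  | record l p τ Γ _ ih =>
    rw [List.map_flatten, List.map_ofFn]
    exact .record l _ τ _ ih
  | asP x p τ Γ _ ih => exact .asP _ _ τ _ ih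
  | const c => exact .const c
  | inj₀ i hi => exact .inj₀ i hi
  | inj i p τ Γ hi _ ih => exact .inj i _ τ _ hi ih

theorem HasType.mem_dom {Γ : Ctx D} {e : Expr I} {τ : Ty D} (h : HasType S Γ e τ) :
    ∀ x ∈ e.fv, x ∈ Γ.dom := by
  induction h with
  | const | inj₀ | prim => simp [Expr.fv]
  | var Γ x τ h =>
    intro y hy
    obtain rfl : y = x := by simpa [Expr.fv] using hy
    exact List.mem_map.2 ⟨_, mem_of_lookup h, rfl⟩
  | record Γ l e τ _ ih =>
    intro x hx
    simp only [Expr.fv, Finset.mem_biUnion, Finset.mem_univ, true_and] at hx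
    obtain ⟨i, hi⟩ := hx
    exact ih i x hi
  | proj Γ e l τ i _ ih => exact ih
  | inj Γ i e τ _ _ ih => exact ih
  | case Γ e p b τ τ' Δ _ hp _ _ ihe ihb =>
    intro x hx
    simp only [Expr.fv, Finset.mem_union, Finset.mem_biUnion, Finset.mem_univ, true_and,
      Finset.mem_sdiff, List.mem_toFinset] at hx
    rcases hx with hx | ⟨i, hi, hx⟩
    · exact ihe x hx
    · have := ihb i x hi
      simp only [Ctx.dom, List.map_append, List.mem_append, (hp i).map_fst] at this
      exact this.resolve_left hx
  | lam Γ x e τ₁ τ₂ _ ih =>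
    intro y hy
    simp only [Expr.fv, Finset.mem_sdiff, Finset.mem_singleton] at hy
    exact (List.mem_cons.1 (ih y hy.1)).resolve_left hy.2
  | app Γ e₁ e₂ τ₁ τ₂ _ _ ih₁ ih₂ =>
    intro x hx
    simp only [Expr.fv, Finset.mem_union] at hx
    exact hx.elim (ih₁ x) (ih₂ x)
  | fix Γ x e τ _ ih =>
    intro y hy
    simp only [Expr.fv, Finset.mem_sdiff, Finset.mem_singleton] at hy
    exact (List.mem_cons.1 (ih y hy.1)).resolve_left hy.2

/-- This is weakening, strengthening and exchange in one. -/
theorem HasType.congr {Γ : Ctx D} {e : Expr I} {τ : Ty D} (h : HasType S Γ e τ) :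
    ∀ {Γ' : Ctx D}, (∀ x ∈ e.fv, Γ'.lookup x = Γ.lookup x) → HasType S Γ' e τ := by
  have cons : ∀ {Γ Γ' : Ctx D} {x : Var} {τ : Ty D} {s : Finset Var},
      (∀ y ∈ (s \ {x} : Finset Var), Γ'.lookup y = Γ.lookup y) →
      ∀ y ∈ s, ((x, τ) :: Γ' : Ctx D).lookup y = ((x, τ) :: Γ : Ctx D).lookup y := by
    intro Γ Γ' x τ s h y hy
    by_cases hyx : y = x
    · subst hyx; simp
    · simp only [List.lookup_cons, beq_eq_false_iff_ne.2 hyx]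
      exact h y (by simp [hy, hyx])
  induction h with
  | const Γ c => intro Γ' _; exact .const Γ' c
  | inj₀ Γ i hi => intro Γ' _; exact .inj₀ Γ' i hi
  | prim Γ o => intro Γ' _; exact .prim Γ' o
  | var Γ x τ h => intro Γ' h'; exact .var Γ' x τ ((h' x (by simp [Expr.fv])).trans h)
  | record Γ l e τ _ ih =>
    intro Γ' h'
    exact .record Γ' l e τ fun i => ih i fun x hx => h' x (by
      simp only [Expr.fv, Finset.mem_biUnion, Finset.mem_univ, true_and]; exact ⟨i, hx⟩)
  | proj Γ e l τ i _ ih => intro Γ' h'; exact .proj Γ' e l τ i (ih h')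
  | inj Γ i e τ hi _ ih => intro Γ' h'; exact .inj Γ' i e τ hi (ih h')
  | case Γ e p b τ τ' Δ _ hp hl _ ihe ihb =>
    intro Γ' h'
    simp only [Expr.fv, Finset.mem_union, Finset.mem_biUnion, Finset.mem_univ, true_and,
      Finset.mem_sdiff, List.mem_toFinset] at h'
    refine .case Γ' e p b τ τ' Δ (ihe fun x hx => h' x (Or.inl hx)) hp hl fun i => ihb i ?_
    intro x hx
    by_cases hxp : x ∈ (p i).vars
    · obtain ⟨a, ha⟩ := exists_lookup ((hp i).map_fst ▸ hxp)
      rw [List.lookup_append, List.lookup_append, ha, Option.some_or, Option.some_or]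
    · rw [(hp i).lookup_append Γ hxp, (hp i).lookup_append Γ' hxp]
      exact h' x (Or.inr ⟨i, hx, hxp⟩)
  | lam Γ x e τ₁ τ₂ _ ih => intro Γ' h'; exact .lam Γ' x e τ₁ τ₂ (ih (cons h'))
  | app Γ e₁ e₂ τ₁ τ₂ _ _ ih₁ ih₂ =>
    intro Γ' h'
    exact .app Γ' e₁ e₂ τ₁ τ₂ (ih₁ fun x hx => h' x (by simp [Expr.fv, hx]))
      (ih₂ fun x hx => h' x (by simp [Expr.fv, hx]))
  | fix Γ x e τ _ ih => intro Γ' h'; exact .fix Γ' x e τ (ih (cons h'))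

/-- The common step below the binders of patterns, functions and fixed points. A shifted binder
keeps its type, and by `bump_notMem` it shadows nothing in the expressions put in. -/
theorem HasType.under {Γ Γ' Δ : Ctx D} {s : Var → Expr I} {b : Expr I} {xs : List Var}
    (hΔ : Δ.map Prod.fst = xs)
    (h : ∀ x ∈ b.fv, x ∉ xs → ∀ τ, Γ.lookup x = some τ → HasType S Γ' (s x) τ) :
    ∀ z ∈ b.fv, ∀ τ, (Δ ++ Γ).lookup z = some τ →
      HasType S (Δ.map (Prod.map (fun x => x + bump s xs b) id) ++ Γ')
        (LambdaPix.under s xs (bump s xs b) z) τ := by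
  intro z hz τ hl
  generalize hk : bump s xs b = k
  by_cases hzx : z ∈ xs
  · simp only [LambdaPix.under, hzx, if_true]
    refine .var _ _ _ ?_
    rw [List.lookup_append] at hl ⊢
    obtain ⟨a, ha⟩ := exists_lookup (hΔ ▸ hzx)
    have hmap : ∀ Δ : Ctx D, (Δ.map (Prod.map (fun x => x + k) id)).lookup (z + k) =
        Δ.lookup z := by
      intro Δ
      induction Δ with
      | nil => rfl
      | cons a Δ ih =>
        obtain ⟨y, τ⟩ := a
        simp only [List.map_cons, Prod.map, List.lookup_cons, ih, id]
        have : (z + k == y + k) = (z == y) := by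
          rw [Bool.eq_iff_iff]; simp
        rw [this]
    rw [hmap, ha, Option.some_or]
    rwa [ha, Option.some_or] at hl
  · simp only [LambdaPix.under, hzx, if_false]
    rw [List.lookup_append, lookup_eq_none_iff'.2 (hΔ ▸ hzx), Option.none_or] at hl
    refine (h z hz hzx τ hl).congr fun y hy => ?_
    rw [List.lookup_append, lookup_eq_none_iff'.2, Option.none_or]
    intro hmem
    simp only [List.map_map, List.mem_map, Function.comp, Prod.map_fst] at hmem
    obtain ⟨a, ha, rfl⟩ := hmem
    refine bump_notMem s xs b (x := a.1) ?_ hz hzx (hk ▸ hy)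
    rw [← hΔ]
    exact List.mem_map.2 ⟨a, ha, rfl⟩

theorem HasType.subst {Γ : Ctx D} {e : Expr I} {τ : Ty D} (h : HasType S Γ e τ) :
    ∀ {Γ' : Ctx D} {s : Var → Expr I},
      (∀ x ∈ e.fv, ∀ τ', Γ.lookup x = some τ' → HasType S Γ' (s x) τ') →
      HasType S Γ' (e.subst s) τ := by
  induction h with
  | const Γ c => intro Γ' s _; exact .const Γ' c
  | inj₀ Γ i hi => intro Γ' s _; exact .inj₀ Γ' i hi
  | prim Γ o => intro Γ' s _; exact .prim Γ' o
  | var Γ x τ h => intro Γ' s h'; exact h' x (by simp [Expr.fv]) τ h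
  | record Γ l e τ _ ih =>
    intro Γ' s h'
    exact .record Γ' l _ τ fun i => ih i fun x hx => h' x (by
      simp only [Expr.fv, Finset.mem_biUnion, Finset.mem_univ, true_and]; exact ⟨i, hx⟩)
  | proj Γ e l τ i _ ih => intro Γ' s h'; exact .proj Γ' _ l τ i (ih h')
  | inj Γ i e τ hi _ ih => intro Γ' s h'; exact .inj Γ' i _ τ hi (ih h')
  | case Γ e p b τ τ' Δ _ hp hl _ ihe ihb =>
    intro Γ' s h'
    simp only [Expr.fv, Finset.mem_union, Finset.mem_biUnion, Finset.mem_univ, true_and,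
      Finset.mem_sdiff, List.mem_toFinset] at h'
    refine .case Γ' _ _ _ τ τ' _ (ihe fun x hx => h' x (Or.inl hx)) (fun i => (hp i).rename _)
      (fun i => ?_) fun i => ihb i
        (HasType.under (hp i).map_fst fun x hx hxp => h' x (Or.inr ⟨i, hx, hxp⟩))
    rw [Pat.Linear, vars_rename]
    exact (hl i).map (add_left_injective _)
  | lam Γ x e τ₁ τ₂ _ ih =>
    intro Γ' s h'
    exact .lam Γ' _ _ τ₁ τ₂ (ih (HasType.under (Δ := [(x, τ₁)]) rfl
      fun y hy hyx => h' y (by simpa [Expr.fv, hy] using hyx)))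
  | app Γ e₁ e₂ τ₁ τ₂ _ _ ih₁ ih₂ =>
    intro Γ' s h'
    exact .app Γ' _ _ τ₁ τ₂ (ih₁ fun x hx => h' x (by simp [Expr.fv, hx]))
      (ih₂ fun x hx => h' x (by simp [Expr.fv, hx]))
  | fix Γ x e τ _ ih =>
    intro Γ' s h'
    exact .fix Γ' _ _ τ (ih (HasType.under (Δ := [(x, τ)]) rfl
      fun y hy hyx => h' y (by simpa [Expr.fv, hy] using hyx)))

theorem HasType.subst₁ {Γ : Ctx D} {x : Var} {e e' : Expr I} {τ τ' : Ty D}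
    (h : HasType S ((x, τ') :: Γ) e τ) (h' : HasType S Γ e' τ') :
    HasType S Γ (e.subst₁ x e') τ := by
  refine h.subst fun y _ τ'' hy => ?_
  by_cases hyx : y = x
  · subst hyx
    simp only [List.lookup_cons_self, Option.some.injEq] at hy
    subst hy
    simpa using h'
  · rw [Function.update_of_ne hyx]
    simp only [List.lookup_cons, beq_eq_false_iff_ne.2 hyx] at hy
    exact .var _ _ _ hy

theorem HasType.prim_inv {Γ : Ctx D} {o : PrimOp} {τ : Ty D} (h : HasType S Γ (.prim o) τ) :
    τ = o.ty := by cases h; rfl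

/-- Linearity ties the value and the type of `x` to the same place of the pattern. -/
theorem Matches.hasType {v : Expr I} {p : Pat I} {B : Bindings I} (h : Matches v p B) :
    ∀ {Γ Δ : Ctx D} {τ : Ty D}, PatTy S p τ Δ → p.Linear → HasType S Γ v τ →
      ∀ {x : Var} {w : Expr I} {τ' : Ty D}, (x, w) ∈ B → (x, τ') ∈ Δ → HasType S Γ w τ' := by
  induction h with
  | wild | const | inj₀ => intro Γ Δ τ _ _ _ x w τ' hx; simp at hx
  | var v y =>
    intro Γ Δ τ hp _ hv x w τ' hx hx'
    cases hp
    simp only [List.mem_singleton, Prod.mk.injEq] at hx hx'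
    rw [hx.2, hx'.2]
    exact hv
  | record l v p B hm ih =>
    intro Γ Δ τ hp hl hv x w τ' hx hx'
    cases hp with
    | record _ _ τs Δs hp =>
      cases hv with
      | record _ _ _ _ hv =>
        obtain ⟨_, hB, hx⟩ := List.mem_flatten.1 hx
        obtain ⟨i, rfl⟩ := List.mem_ofFn.1 hB
        obtain ⟨_, hB, hx'⟩ := List.mem_flatten.1 hx'
        obtain ⟨j, rfl⟩ := List.mem_ofFn.1 hB
        obtain rfl : i = j := hl.eq_of_mem
          ((hm i).map_fst ▸ List.mem_map.2 ⟨_, hx, rfl⟩) ((hp j).mem_vars hx')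
        exact ih i (hp i) (hl.of_record i) (hv i) hx hx'
  | asP v y p B hm ih =>
    intro Γ Δ τ hp hl hv x w τ' hx hx'
    have hl' : y ∉ p.vars ∧ p.vars.Nodup := by simpa [Pat.Linear, Pat.vars] using hl
    cases hp with
    | asP _ _ _ Δ hp =>
      have h₁ : (x, w) ∈ B → x ∈ p.vars := fun h =>
        hm.map_fst ▸ List.mem_map.2 ⟨_, h, rfl⟩
      rcases List.mem_cons.1 hx with hx | hx <;> rcases List.mem_cons.1 hx' with hx' | hx'
      · simp only [Prod.mk.injEq] at hx hx'
        rw [hx.2, hx'.2]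
        exact hv
      · cases hx
        exact absurd (hp.mem_vars hx') hl'.1
      · cases hx'
        exact absurd (h₁ hx) hl'.1
      · exact ih hp hl'.2 hv hx hx'
  | inj i v p B _ ih =>
    intro Γ Δ τ hp hl hv x w τ' hx hx'
    cases hp with
    | inj _ _ τ₁ _ hi hp =>
      generalize hτ : Ty.data (S.res i) = τ₀ at hv
      cases hv with
      | inj _ _ _ τ₂ hi' hv =>
        cases hi.symm.trans hi'
        exact ih hp hl hv hx hx'

theorem PrimOp.eval_ty (o : PrimOp) (a b : ℤ) : (o.eval a b).ty = o.resTy := by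
  cases o <;> rfl

theorem Step.hasType {e e' : Expr I} (h : Step e e') :
    ∀ {Γ : Ctx D} {τ : Ty D}, HasType S Γ e τ → HasType S Γ e' τ := by
  induction h with
  | record l e i e' _ _ ih =>
    intro Γ τ ht
    cases ht with
    | record _ _ _ τs ht =>
      refine .record Γ l _ τs fun j => ?_
      by_cases hj : j = i
      · subst hj; simpa using ih (ht j)
      · simpa [Function.update_of_ne hj] using ht j
  | proj e e' k _ ih =>
    intro Γ τ ht
    cases ht with | proj _ _ l τs i ht => exact .proj Γ e' l τs i (ih ht)
  | proj_record l e i hv =>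
    intro Γ τ ht
    generalize hk : l i = k at ht
    cases ht with
    | proj _ _ l' τs j ht =>
      cases ht with
      | record _ _ _ _ ht =>
        cases l.injective hk
        exact ht i
  | inj i e e' _ ih =>
    intro Γ τ ht
    cases ht with | inj _ _ _ τ hi ht => exact .inj Γ i e' τ hi (ih ht)
  | case e e' p b _ ih =>
    intro Γ τ ht
    cases ht with
    | case _ _ _ _ τ₁ _ Δ he hp hl hb => exact .case Γ e' p b τ₁ τ Δ (ih he) hp hl hb
  | case_match e p b i B hv hn hm =>
    intro Γ τ ht
    cases ht with
    | case _ _ _ _ τ₁ _ Δ he hp hl hb =>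
      refine (hb i).subst fun x _ τ' hx => ?_
      by_cases hxp : x ∈ (p i).vars
      · obtain ⟨w, hw⟩ := exists_lookup (hm.map_fst ▸ hxp)
        simp only [hw, Option.getD_some]
        exact hm.hasType (hp i) (hl i) he (mem_of_lookup hw)
          ((hp i).mem_of_lookup_append hxp hx)
      · have hw : B.lookup x = none := lookup_eq_none_iff'.2 (hm.map_fst ▸ hxp)
        simp only [hw, Option.getD_none]
        exact .var _ _ _ ((hp i).lookup_append Γ hxp ▸ hx)
  | app_left e₁ e₁' e₂ _ ih =>
    intro Γ τ ht
    cases ht with | app _ _ _ τ₁ _ h₁ h₂ => exact .app Γ _ _ τ₁ τ (ih h₁) h₂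
  | app_right e₁ e₂ e₂' _ _ ih =>
    intro Γ τ ht
    cases ht with | app _ _ _ τ₁ _ h₁ h₂ => exact .app Γ _ _ τ₁ τ h₁ (ih h₂)
  | beta x e e₂ _ =>
    intro Γ τ ht
    cases ht with
    | app _ _ _ τ₁ _ h₁ h₂ => cases h₁ with | lam _ _ _ _ _ h₁ => exact h₁.subst₁ h₂
  | fix x e =>
    intro Γ τ ht
    cases ht with | fix _ _ _ _ h => exact h.subst₁ (.fix Γ x e τ h)
  | prim o a b =>
    intro Γ τ ht
    cases ht with
    | app _ _ _ τ₁ _ h₁ h₂ =>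
      have := h₁.prim_inv
      simp only [PrimOp.ty, Ty.arrow.injEq] at this
      rw [this.2, ← o.eval_ty a b]
      exact .const Γ _

theorem Evals.hasType {e v : Expr I} (h : Evals e v) {Γ : Ctx D} {τ : Ty D}
    (ht : HasType S Γ e τ) : HasType S Γ v τ := by
  induction h with
  | val => exact ht
  | step e e' v h _ ih => exact ih (h.hasType ht)

theorem Evals.val' {e v : Expr I} (h : Evals e v) : Val v := by
  induction h with
  | val v h => exact h
  | step e e' v _ _ ih => exact ih

end Typing

-- Coherence of tokens and the fundamental lemma.

section Coherence

variable {D : Type u} {I : Type v}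

/-- The token is one of a value of type `τ`. -/
def Tok.Ok (S : Signature D I) : Tok I → Ty D → Prop
  | .const c, τ => τ = .base c.ty
  | .record l t, τ => ∃ τs, τ = .record l τs ∧ ∀ i, (t i).Ok S (τs i)
  | .inj i t, τ => ∃ τ', S.arg i = some τ' ∧ τ = .data (S.res i) ∧ t.Ok S τ'
  | .inj₀ i, τ => S.arg i = none ∧ τ = .data (S.res i)
  | .fn, τ => ∃ τ₁ τ₂, τ = .arrow τ₁ τ₂
  -- `Sem` lists tokens of a function for argument families of any type, so the result is
  -- constrained only for families of the right one.
  | .arr A b, τ => ∃ τ₁ τ₂, τ = .arrow τ₁ τ₂ ∧ ((∀ i, (A i).Ok S τ₁) → b.Ok S τ₂)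

/-- Coherence at the type `τ`: the two tokens do not tell two values apart. Functions are coherent
if they have coherent results for all coherent arguments for which both have one. -/
def Tok.Coh (S : Signature D I) : Tok I → Ty D → Tok I → Prop
  | .const c, τ, u => τ = .base c.ty ∧ u = .const c
  | .record l t, τ, u =>
      ∃ τs us, τ = .record l τs ∧ u = .record l us ∧ ∀ i, (t i).Coh S (τs i) (us i)
  | .inj i t, τ, u =>
      ∃ τ' u', S.arg i = some τ' ∧ τ = .data (S.res i) ∧ u = .inj i u' ∧ t.Coh S τ' u'
  | .inj₀ i, τ, u => S.arg i = none ∧ τ = .data (S.res i) ∧ u = .inj₀ i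
  | .fn, τ, u => (∃ τ₁ τ₂, τ = .arrow τ₁ τ₂) ∧
      (u = .fn ∨ ∃ (m : ℕ) (A' : Fin (m + 1) → Tok I) (b' : Tok I), u = .arr A' b')
  | .arr A b, τ, u => ∃ τ₁ τ₂, τ = .arrow τ₁ τ₂ ∧
      (u = .fn ∨ ∃ (m : ℕ) (A' : Fin (m + 1) → Tok I) (b' : Tok I), u = .arr A' b' ∧
        ((∀ i, (A i).Ok S τ₁) → (∀ j, (A' j).Ok S τ₁) →
          (∀ i j, (A i).Coh S τ₁ (A' j)) → b.Coh S τ₂ b'))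

variable {S : Signature D I}

/-- The definition recurses on the left token alone, so symmetry is not built in. An equivalence is
needed in the induction, because arguments occur as premises and results as conclusions. -/
theorem Tok.coh_comm (t : Tok I) : ∀ {τ : Ty D} {u : Tok I}, t.Coh S τ u ↔ u.Coh S τ t := by
  induction t with
  | const c =>
    intro τ u
    refine ⟨?_, fun h => ?_⟩
    · rintro ⟨rfl, rfl⟩; exact ⟨rfl, rfl⟩
    · cases u <;> simp_all [Tok.Coh]
  | record l t ih =>
    intro τ u
    constructor
    · rintro ⟨τs, us, rfl, rfl, h⟩
      exact ⟨τs, t, rfl, rfl, fun i => (ih i).1 (h i)⟩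
    · intro h
      cases u with
      | record l' us =>
        obtain ⟨τs, _, rfl, hu, h⟩ := h
        cases hu
        exact ⟨τs, us, rfl, rfl, fun i => (ih i).2 (h i)⟩
      | _ => simp [Tok.Coh] at h
  | inj i t ih =>
    intro τ u
    constructor
    · rintro ⟨τ', u', hi, rfl, rfl, h⟩
      exact ⟨τ', t, hi, rfl, rfl, ih.1 h⟩
    · intro h
      cases u with
      | inj i' u =>
        obtain ⟨τ', _, hi, rfl, hu, h⟩ := h
        cases hu
        exact ⟨τ', u, hi, rfl, rfl, ih.2 h⟩
      | _ => simp [Tok.Coh] at h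
  | inj₀ i =>
    intro τ u
    refine ⟨?_, fun h => ?_⟩
    · rintro ⟨hi, rfl, rfl⟩; exact ⟨hi, rfl, rfl⟩
    · cases u with
      | inj₀ j => obtain ⟨hj, rfl, h⟩ := h; cases h; exact ⟨hj, rfl, rfl⟩
      | _ => simp [Tok.Coh] at h
  | fn =>
    intro τ u
    constructor
    · rintro ⟨⟨τ₁, τ₂, rfl⟩, rfl | ⟨m, A', b', rfl⟩⟩
      · exact ⟨⟨τ₁, τ₂, rfl⟩, Or.inl rfl⟩
      · exact ⟨τ₁, τ₂, rfl, Or.inl rfl⟩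
    · intro h
      cases u with
      | fn => exact h
      | arr A b => obtain ⟨τ₁, τ₂, rfl, -⟩ := h; exact ⟨⟨τ₁, τ₂, rfl⟩, Or.inr ⟨_, A, b, rfl⟩⟩
      | _ => simp [Tok.Coh] at h
  | arr A b ihA ihb =>
    intro τ u
    constructor
    · rintro ⟨τ₁, τ₂, rfl, rfl | ⟨m, A', b', rfl, h⟩⟩
      · exact ⟨⟨τ₁, τ₂, rfl⟩, Or.inr ⟨_, A, b, rfl⟩⟩
      · exact ⟨τ₁, τ₂, rfl, Or.inr ⟨_, A, b, rfl, fun hA' hA hc =>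
          ihb.1 (h hA hA' fun i j => (ihA i).2 (hc j i))⟩⟩
    · intro h
      cases u with
      | fn => obtain ⟨⟨τ₁, τ₂, rfl⟩, -⟩ := h; exact ⟨τ₁, τ₂, rfl, Or.inl rfl⟩
      | arr A' b' =>
        obtain ⟨τ₁, τ₂, rfl, h | ⟨m, _, _, hu, h⟩⟩ := h
        · cases h
        · cases hu
          exact ⟨τ₁, τ₂, rfl, Or.inr ⟨_, A', b', rfl, fun hA hA' hc =>
            ihb.2 (h hA' hA fun i j => (ihA j).1 (hc j i))⟩⟩
      | _ => simp [Tok.Coh] at h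

/-- All tokens of the set are of type `τ`. -/
def OkSet (S : Signature D I) (P : Set (Tok I)) (τ : Ty D) : Prop := ∀ t ∈ P, t.Ok S τ

/-- All tokens of the one set are coherent with all tokens of the other. -/
def CohSet (S : Signature D I) (P : Set (Tok I)) (τ : Ty D) (Q : Set (Tok I)) : Prop :=
  ∀ t ∈ P, ∀ u ∈ Q, t.Coh S τ u

theorem CohSet.symm {P Q : Set (Tok I)} {τ : Ty D} (h : CohSet S P τ Q) : CohSet S Q τ P :=
  fun t ht u hu => (Tok.coh_comm t).2 (h u hu t ht)

theorem CohSet.mono {P P' Q Q' : Set (Tok I)} {τ : Ty D} (h : CohSet S P τ Q) (hP : P' ⊆ P)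
    (hQ : Q' ⊆ Q) : CohSet S P' τ Q' := fun t ht u hu => h t (hP ht) u (hQ hu)

theorem Tok.Ok.tbind {p : Pat I} {τ : Ty D} {Δ : Ctx D} (hp : PatTy S p τ Δ) :
    ∀ {t w : Tok I} {x : Var} {τ' : Ty D}, p.Linear → t.Ok S τ → TBind t p x w → (x, τ') ∈ Δ →
      w.Ok S τ' := by
  induction hp with
  | wild | const | inj₀ => intro t w x τ' _ _ hb; cases hb
  | var y τ =>
    intro t w x τ' _ ht hb hx
    cases hb
    simp only [List.mem_singleton, Prod.mk.injEq] at hx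
    rw [hx.2]
    exact ht
  | record l p τ Δ hp ih =>
    intro t w x τ' hl ht hb hx
    cases hb with
    | record _ t _ i _ _ hb =>
      obtain ⟨_, hB, hx⟩ := List.mem_flatten.1 hx
      obtain ⟨j, rfl⟩ := List.mem_ofFn.1 hB
      obtain rfl : i = j := hl.eq_of_mem hb.mem_vars ((hp j).mem_vars hx)
      obtain ⟨τs, hτ, ht⟩ := ht
      cases hτ
      exact ih i (hl.of_record i) (ht i) hb hx
  | asP y p τ Δ hp ih =>
    intro t w x τ' hl ht hb hx
    have hl' : y ∉ p.vars ∧ p.vars.Nodup := by simpa [Pat.Linear, Pat.vars] using hl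
    cases hb with
    | as_self =>
      rcases List.mem_cons.1 hx with hx | hx
      · cases hx; exact ht
      · exact absurd (hp.mem_vars hx) hl'.1
    | asP _ _ _ _ _ hb =>
      rcases List.mem_cons.1 hx with hx | hx
      · cases hx; exact absurd hb.mem_vars hl'.1
      · exact ih hl'.2 ht hb hx
  | inj i p τ Δ hi hp ih =>
    intro t w x τ' hl ht hb hx
    cases hb with
    | inj _ t _ _ _ hb =>
      obtain ⟨τ₁, hi', -, ht⟩ := ht
      cases hi.symm.trans hi'
      exact ih hl ht hb hx

/-- By linearity both tokens bind `x` at the same place of the pattern, and coherence passes to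
components. -/
theorem Tok.Coh.tbind {p : Pat I} {τ : Ty D} {Δ : Ctx D} (hp : PatTy S p τ Δ) :
    ∀ {t t' w w' : Tok I} {x : Var} {τ' : Ty D}, p.Linear → t.Coh S τ t' → TBind t p x w →
      TBind t' p x w' → (x, τ') ∈ Δ → w.Coh S τ' w' := by
  induction hp with
  | wild | const | inj₀ => intro t t' w w' x τ' _ _ hb; cases hb
  | var y τ =>
    intro t t' w w' x τ' _ ht hb hb' hx
    cases hb
    cases hb'
    simp only [List.mem_singleton, Prod.mk.injEq] at hx
    rw [hx.2]
    exact ht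
  | record l p τ Δ hp ih =>
    intro t t' w w' x τ' hl ht hb hb' hx
    cases hb with
    | record _ t _ i _ _ hb =>
      cases hb' with
      | record _ t' _ i' _ _ hb' =>
        obtain ⟨_, hB, hx⟩ := List.mem_flatten.1 hx
        obtain ⟨j, rfl⟩ := List.mem_ofFn.1 hB
        obtain rfl : i = j := hl.eq_of_mem hb.mem_vars ((hp j).mem_vars hx)
        obtain rfl : i = i' := hl.eq_of_mem hb.mem_vars hb'.mem_vars
        obtain ⟨τs, us, hτ, hu, ht⟩ := ht
        cases hτ
        cases hu
        exact ih i (hl.of_record i) (ht i) hb hb' hx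
  | asP y p τ Δ hp ih =>
    intro t t' w w' x τ' hl ht hb hb' hx
    have hl' : y ∉ p.vars ∧ p.vars.Nodup := by simpa [Pat.Linear, Pat.vars] using hl
    rcases List.mem_cons.1 hx with hx | hx
    · cases hx
      cases hb with
      | asP _ _ _ _ _ hb => exact absurd hb.mem_vars hl'.1
      | as_self =>
        cases hb' with
        | asP _ _ _ _ _ hb' => exact absurd hb'.mem_vars hl'.1
        | as_self => exact ht
    · cases hb with
      | as_self => exact absurd (hp.mem_vars hx) hl'.1
      | asP _ _ _ _ _ hb =>
        cases hb' with
        | as_self => exact absurd (hp.mem_vars hx) hl'.1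
        | asP _ _ _ _ _ hb' => exact ih hl'.2 ht hb hb' hx
  | inj i p τ Δ hi hp ih =>
    intro t t' w w' x τ' hl ht hb hb' hx
    cases hb with
    | inj _ t _ _ _ hb =>
      cases hb' with
      | inj _ t' _ _ _ hb' =>
        obtain ⟨τ₁, _, hi', -, hu, ht⟩ := ht
        cases hu
        cases hi.symm.trans hi'
        exact ih hl ht hb hb' hx

/-- Coherent tokens agree outside functions, and patterns do not look into functions. -/
theorem Tok.Coh.tmatch {t : Tok I} {p : Pat I} (h : TMatch t p) :
    ∀ {τ : Ty D} {u : Tok I}, t.Coh S τ u → TMatch u p := by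
  induction h with
  | wild t => intro τ u _; exact .wild u
  | var t x => intro τ u _; exact .var u x
  | record l t p _ ih =>
    rintro τ u ⟨τs, us, rfl, rfl, h⟩
    exact .record l us p fun i => ih i (h i)
  | asP t x p _ ih => intro τ u h; exact .asP u x p (ih h)
  | const c => rintro τ u ⟨rfl, rfl⟩; exact .const c
  | inj i t p _ ih => rintro τ u ⟨τ', u', hi, rfl, rfl, h⟩; exact .inj i u' p (ih h)
  | inj₀ i => rintro τ u ⟨hi, rfl, rfl⟩; exact .inj₀ i

theorem primSet_ok (o : PrimOp) : OkSet S (primSet o : Set (Tok I)) o.ty := by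
  rintro t (rfl | ⟨n, A, a, b, -, rfl⟩)
  · exact ⟨_, _, rfl⟩
  · exact ⟨_, _, rfl, fun _ => congrArg Ty.base (o.eval_ty a b).symm⟩

theorem pairTok_coh {a b a' b' : ℤ} {τ : Ty D}
    (h : (pairTok a b : Tok I).Coh S τ (pairTok a' b')) : a = a' ∧ b = b' := by
  obtain ⟨τs, us, rfl, hu, h⟩ := h
  simp only [pairTok, Tok.record.injEq, heq_eq_eq, true_and] at hu
  subst hu
  have h0 := (h 0).2
  have h1 := (h 1).2
  simp only [Matrix.cons_val_zero, Matrix.cons_val_one, Tok.const.injEq, Const.int.injEq] at h0 h1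
  exact ⟨h0.symm, h1.symm⟩

/-- Each argument family contains a pair of integers; coherence of the families makes the two pairs
equal, hence also the results. -/
theorem primSet_coh (o : PrimOp) : CohSet S (primSet o : Set (Tok I)) o.ty (primSet o) := by
  rintro t (rfl | ⟨n, A, a, b, ⟨i, hi⟩, rfl⟩) u (rfl | ⟨n', A', a', b', ⟨i', hi'⟩, rfl⟩)
  · exact ⟨⟨_, _, rfl⟩, Or.inl rfl⟩
  · exact ⟨⟨_, _, rfl⟩, Or.inr ⟨_, _, _, rfl⟩⟩
  · exact ⟨_, _, rfl, Or.inl rfl⟩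
  · refine ⟨_, _, rfl, Or.inr ⟨_, _, _, rfl, fun _ _ h => ?_⟩⟩
    have := h i i'
    rw [hi, hi'] at this
    obtain ⟨rfl, rfl⟩ := pairTok_coh this
    exact ⟨congrArg Ty.base (o.eval_ty a b).symm, rfl⟩

/-- An application of coherent functions to coherent arguments. -/
theorem CohSet.app {P Q : Set (Tok I)} {τ₁ τ₂ : Ty D} (h : CohSet S P (.arrow τ₁ τ₂) Q)
    {n m : ℕ} {A : Fin (n + 1) → Tok I} {A' : Fin (m + 1) → Tok I} {b b' : Tok I}
    (hb : .arr A b ∈ P) (hb' : .arr A' b' ∈ Q) (hA : ∀ i, (A i).Ok S τ₁)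
    (hA' : ∀ i, (A' i).Ok S τ₁) (hc : ∀ i j, (A i).Coh S τ₁ (A' j)) : b.Coh S τ₂ b' := by
  obtain ⟨_, _, hτ, h | ⟨m, _, _, hu, h⟩⟩ := h _ hb _ hb'
  · cases h
  · cases hτ
    cases hu
    exact h hA hA' hc

theorem CohSet.proj {P Q : Set (Tok I)} {n : ℕ} {l : Fin n ↪ Label} {τ : Fin n → Ty D}
    (h : CohSet S P (.record l τ) Q) {i : Fin n} {m m' : ℕ} {l₁ : Fin m ↪ Label}
    {l₂ : Fin m' ↪ Label} {t : Fin m → Tok I} {u : Fin m' → Tok I} {j : Fin m} {k : Fin m'}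
    (ht : .record l₁ t ∈ P) (hj : l₁ j = l i) (hu : .record l₂ u ∈ Q) (hk : l₂ k = l i) :
    (t j).Coh S (τ i) (u k) := by
  obtain ⟨_, _, hτ, hu', h⟩ := h _ ht _ hu
  cases hτ
  cases hu'
  obtain rfl := l.injective hj
  obtain rfl := l.injective hk
  exact h _

/-- The environment agrees with the context. -/
def EnvOk (S : Signature D I) (Γ : Ctx D) (ρ : Env I) : Prop :=
  ∀ x τ, Γ.lookup x = some τ → OkSet S (ρ x) τ

def EnvCoh (S : Signature D I) (Γ : Ctx D) (ρ ρ' : Env I) : Prop :=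
  ∀ x τ, Γ.lookup x = some τ → CohSet S (ρ x) τ (ρ' x)

theorem EnvOk.update {Γ : Ctx D} {ρ : Env I} (h : EnvOk S Γ ρ) {x : Var} {τ : Ty D}
    {X : Set (Tok I)} (hX : OkSet S X τ) : EnvOk S ((x, τ) :: Γ) (Function.update ρ x X) := by
  intro y τ' hy
  by_cases hyx : y = x
  · subst hyx
    simp only [List.lookup_cons_self, Option.some.injEq] at hy
    subst hy
    simpa using hX
  · simp only [List.lookup_cons, beq_eq_false_iff_ne.2 hyx] at hy
    rw [Function.update_of_ne hyx]
    exact h y τ' hy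

theorem EnvCoh.update {Γ : Ctx D} {ρ ρ' : Env I} (h : EnvCoh S Γ ρ ρ') {x : Var} {τ : Ty D}
    {X X' : Set (Tok I)} (hX : CohSet S X τ X') :
    EnvCoh S ((x, τ) :: Γ) (Function.update ρ x X) (Function.update ρ' x X') := by
  intro y τ' hy
  by_cases hyx : y = x
  · subst hyx
    simp only [List.lookup_cons_self, Option.some.injEq] at hy
    subst hy
    simpa using hX
  · simp only [List.lookup_cons, beq_eq_false_iff_ne.2 hyx] at hy
    rw [Function.update_of_ne hyx, Function.update_of_ne hyx]
    exact h y τ' hy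

theorem EnvOk.bind {Γ Δ : Ctx D} {ρ : Env I} (h : EnvOk S Γ ρ) {p : Pat I} {τ : Ty D}
    (hp : PatTy S p τ Δ) (hl : p.Linear) {P : Set (Tok I)} (hP : OkSet S P τ) :
    EnvOk S (Δ ++ Γ) (bindEnv ρ p P) := by
  intro x τ' hx
  by_cases hxp : x ∈ p.vars
  · simp only [bindEnv, hxp, if_true]
    rintro w ⟨t, ht, hb⟩
    exact Tok.Ok.tbind hp hl (hP t ht) hb (hp.mem_of_lookup_append hxp hx)
  · simp only [bindEnv, hxp, if_false]
    exact h x τ' (hp.lookup_append Γ hxp ▸ hx)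

theorem EnvCoh.bind {Γ Δ : Ctx D} {ρ ρ' : Env I} (h : EnvCoh S Γ ρ ρ') {p : Pat I} {τ : Ty D}
    (hp : PatTy S p τ Δ) (hl : p.Linear) {P P' : Set (Tok I)} (hP : CohSet S P τ P') :
    EnvCoh S (Δ ++ Γ) (bindEnv ρ p P) (bindEnv ρ' p P') := by
  intro x τ' hx
  by_cases hxp : x ∈ p.vars
  · simp only [bindEnv, hxp, if_true]
    rintro w ⟨t, ht, hb⟩ w' ⟨t', ht', hb'⟩
    exact Tok.Coh.tbind hp hl (hP t ht t' ht') hb hb' (hp.mem_of_lookup_append hxp hx)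
  · simp only [bindEnv, hxp, if_false]
    exact h x τ' (hp.lookup_append Γ hxp ▸ hx)

/-- At a fixed point, the tokens of the right type form a prefixed set. -/
theorem HasType.okSet {Γ : Ctx D} {e : Expr I} {τ : Ty D} (h : HasType S Γ e τ) :
    ∀ {ρ : Env I}, EnvOk S Γ ρ → OkSet S (Sem e ρ) τ := by
  induction h with
  | const Γ c => rintro ρ _ t rfl; rfl
  | var Γ x τ h => intro ρ hρ; exact hρ x τ h
  | record Γ l e τ _ ih =>
    rintro ρ hρ t ⟨u, rfl, hu⟩
    exact ⟨τ, rfl, fun i => ih i hρ _ (hu i)⟩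
  | proj Γ e l τ i _ ih =>
    rintro ρ hρ t ⟨n, l', u, j, hu, hj, rfl⟩
    obtain ⟨_, hτ, h⟩ := ih hρ _ hu
    cases hτ
    obtain rfl := l.injective hj
    exact h _
  | inj₀ Γ i hi => rintro ρ _ t rfl; exact ⟨hi, rfl⟩
  | inj Γ i e τ hi _ ih =>
    rintro ρ hρ t ⟨u, rfl, hu⟩
    exact ⟨τ, hi, rfl, ih hρ _ hu⟩
  | case Γ e p b τ τ' Δ _ hp hl _ ihe ihb =>
    rintro ρ hρ t ⟨i, -, ht⟩
    exact ihb i (hρ.bind (hp i) (hl i) (ihe hρ)) t ht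
  | lam Γ x e τ₁ τ₂ _ ih =>
    rintro ρ hρ t (rfl | ⟨n, A, b, rfl, hb⟩)
    · exact ⟨τ₁, τ₂, rfl⟩
    · exact ⟨τ₁, τ₂, rfl, fun hA => ih (hρ.update (Set.forall_mem_range.2 hA)) b hb⟩
  | app Γ e₁ e₂ τ₁ τ₂ _ _ ih₁ ih₂ =>
    rintro ρ hρ t ⟨n, A, hA, hi⟩
    obtain ⟨_, _, hτ, h⟩ := ih₁ hρ _ hA
    cases hτ
    exact h fun i => ih₂ hρ _ (hi i)
  | fix Γ x e τ _ ih =>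
    intro ρ hρ
    exact fixSet_subset (X := {t : Tok I | t.Ok S τ}) (ih (hρ.update fun t ht => ht))
  | prim Γ o => intro ρ _; exact primSet_ok o

/-- Every expression preserves coherence. -/
theorem HasType.cohSet {Γ : Ctx D} {e : Expr I} {τ : Ty D} (h : HasType S Γ e τ) :
    ∀ {ρ ρ' : Env I}, EnvOk S Γ ρ → EnvOk S Γ ρ' → EnvCoh S Γ ρ ρ' →
      CohSet S (Sem e ρ) τ (Sem e ρ') := by
  induction h with
  | const Γ c => rintro ρ ρ' _ _ _ t rfl u rfl; exact ⟨rfl, rfl⟩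
  | var Γ x τ h => intro ρ ρ' _ _ hc; exact hc x τ h
  | record Γ l e τ _ ih =>
    rintro ρ ρ' hρ hρ' hc t ⟨t, rfl, ht⟩ u ⟨u, rfl, hu⟩
    exact ⟨τ, u, rfl, rfl, fun i => ih i hρ hρ' hc _ (ht i) _ (hu i)⟩
  | proj Γ e l τ i _ ih =>
    rintro ρ ρ' hρ hρ' hc _ ⟨n, l₁, t, j, ht, hj, rfl⟩ _ ⟨m, l₂, u, k, hu, hk, rfl⟩
    exact (ih hρ hρ' hc).proj ht hj hu hk
  | inj₀ Γ i hi => rintro ρ ρ' _ _ _ t rfl u rfl; exact ⟨hi, rfl, rfl⟩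
  | inj Γ i e τ hi _ ih =>
    rintro ρ ρ' hρ hρ' hc _ ⟨t, rfl, ht⟩ _ ⟨u, rfl, hu⟩
    exact ⟨τ, u, hi, rfl, rfl, ih hρ hρ' hc _ ht _ hu⟩
  | case Γ e p b τ τ' Δ he hp hl hb ihe ihb =>
    rintro ρ ρ' hρ hρ' hc t ⟨i, ⟨v, hv, hm, hn⟩, ht⟩ t' ⟨i', ⟨v', hv', hm', hn'⟩, ht'⟩
    have hcv := ihe hρ hρ' hc
    -- If the branches differed, the pattern of the earlier one would, by coherence, also match the
    -- token on the other side, where it was passed over.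
    obtain rfl : i = i' := by
      rcases lt_trichotomy i i' with hlt | heq | hlt
      · exact absurd (Tok.Coh.tmatch hm (hcv v hv v' hv')) (hn' i hlt)
      · exact heq
      · exact absurd (Tok.Coh.tmatch hm' (hcv.symm v' hv' v hv)) (hn i' hlt)
    exact ihb i (hρ.bind (hp i) (hl i) (he.okSet hρ)) (hρ'.bind (hp i) (hl i) (he.okSet hρ'))
      (hc.bind (hp i) (hl i) hcv) t ht t' ht'
  | lam Γ x e τ₁ τ₂ _ ih =>
    rintro ρ ρ' hρ hρ' hc t (rfl | ⟨n, A, b, rfl, hb⟩) u (rfl | ⟨m, A', b', rfl, hb'⟩)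
    · exact ⟨⟨τ₁, τ₂, rfl⟩, Or.inl rfl⟩
    · exact ⟨⟨τ₁, τ₂, rfl⟩, Or.inr ⟨_, _, _, rfl⟩⟩
    · exact ⟨τ₁, τ₂, rfl, Or.inl rfl⟩
    · refine ⟨τ₁, τ₂, rfl, Or.inr ⟨_, _, _, rfl, fun hA hA' hAA' => ?_⟩⟩
      exact ih (hρ.update (Set.forall_mem_range.2 hA)) (hρ'.update (Set.forall_mem_range.2 hA'))
        (hc.update (Set.forall_mem_range.2 fun i => Set.forall_mem_range.2 (hAA' i))) b hb b' hb'
  | app Γ e₁ e₂ τ₁ τ₂ _ h₂ ih₁ ih₂ =>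
    rintro ρ ρ' hρ hρ' hc t ⟨n, A, hA, hi⟩ u ⟨m, A', hA', hi'⟩
    exact (ih₁ hρ hρ' hc).app hA hA' (fun i => h₂.okSet hρ _ (hi i))
      (fun i => h₂.okSet hρ' _ (hi' i)) fun i j => ih₂ hρ hρ' hc _ (hi i) _ (hi' j)
  | fix Γ x e τ h ih =>
    intro ρ ρ' hρ hρ' hc
    have hX' : OkSet S (Sem (.fix x e) ρ') τ := (HasType.fix Γ x e τ h).okSet hρ'
    -- Fixed-point induction is needed on the left only; on the right one unfolding is enough.
    -- Typing is carried along because the induction hypothesis requires environments that agree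
    -- with the context.
    have : Sem (.fix x e) ρ ⊆ {t | t.Ok S τ ∧ ∀ u ∈ Sem (.fix x e) ρ', t.Coh S τ u} := by
      refine fixSet_subset fun t ht => ⟨?_, fun u hu => ?_⟩
      · exact h.okSet (hρ.update fun t ht => ht.1) t ht
      · rw [← Sem_fix] at hu
        exact ih (hρ.update fun t ht => ht.1) (hρ'.update hX') (hc.update fun t ht => ht.2)
          t ht u hu
    exact fun t ht => (this ht).2
  | prim Γ o => intro ρ ρ' _ _ _; exact primSet_coh o

end Coherence

-- Closed values whose functions are interpreted by sets of tokens.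

section Interpretation

variable {D : Type u} {I : Type v}

/-- The tokens of a closed value at a type, if `θ` says what its functions stand for. -/
inductive Den (S : Signature D I) (θ : Ty D → Expr I → Set (Tok I)) :
    Expr I → Ty D → Tok I → Prop
  | const (c : Const) : Den S θ (.const c) (.base c.ty) (.const c)
  | record {n : ℕ} (l : Fin n ↪ Label) (w : Fin n → Expr I) (τ : Fin n → Ty D)
      (t : Fin n → Tok I) (h : ∀ i, Den S θ (w i) (τ i) (t i)) :
      Den S θ (.record l w) (.record l τ) (.record l t)
  | inj (i : I) (w : Expr I) (τ : Ty D) (t : Tok I) (hi : S.arg i = some τ)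
      (h : Den S θ w τ t) : Den S θ (.inj i w) (.data (S.res i)) (.inj i t)
  | inj₀ (i : I) (hi : S.arg i = none) : Den S θ (.inj₀ i) (.data (S.res i)) (.inj₀ i)
  | lam (x : Var) (e : Expr I) (τ₁ τ₂ : Ty D) (t : Tok I)
      (h : t ∈ θ (.arrow τ₁ τ₂) (.lam x e)) : Den S θ (.lam x e) (.arrow τ₁ τ₂) t
  | prim (o : PrimOp) (t : Tok I) (h : t ∈ primSet o) : Den S θ (.prim o) o.ty t

variable {S : Signature D I}

/-- Two interpretations of functions that are coherent. -/
structure CohInterp (S : Signature D I) (θ₁ θ₂ : Ty D → Expr I → Set (Tok I)) : Prop where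
  ok_left : ∀ τ f, OkSet S (θ₁ τ f) τ
  ok_right : ∀ τ f, OkSet S (θ₂ τ f) τ
  coh : ∀ τ f, CohSet S (θ₁ τ f) τ (θ₂ τ f)

theorem CohInterp.symm {θ₁ θ₂ : Ty D → Expr I → Set (Tok I)} (h : CohInterp S θ₁ θ₂) :
    CohInterp S θ₂ θ₁ := ⟨h.ok_right, h.ok_left, fun τ f => (h.coh τ f).symm⟩

theorem Den.ok {θ : Ty D → Expr I → Set (Tok I)} (hθ : ∀ τ f, OkSet S (θ τ f) τ) {v : Expr I}
    {τ : Ty D} {t : Tok I} (h : Den S θ v τ t) : t.Ok S τ := by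
  induction h with
  | const c => rfl
  | record l w τ t _ ih => exact ⟨τ, rfl, ih⟩
  | inj i w τ t hi _ ih => exact ⟨τ, hi, rfl, ih⟩
  | inj₀ i hi => exact ⟨hi, rfl⟩
  | lam x e τ₁ τ₂ t h => exact hθ _ _ t h
  | prim o t h => exact primSet_ok o t h

/-- Both tokens describe the same value, so they can differ only at its functions, where the
interpretations are coherent. -/
theorem Den.coh {θ₁ θ₂ : Ty D → Expr I → Set (Tok I)} (hθ : CohInterp S θ₁ θ₂) {v : Expr I}
    {τ : Ty D} {t : Tok I} (h : Den S θ₁ v τ t) :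
    ∀ {u : Tok I}, Den S θ₂ v τ u → t.Coh S τ u := by
  induction h with
  | const c =>
    intro u hu
    generalize hτ : Ty.base c.ty = τ at hu
    cases hu
    exact ⟨rfl, rfl⟩
  | record l w τ t _ ih =>
    intro u hu
    cases hu with | record _ _ _ u hu => exact ⟨τ, u, rfl, rfl, fun i => ih i (hu i)⟩
  | inj i w τ t hi _ ih =>
    intro u hu
    generalize hτ : Ty.data (S.res i) = τ₀ at hu
    cases hu with
    | inj _ _ τ' u hi' hu =>
      cases hi.symm.trans hi'
      exact ⟨τ, u, hi, rfl, rfl, ih hu⟩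
  | inj₀ i hi =>
    intro u hu
    generalize hτ : Ty.data (S.res i) = τ₀ at hu
    cases hu
    exact ⟨hi, rfl, rfl⟩
  | lam x e τ₁ τ₂ t h =>
    intro u hu
    cases hu with | lam _ _ _ _ _ hu => exact hθ.coh _ _ t h u hu
  | prim o t h =>
    intro u hu
    generalize hτ : PrimOp.ty o = τ₀ at hu
    cases hu with | prim _ _ hu => exact primSet_coh o t h u hu

/-- Every variable stands for a closed value of its type. -/
def Typed (S : Signature D I) (Ω : Var → Ty D) (s : Var → Expr I) : Prop :=
  ∀ x, Val (s x) ∧ HasType S [] (s x) (Ω x)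

/-- Every variable has one type `Ω x` throughout a derivation, so the environment does not change
when the context grows. -/
def denEnv (S : Signature D I) (Ω : Var → Ty D) (θ : Ty D → Expr I → Set (Tok I))
    (s : Var → Expr I) : Env I := fun x => {t | Den S θ (s x) (Ω x) t}

theorem denEnv_ok {Ω : Var → Ty D} {θ : Ty D → Expr I → Set (Tok I)} {s : Var → Expr I}
    (hθ : ∀ τ f, OkSet S (θ τ f) τ) {Γ : Ctx D} (hΓ : ∀ x τ, (x, τ) ∈ Γ → Ω x = τ) :
    EnvOk S Γ (denEnv S Ω θ s) := fun x τ hx t ht => by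
  rw [← hΓ x τ (mem_of_lookup hx)]
  exact Den.ok hθ ht

theorem denEnv_coh {Ω : Var → Ty D} {θ₁ θ₂ : Ty D → Expr I → Set (Tok I)} {s : Var → Expr I}
    (hθ : CohInterp S θ₁ θ₂) {Γ : Ctx D} (hΓ : ∀ x τ, (x, τ) ∈ Γ → Ω x = τ) :
    EnvCoh S Γ (denEnv S Ω θ₁ s) (denEnv S Ω θ₂ s) := fun x τ hx t ht u hu => by
  rw [← hΓ x τ (mem_of_lookup hx)]
  exact Den.coh hθ ht hu

/-! ### Terms and patterns -/

/-- This refutes the earlier patterns in a guard. It is indifferent to what `s` has for their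
variables, which may be anything. -/
theorem TMatch.of_is {s : Var → Expr I} (p : Pat I) :
    ∀ {θ : Ty D → Expr I → Set (Tok I)} {v : Expr I} {τ : Ty D} {u : Tok I},
      p.toTerm.Is s v → Den S θ v τ u → TMatch u p := by
  induction p with
  | wild => intro θ v τ u _ _; exact .wild u
  | var x => intro θ v τ u _ _; exact .var u x
  | record l p ih =>
    rintro θ v τ u ⟨w, rfl, hw⟩ hd
    cases hd with | record _ _ τs t hd => exact .record l t p fun i => ih i (hw i) (hd i)
  | asP x p ih => rintro θ v τ u ⟨-, hw⟩ hd; exact .asP u x p (ih hw hd)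
  | const c => rintro θ v τ u hv hd; cases hv; cases hd; exact .const c
  | inj i p ih =>
    rintro θ v τ u ⟨w, rfl, hw⟩ hd
    cases hd with | inj _ _ τ' t _ hd => exact .inj i t p (ih hw hd)
  | inj₀ i => rintro θ v τ u hv hd; cases hv; cases hd; exact .inj₀ i

theorem Val.of_base_int {v : Expr I} (hv : Val v) (ht : HasType S [] v (.base .int)) :
    ∃ a : ℤ, v = .const (.int a) := by
  cases hv with
  | const c =>
    cases c with
    | int z => exact ⟨z, rfl⟩
    | bool b => generalize hτ : Ty.base BaseTy.int = τ at ht; cases ht; cases hτ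
  | prim o => have := ht.prim_inv; simp [PrimOp.ty] at this
  | _ => cases ht

/-- A term has a value under every substitution of values, the only one that it is equivalent
to. -/
theorem IsTerm.exists_value {Ω : Var → Ty D} {s : Var → Expr I} (hs : Typed S Ω s) {e : Expr I}
    {t : Term I} (h : IsTerm e t) :
    ∀ {Γ : Ctx D} {τ : Ty D}, HasType S Γ e τ → (∀ x τ, (x, τ) ∈ Γ → Ω x = τ) →
      ∃ v, Val v ∧ HasType S [] v τ ∧
        -- The formula is evaluated at substitutions that change `s` at fresh variables.
        (∀ s', (∀ x ∈ e.fv, s' x = s x) → ∀ w, t.Is s' w ↔ w = v) ∧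
        ∀ θ, Sem e (denEnv S Ω θ s) ⊆ {u | Den S θ v τ u} := by
  induction h with
  | const c =>
    intro Γ τ ht _
    cases ht
    refine ⟨_, .const c, .const _ c, fun s' _ w => Iff.rfl, ?_⟩
    rintro θ u rfl
    exact .const c
  | var x =>
    intro Γ τ ht hΓ
    cases ht with
    | var _ _ _ hx =>
      have := hΓ x τ (mem_of_lookup hx)
      subst this
      refine ⟨s x, (hs x).1, (hs x).2, fun s' hs' w => ?_, fun θ => subset_rfl⟩
      rw [Term.Is, hs' x (by simp [Expr.fv])]
  | record l e t _ ih =>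
    intro Γ τ ht hΓ
    cases ht with
    | record _ _ _ τs ht =>
      choose v hv hvt hi hd using fun i => ih i (ht i) hΓ
      refine ⟨.record l v, .record l v hv, .record _ l v τs hvt, fun s' hs' w => ?_, ?_⟩
      · have hi' := fun i => hi i s' fun x hx => hs' x (by
          simp only [Expr.fv, Finset.mem_biUnion, Finset.mem_univ, true_and]; exact ⟨i, hx⟩)
        simp only [Term.Is, hi']
        constructor
        · rintro ⟨w, rfl, hw⟩; rw [funext hw]
        · rintro rfl; exact ⟨v, rfl, fun _ => rfl⟩
      · rintro θ _ ⟨u, rfl, hu⟩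
        exact .record l v τs u fun i => hd i θ (hu i)
  | proj e t k _ ih =>
    intro Γ τ ht hΓ
    cases ht with
    | proj _ _ l τs i ht =>
      obtain ⟨v, hv, hvt, hi, hd⟩ := ih ht hΓ
      have hval : ∃ w : _ → Expr I, v = .record l w := by
        cases hv with
        | record l' w h => cases hvt; exact ⟨w, rfl⟩
        | prim o => have := hvt.prim_inv; simp [PrimOp.ty] at this
        | const c => generalize hτ : Ty.record l τs = τ at hvt; cases hvt; cases hτ
        | _ => cases hvt
      obtain ⟨w, rfl⟩ := hval
      cases hv with
      | record _ _ hv =>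
      cases hvt with
      | record _ _ _ _ hvt =>
        refine ⟨w i, hv i, hvt i, fun s' hs' v => ?_, ?_⟩
        · simp only [Term.Is, hi s' hs']
          constructor
          · rintro ⟨n, l', w', j, h, hj, rfl⟩
            cases h
            rw [l.injective hj]
          · rintro rfl; exact ⟨_, l, w, i, rfl, rfl, rfl⟩
        · rintro θ _ ⟨n, l', u, j, hu, hj, rfl⟩
          have := hd θ hu
          simp only [Set.mem_ofPred_eq] at this
          cases this with
          | record _ _ _ _ h =>
            obtain rfl := l.injective hj
            exact h _
  | inj i e t _ ih =>
    intro Γ τ ht hΓ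
    cases ht with
    | inj _ _ _ τ' hi' ht =>
      obtain ⟨v, hv, hvt, hi, hd⟩ := ih ht hΓ
      refine ⟨.inj i v, .inj i v hv, .inj _ i v τ' hi' hvt, fun s' hs' w => ?_, ?_⟩
      · simp only [Term.Is, hi s' hs']
        constructor
        · rintro ⟨w, rfl, rfl⟩; rfl
        · rintro rfl; exact ⟨v, rfl, rfl⟩
      · rintro θ _ ⟨u, rfl, hu⟩
        exact .inj i v τ' u hi' (hd θ hu)
  | inj₀ i =>
    intro Γ τ ht _
    cases ht with
    | inj₀ _ _ hi =>
      refine ⟨_, .inj₀ i, .inj₀ _ i hi, fun s' _ w => Iff.rfl, ?_⟩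
      rintro θ u rfl
      exact .inj₀ i hi
  | prim o =>
    intro Γ τ ht _
    cases ht
    exact ⟨_, .prim o, .prim _ o, fun s' _ w => Iff.rfl, fun θ u hu => .prim o u hu⟩
  | primApp o e t _ ih =>
    intro Γ τ ht hΓ
    cases ht with
    | app _ _ _ τ₁ _ h₁ h₂ =>
      have hτ := h₁.prim_inv
      simp only [PrimOp.ty, Ty.arrow.injEq] at hτ
      obtain ⟨rfl, rfl⟩ := hτ
      obtain ⟨v, hv, hvt, hi, hd⟩ := ih h₂ hΓ
      have hval : ∃ a b : ℤ, v = intPair a b := by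
        cases hv with
        | record l' w h =>
          generalize hτs : (fun _ => Ty.base BaseTy.int : Fin 2 → Ty D) = τs at hvt
          cases hvt with
          | record _ _ _ _ hw =>
            subst hτs
            obtain ⟨a, ha⟩ := Val.of_base_int (h 0) (hw 0)
            obtain ⟨b, hb⟩ := Val.of_base_int (h 1) (hw 1)
            refine ⟨a, b, congrArg (Expr.record pairLabels) ?_⟩
            funext i
            fin_cases i
            · exact ha
            · exact hb
        | prim o => have := hvt.prim_inv; simp [PrimOp.ty] at this
        | const c =>
          generalize hτ : Ty.record pairLabels (fun _ => Ty.base BaseTy.int) = τ at hvt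
          cases hvt
          cases hτ
        | _ => cases hvt
      obtain ⟨a, b, rfl⟩ := hval
      have hinj : ∀ {a b a' b' : ℤ}, (intPair a b : Expr I) = intPair a' b' → a = a' ∧ b = b' := by
        intro a b a' b' h
        simp only [intPair, Expr.record.injEq, heq_eq_eq, true_and] at h
        have h0 := congrFun h 0
        have h1 := congrFun h 1
        simp only [Matrix.cons_val_zero, Matrix.cons_val_one, Expr.const.injEq,
          Const.int.injEq] at h0 h1
        exact ⟨h0, h1⟩
      refine ⟨.const (o.eval a b), .const _, ?_, fun s' hs' w => ?_, ?_⟩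
      · rw [← o.eval_ty a b]; exact .const _ _
      · have := hi s' fun x hx => hs' x (by simp [Expr.fv, hx])
        simp only [Term.Is, this]
        constructor
        · rintro ⟨a', b', h, rfl⟩
          obtain ⟨rfl, rfl⟩ := hinj h
          rfl
        · rintro rfl; exact ⟨a, b, rfl, rfl⟩
      · rintro θ u ⟨n, A, hA | ⟨n', A', a', b', ⟨i, hi'⟩, hA⟩, hmem⟩
        · cases hA
        · cases hA
          have := hd θ (hmem i)
          rw [hi'] at this
          simp only [Set.mem_ofPred_eq, intPair, pairTok] at this
          cases this with
          | record _ _ _ _ h =>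
            have h0 := h 0
            have h1 := h 1
            simp only [Matrix.cons_val_zero, Matrix.cons_val_one] at h0 h1
            cases h0
            cases h1
            rw [Set.mem_ofPred_eq, ← o.eval_ty a b]
            exact .const _

/-- If a value matches a pattern, its variables can be bound. -/
theorem PatTy.exists_bindings {p : Pat I} {τ : Ty D} {Δ : Ctx D} (hp : PatTy S p τ Δ) :
    ∀ {v : Expr I} {θ : Ty D → Expr I → Set (Tok I)} {u : Tok I}, Val v → HasType S [] v τ →
      p.Linear → Den S θ v τ u → TMatch u p →
      ∃ B : Var → Expr I, (∀ x τ', (x, τ') ∈ Δ → Val (B x) ∧ HasType S [] (B x) τ') ∧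
        (∀ s, (∀ x ∈ p.vars, s x = B x) → p.toTerm.Is s v) ∧
        ∀ θ u x w τ', Den S θ v τ u → TBind u p x w → (x, τ') ∈ Δ → Den S θ (B x) τ' w := by
  induction hp with
  | wild τ =>
    intro v θ u _ _ _ _ _
    exact ⟨fun _ => v, by simp, fun s _ => trivial, fun θ u x w τ' _ hb => by cases hb⟩
  | var y τ =>
    intro v θ u hv ht _ _ _
    refine ⟨fun _ => v, ?_, fun s hs => (hs y (by simp [Pat.vars])).symm, ?_⟩
    · intro x τ' hx
      simp only [List.mem_singleton, Prod.mk.injEq] at hx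
      rw [hx.2]
      exact ⟨hv, ht⟩
    · intro θ u x w τ' hd hb hx
      cases hb
      simp only [List.mem_singleton, Prod.mk.injEq] at hx
      rw [hx.2]
      exact hd
  | record l p τ Δ hp ih =>
    intro v θ u hv ht hl hd hm
    cases hm with
    | record _ u _ hm =>
    cases hd with
    | record _ w _ _ hd =>
    cases hv with
    | record _ _ hv =>
    cases ht with
    | record _ _ _ _ ht =>
      choose B hB hB' hB'' using fun i => ih i (hv i) (ht i) (hl.of_record i) (hd i) (hm i)
      -- By linearity a variable belongs to at most one component, so the bindings of the components
      -- can be glued; elsewhere the value is arbitrary.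
      have hex : ∀ x, ∃ b : Expr I, ∀ i, x ∈ (p i).vars → b = B i x := by
        intro x
        by_cases hx : ∃ i, x ∈ (p i).vars
        · obtain ⟨i, hi⟩ := hx
          exact ⟨B i x, fun j hj => by rw [hl.eq_of_mem hi hj]⟩
        · exact ⟨.record l w, fun i hi => absurd ⟨i, hi⟩ hx⟩
      choose C hC using hex
      refine ⟨C, ?_, ?_, ?_⟩
      · intro x τ' hx
        obtain ⟨_, h, hx⟩ := List.mem_flatten.1 hx
        obtain ⟨i, rfl⟩ := List.mem_ofFn.1 h
        rw [hC x i ((hp i).mem_vars hx)]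
        exact hB i x τ' hx
      · intro s hs
        refine ⟨w, rfl, fun i => hB' i s fun x hx => ?_⟩
        rw [hs x (Pat.mem_vars_record.2 ⟨i, hx⟩), hC x i hx]
      · intro θ u x w τ' hd hb hx
        cases hb with
        | record _ t _ i _ _ hb =>
        cases hd with
        | record _ _ _ _ hd =>
          obtain ⟨_, h, hx⟩ := List.mem_flatten.1 hx
          obtain ⟨j, rfl⟩ := List.mem_ofFn.1 h
          obtain rfl : i = j := hl.eq_of_mem hb.mem_vars ((hp j).mem_vars hx)
          rw [hC x i hb.mem_vars]
          exact hB'' i θ _ x w τ' (hd i) hb hx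
  | asP y p τ Δ hp ih =>
    intro v θ u hv ht hl hd hm
    have hl' : y ∉ p.vars ∧ p.vars.Nodup := by simpa [Pat.Linear, Pat.vars] using hl
    cases hm with
    | asP _ _ _ hm =>
      obtain ⟨B, hB, hB', hB''⟩ := ih hv ht hl'.2 hd hm
      have hne : ∀ x ∈ p.vars, x ≠ y := by rintro x hx rfl; exact hl'.1 hx
      refine ⟨Function.update B y v, ?_, ?_, ?_⟩
      · intro x τ' hx
        rcases List.mem_cons.1 hx with hx | hx
        · cases hx; simpa using ⟨hv, ht⟩
        · rw [Function.update_of_ne (hne x (hp.mem_vars hx))]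
          exact hB x τ' hx
      · intro s hs
        have hy : s y = v := by simpa using hs y (by simp [Pat.vars])
        have := hB' s fun x hx => by
          rw [hs x (by simp [Pat.vars, hx]), Function.update_of_ne (hne x hx)]
        exact ⟨hy ▸ this, this⟩
      · intro θ u x w τ' hd hb hx
        cases hb with
        | as_self =>
          rcases List.mem_cons.1 hx with hx | hx
          · cases hx; simpa using hd
          · exact absurd (hp.mem_vars hx) hl'.1
        | asP _ _ _ _ _ hb =>
          rw [Function.update_of_ne (hne x hb.mem_vars)]
          rcases List.mem_cons.1 hx with hx | hx
          · cases hx; exact absurd hb.mem_vars hl'.1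
          · exact hB'' θ u x w τ' hd hb hx
  | const c =>
    intro v θ u hv _ _ hd hm
    cases hm
    refine ⟨fun _ => v, by simp, fun s _ => ?_, fun θ u x w τ' _ hb => by cases hb⟩
    generalize hτ : Ty.base c.ty = τ at hd
    cases hd with
    | const => rfl
    | lam => cases hτ
    | prim _ _ h => rcases h with h | ⟨_, _, _, _, _, h⟩ <;> cases h
  | inj₀ i hi =>
    intro v θ u hv _ _ hd hm
    cases hm
    refine ⟨fun _ => v, by simp, fun s _ => ?_, fun θ u x w τ' _ hb => by cases hb⟩
    generalize hτ : Ty.data (S.res i) = τ at hd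
    cases hd with
    | inj₀ => rfl
    | lam => cases hτ
    | prim _ _ h => rcases h with h | ⟨_, _, _, _, _, h⟩ <;> cases h
  | inj i p τ Δ hi hp ih =>
    intro v θ u hv ht hl hd hm
    cases hm with
    | inj _ t _ hm =>
      have hw : ∃ w, v = .inj i w ∧ Den S θ w τ t := by
        generalize hτ : Ty.data (S.res i) = τ₀ at hd
        cases hd with
        | inj _ w τ' _ hi' hd => cases hi.symm.trans hi'; exact ⟨w, rfl, hd⟩
        | lam => cases hτ
        | prim _ _ h => rcases h with h | ⟨_, _, _, _, _, h⟩ <;> cases h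
      obtain ⟨w, rfl, hdw⟩ := hw
      cases hv with
      | inj _ _ hv =>
      have ht' : HasType S [] w τ := by
        generalize hτ : Ty.data (S.res i) = τ₀ at ht
        cases ht with | inj _ _ _ τ' hi' ht => cases hi.symm.trans hi'; exact ht
      obtain ⟨B, hB, hB', hB''⟩ := ih hv ht' hl hdw hm
      refine ⟨B, hB, fun s hs => ⟨w, rfl, hB' s hs⟩, ?_⟩
      intro θ u x w' τ' hd hb hx
      cases hb with
      | inj _ t _ _ _ hb =>
        refine hB'' θ t x w' τ' ?_ hb hx
        generalize hτ : Ty.data (S.res i) = τ₀ at hd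
        cases hd with | inj _ _ _ _ hi' hd => cases hi.symm.trans hi'; exact hd

/-! ### Realizing coherent sets of tokens -/

/-- A function value whose only purpose is to be told apart from others by its variable. -/
def atom (k : Var) : Expr I := .lam k (.fix 0 (.var 0))

/-- A value that looks like the token, with the atom `c π` for the function at the position `π`. -/
def Tok.template (c : List ℕ → ℕ) : Tok I → List ℕ → Expr I
  | .const a, _ => .const a
  | .record l t, π => .record l fun i => (t i).template c (i.val :: π)
  | .inj i t, π => .inj i (t.template c (0 :: π))
  | .inj₀ i, _ => .inj₀ i
  | .fn, π => atom (c π)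
  | .arr _ _, π => atom (c π)

theorem Tok.template_val (c : List ℕ → ℕ) (t : Tok I) : ∀ π, Val (t.template c π) := by
  induction t with
  | const a => intro π; exact .const a
  | record l t ih => intro π; exact .record l _ fun i => ih i _
  | inj i t ih => intro π; exact .inj i _ (ih _)
  | inj₀ i => intro π; exact .inj₀ i
  | fn => intro π; exact .lam _ _
  | arr => intro π; exact .lam _ _

theorem atom_hasType (k : Var) (τ₁ τ₂ : Ty D) : HasType S [] (atom k) (.arrow τ₁ τ₂) :=
  .lam _ _ _ _ _ (.fix _ _ _ _ (.var _ _ _ (by simp)))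

theorem Tok.template_hasType (c : List ℕ → ℕ) (t : Tok I) :
    ∀ {τ : Ty D} π, t.Ok S τ → HasType S [] (t.template c π) τ := by
  induction t with
  | const a => rintro τ π rfl; exact .const _ a
  | record l t ih => rintro τ π ⟨τs, rfl, h⟩; exact .record _ l _ τs fun i => ih i _ (h i)
  | inj i t ih => rintro τ π ⟨τ', hi, rfl, h⟩; exact .inj _ i _ τ' hi (ih _ h)
  | inj₀ i => rintro τ π ⟨hi, rfl⟩; exact .inj₀ _ i hi
  | fn => rintro τ π ⟨τ₁, τ₂, rfl⟩; exact atom_hasType _ _ _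
  | arr A b => rintro τ π ⟨τ₁, τ₂, rfl, -⟩; exact atom_hasType _ _ _

/-- Coherent tokens agree outside functions, and each function is represented by the atom of its
position alone. -/
theorem Tok.Coh.template_eq (c : List ℕ → ℕ) {t : Tok I} :
    ∀ {τ : Ty D} {u : Tok I} π, t.Coh S τ u → t.template c π = u.template c π := by
  induction t with
  | const a => rintro τ u π ⟨-, rfl⟩; rfl
  | record l t ih =>
    rintro τ u π ⟨τs, us, rfl, rfl, h⟩
    simp only [Tok.template]
    congr 1
    funext i
    exact ih i _ (h i)
  | inj i t ih =>
    rintro τ u π ⟨τ', u', -, -, rfl, h⟩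
    simp only [Tok.template, ih _ h]
  | inj₀ i => rintro τ u π ⟨-, -, rfl⟩; rfl
  | fn => rintro τ u π ⟨-, rfl | ⟨m, A', b', rfl⟩⟩ <;> rfl
  | arr A b => rintro τ u π ⟨τ₁, τ₂, -, rfl | ⟨m, A', b', rfl, -⟩⟩ <;> rfl

/-- `At S τ₀ t₀ π τ t`: at the position `π` of the token `t₀` of type `τ₀` is `t` of type `τ`. -/
inductive At (S : Signature D I) (τ₀ : Ty D) (t₀ : Tok I) : List ℕ → Ty D → Tok I → Prop
  | here : At S τ₀ t₀ [] τ₀ t₀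
  | record {n : ℕ} (l : Fin n ↪ Label) (π : List ℕ) (τ : Fin n → Ty D) (t : Fin n → Tok I)
      (i : Fin n) (h : At S τ₀ t₀ π (.record l τ) (.record l t)) :
      At S τ₀ t₀ (i.val :: π) (τ i) (t i)
  | inj (i : I) (π : List ℕ) (τ : Ty D) (t : Tok I) (hi : S.arg i = some τ)
      (h : At S τ₀ t₀ π (.data (S.res i)) (.inj i t)) : At S τ₀ t₀ (0 :: π) τ t

theorem At.ok {τ₀ τ : Ty D} {t₀ t : Tok I} {π : List ℕ} (h : At S τ₀ t₀ π τ t)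
    (h₀ : t₀.Ok S τ₀) : t.Ok S τ := by
  induction h with
  | here => exact h₀
  | record l π τ t i _ ih => obtain ⟨τs, hτ, h⟩ := ih; cases hτ; exact h i
  | inj i π τ t hi _ ih => obtain ⟨τ', hi', -, h⟩ := ih; cases hi.symm.trans hi'; exact h

/-- Since the shapes agree, the same path can be followed in both tokens and leads to the same type.
-/
theorem At.coh {τ₀ τ : Ty D} {t₀ u₀ t : Tok I} {π : List ℕ} (h : At S τ₀ t₀ π τ t)
    (h₀ : t₀.Coh S τ₀ u₀) :
    ∀ {τ' : Ty D} {u : Tok I}, At S τ₀ u₀ π τ' u → τ = τ' ∧ t.Coh S τ u := by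
  induction h with
  | here => intro τ' u hu; cases hu; exact ⟨rfl, h₀⟩
  | record l π τ t i _ ih =>
    intro τ' u hu
    generalize hπ : i.val :: π = π' at hu
    cases hu with
    | here => cases hπ
    | record l' π' τs us j hu =>
      obtain ⟨hij, rfl⟩ := List.cons.inj hπ
      obtain ⟨hτ, hc⟩ := ih hu
      cases hτ
      obtain rfl : i = j := Fin.ext hij
      obtain ⟨τs, us, hτ, hu, hc⟩ := hc
      cases hτ
      cases hu
      exact ⟨rfl, hc i⟩
    | inj j π' τ₁ u hj hu =>
      obtain ⟨-, rfl⟩ := List.cons.inj hπ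
      cases (ih hu).1
  | inj i π τ t hi _ ih =>
    intro τ' u hu
    generalize hπ : 0 :: π = π' at hu
    cases hu with
    | here => cases hπ
    | record l' π' τs us j hu =>
      obtain ⟨-, rfl⟩ := List.cons.inj hπ
      cases (ih hu).1
    | inj j π' τ₁ u hj hu =>
      obtain ⟨-, rfl⟩ := List.cons.inj hπ
      obtain ⟨-, τ₂, u', hi', -, hu', hc⟩ := ih hu
      cases hu'
      cases hi.symm.trans hi'
      cases hi.symm.trans hj
      exact ⟨rfl, hc⟩

/-- The interpretation `θ`, changed at the atoms `c π` to what the tokens in `P` have at `π`. -/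
def realize (S : Signature D I) (c : List ℕ → ℕ) (τ₀ : Ty D) (P : Set (Tok I))
    (θ : Ty D → Expr I → Set (Tok I)) : Ty D → Expr I → Set (Tok I) :=
  fun τ f => {t | (∃ π, f = atom (c π) ∧ ∃ t₀ ∈ P, At S τ₀ t₀ π τ t) ∨
    ((∀ π, f ≠ atom (c π)) ∧ t ∈ θ τ f)}

theorem OkSet.realize {c : List ℕ → ℕ} {τ₀ : Ty D} {P : Set (Tok I)} (hP : OkSet S P τ₀)
    {θ : Ty D → Expr I → Set (Tok I)} (hθ : ∀ τ f, OkSet S (θ τ f) τ) (τ : Ty D) (f : Expr I) :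
    OkSet S (realize S c τ₀ P θ τ f) τ := by
  rintro t (⟨π, rfl, t₀, ht₀, h⟩ | ⟨-, h⟩)
  · exact h.ok (hP t₀ ht₀)
  · exact hθ τ f t h

/-- As `c` is injective, an atom determines its position, and there `At.coh` applies. All other
functions keep their old interpretation. -/
theorem CohInterp.realize {c : List ℕ → ℕ} (hc : Function.Injective c) {τ₀ : Ty D}
    {P₁ P₂ : Set (Tok I)} (h₁ : OkSet S P₁ τ₀) (h₂ : OkSet S P₂ τ₀) (h : CohSet S P₁ τ₀ P₂)
    {θ₁ θ₂ : Ty D → Expr I → Set (Tok I)} (hθ : CohInterp S θ₁ θ₂) :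
    CohInterp S (LambdaPix.realize S c τ₀ P₁ θ₁) (LambdaPix.realize S c τ₀ P₂ θ₂) := by
  refine ⟨h₁.realize hθ.ok_left, h₂.realize hθ.ok_right, ?_⟩
  rintro τ f t (⟨π, rfl, t₀, ht₀, ht⟩ | ⟨hf, ht⟩) u (⟨π', hπ, u₀, hu₀, hu⟩ | ⟨hf', hu⟩)
  · have : c π = c π' := by simpa [atom] using hπ
    obtain rfl := hc this
    exact (ht.coh (h t₀ ht₀ u₀ hu₀) hu).2
  · exact absurd rfl (hf' π)
  · exact absurd hπ (hf π')
  · exact hθ.coh τ f t ht u hu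

theorem At.den {c : List ℕ → ℕ} {τ₀ : Ty D} {P : Set (Tok I)} {θ : Ty D → Expr I → Set (Tok I)}
    {t₀ : Tok I} (ht₀ : t₀ ∈ P) (t : Tok I) : ∀ {π : List ℕ} {τ : Ty D}, At S τ₀ t₀ π τ t →
      t.Ok S τ → Den S (realize S c τ₀ P θ) (t.template c π) τ t := by
  induction t with
  | const a => rintro π τ _ rfl; exact .const a
  | record l t ih =>
    rintro π τ h ⟨τs, rfl, hok⟩
    exact .record l _ τs t fun i => ih i (h.record l π τs t i) (hok i)
  | inj i t ih =>
    rintro π τ h ⟨τ', hi, rfl, hok⟩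
    exact .inj i _ τ' t hi (ih (h.inj i π τ' t hi) hok)
  | inj₀ i => rintro π τ _ ⟨hi, rfl⟩; exact .inj₀ i hi
  | fn => rintro π τ h ⟨τ₁, τ₂, rfl⟩; exact .lam _ _ _ _ _ (Or.inl ⟨π, rfl, t₀, ht₀, h⟩)
  | arr A b =>
    rintro π τ h ⟨τ₁, τ₂, rfl, -⟩; exact .lam _ _ _ _ _ (Or.inl ⟨π, rfl, t₀, ht₀, h⟩)

/-- An atom contains its own number as a variable, so a value without these numbers contains no
reinterpreted function and keeps its tokens. -/
theorem Den.realize {c : List ℕ → ℕ} {τ₀ : Ty D} {P : Set (Tok I)}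
    {θ : Ty D → Expr I → Set (Tok I)} {v : Expr I} {τ : Ty D} {t : Tok I} (h : Den S θ v τ t) :
    (∀ π, c π ∉ v.vars) → Den S (LambdaPix.realize S c τ₀ P θ) v τ t := by
  induction h with
  | const a => intro _; exact .const a
  | record l w τ t _ ih =>
    intro hv
    refine .record l w τ t fun i => ih i fun π hπ => hv π ?_
    simp only [Expr.vars, Finset.mem_biUnion, Finset.mem_univ, true_and]
    exact ⟨i, hπ⟩
  | inj i w τ t hi _ ih => intro hv; exact .inj i w τ t hi (ih hv)
  | inj₀ i hi => intro _; exact .inj₀ i hi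
  | lam x e τ₁ τ₂ t h =>
    intro hv
    refine .lam x e τ₁ τ₂ t (Or.inr ⟨fun π hπ => hv π ?_, h⟩)
    rw [hπ]
    simp [atom, Expr.vars]
  | prim o t h => intro _; exact .prim o t h

/-- A variable can be given a value with two coherent sets of tokens, without a loss for the
variables in `F`. -/
theorem exists_extension {Ω : Var → Ty D} {s : Var → Expr I}
    {θ₁ θ₂ : Ty D → Expr I → Set (Tok I)} (hs : Typed S Ω s) (hθ : CohInterp S θ₁ θ₂)
    (F : Finset Var) {y : Var} (hy : y ∉ F) {P₁ P₂ : Set (Tok I)} (h₁ : OkSet S P₁ (Ω y))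
    (h₂ : OkSet S P₂ (Ω y)) (h : CohSet S P₁ (Ω y) P₂) (hne : P₁.Nonempty)
    (hsub : P₂.Nonempty ∨ P₁.Subsingleton) :
    ∃ (s' : Var → Expr I) (θ₁' θ₂' : Ty D → Expr I → Set (Tok I)), Typed S Ω s' ∧
      CohInterp S θ₁' θ₂' ∧ (∀ z, z ≠ y → s' z = s z) ∧
      (∀ z ∈ F, denEnv S Ω θ₁ s z ⊆ denEnv S Ω θ₁' s' z) ∧
      (∀ z ∈ F, denEnv S Ω θ₂ s z ⊆ denEnv S Ω θ₂' s' z) ∧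
      P₁ ⊆ denEnv S Ω θ₁' s' y ∧ P₂ ⊆ denEnv S Ω θ₂' s' y := by
  obtain ⟨t₁, ht₁⟩ := hne
  -- Every variable that occurs in a value of `F` is below `N`, so the atoms numbered from `N` on
  -- are new to these values.
  set N := (F.biUnion fun x => (s x).vars).sup id + 1 with hN
  let c : List ℕ → ℕ := fun π => N + Encodable.encode π
  have hcinj : Function.Injective c := fun π π' h =>
    Encodable.encode_injective (Nat.add_left_cancel h)
  have hcF : ∀ z ∈ F, ∀ π, c π ∉ (s z).vars := by
    intro z hz π hmem
    have : c π ≤ (F.biUnion fun x => (s x).vars).sup id :=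
      Finset.le_sup (f := id) (Finset.mem_biUnion.2 ⟨z, hz, hmem⟩)
    have h' : N ≤ c π := Nat.le_add_right _ _
    exact absurd (h'.trans this) (Nat.not_succ_le_self _)
  have hshape₂ : ∀ u ∈ P₂, u.template c [] = t₁.template c [] := fun u hu =>
    ((h t₁ ht₁ u hu).template_eq c []).symm
  -- Tokens of `P₁` are not assumed coherent with each other. They share a template through a token
  -- of `P₂` with which both are coherent; if there is none, `P₁` must have only one token.
  have hshape₁ : ∀ t ∈ P₁, t.template c [] = t₁.template c [] := by
    intro t ht
    rcases hsub with ⟨u, hu⟩ | hsub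
    · rw [(h t ht u hu).template_eq c [], hshape₂ u hu]
    · rw [hsub ht ht₁]
  have hold : ∀ z ∈ F, Function.update s y (t₁.template c []) z = s z := by
    intro z hz
    rw [Function.update_of_ne]
    rintro rfl
    exact hy hz
  refine ⟨Function.update s y (t₁.template c []), realize S c (Ω y) P₁ θ₁,
    realize S c (Ω y) P₂ θ₂, fun x => ?_, hθ.realize hcinj h₁ h₂ h, fun z hz => ?_, ?_, ?_, ?_, ?_⟩
  · by_cases hx : x = y
    · subst hx
      simp only [Function.update_self]
      exact ⟨t₁.template_val c [], t₁.template_hasType c [] (h₁ t₁ ht₁)⟩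
    · rw [Function.update_of_ne hx]; exact hs x
  · exact Function.update_of_ne hz _ _
  · intro z hz t ht
    rw [denEnv, hold z hz]
    exact Den.realize ht (hcF z hz)
  · intro z hz t ht
    rw [denEnv, hold z hz]
    exact Den.realize ht (hcF z hz)
  · intro t ht
    simp only [denEnv, Function.update_self, Set.mem_ofPred_eq]
    rw [← hshape₁ t ht]
    exact At.den ht t .here (h₁ t ht)
  · intro t ht
    simp only [denEnv, Function.update_self, Set.mem_ofPred_eq]
    rw [← hshape₂ t ht]
    exact At.den ht t .here (h₂ t ht)

end Interpretation

-- Soundness of formula generation, rule by rule.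

section Soundness

variable {D : Type u} {I : Type v} {S : Signature D I}

theorem Formula.holds_conj {n : ℕ} {f : Fin n → Formula I} {s : Var → Expr I} :
    (Formula.conj f).Holds s ↔ ∀ i, (f i).Holds s := by
  have : ∀ l : List (Formula I), (l.foldr Formula.and .tru).Holds s ↔ ∀ g ∈ l, g.Holds s := by
    intro l
    induction l with
    | nil => simp [Formula.Holds]
    | cons a l ih => simp [Formula.Holds, ih]
  rw [Formula.conj, this, List.forall_mem_ofFn_iff]

theorem Formula.holds_guard {n : ℕ} {t : Term I} {p : Fin n → Pat I} {k : Fin n}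
    {s : Var → Expr I} {v : Expr I} (ht : ∀ w, t.Is s w ↔ w = v) (hk : (p k).toTerm.Is s v)
    (hj : ∀ j, j < k → ¬ (p j).toTerm.Is s v) : (Formula.guard t p k).Holds s := by
  refine ⟨Formula.holds_conj.2 fun j => ?_, v, (ht v).2 rfl, hk⟩
  rintro ⟨w, hw, hw'⟩
  rw [ht] at hw
  subst hw
  exact hj _ (Fin.mk_lt_of_lt_val j.isLt) hw'

theorem HasType.case_linear {Γ : Ctx D} {e : Expr I} {n : ℕ} {p : Fin n → Pat I}
    {b : Fin n → Expr I} {τ : Ty D} (h : HasType S Γ (.case e p b) τ) (i : Fin n) :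
    (p i).Linear := by
  cases h with | case _ _ _ _ _ _ _ _ _ hl _ => exact hl i

theorem Iso.hasType {Γ Γ' : Ctx D} {e₁ e₂ : Expr I} {σ : Formula I} {τ : Ty D}
    (h : Iso S Γ e₁ e₂ σ τ Γ') : HasType S Γ e₁ τ ∧ HasType S Γ e₂ τ := by
  cases h with | whnf _ _ _ _ _ _ _ _ h₁ h₂ => exact ⟨h₁, h₂⟩

theorem IsoN.hasType {Γ Γ' : Ctx D} {e₁ e₂ : Expr I} {σ : Formula I} {τ : Ty D}
    (h : IsoN S Γ e₁ e₂ σ τ Γ') : HasType S Γ e₁ τ ∧ HasType S Γ e₂ τ := by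
  cases h <;> exact ⟨‹_›, ‹_›⟩

theorem inUse_left {Γ : Ctx D} {e₁ e₂ : Expr I} : e₁.vars ⊆ inUse Γ e₁ e₂ := fun x hx => by
  simp [inUse, hx]

theorem inUse_right {Γ : Ctx D} {e₁ e₂ : Expr I} : e₂.vars ⊆ inUse Γ e₁ e₂ := fun x hx => by
  simp [inUse, hx]

theorem inUse_dom {Γ : Ctx D} {e₁ e₂ : Expr I} : Γ.dom.toFinset ⊆ inUse Γ e₁ e₂ := fun x hx => by
  simp only [inUse, Finset.mem_union]
  exact Or.inl (Or.inl hx)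

theorem Ctx.mem_dom_flatten {n : ℕ} {Γ : Fin n → Ctx D} {x : Var} :
    x ∈ Ctx.dom (List.ofFn Γ).flatten ↔ ∃ i, x ∈ (Γ i).dom := by
  simp only [Ctx.dom, List.mem_map, List.mem_flatten, List.mem_ofFn]
  constructor
  · rintro ⟨a, ⟨_, ⟨i, rfl⟩, ha⟩, rfl⟩; exact ⟨i, a, ha, rfl⟩
  · rintro ⟨i, a, ha, rfl⟩; exact ⟨a, ⟨_, ⟨i, rfl⟩, ha⟩, rfl⟩

theorem Ctx.mem_flatten {n : ℕ} {Γ : Fin n → Ctx D} {a : Var × Ty D} {i : Fin n} (h : a ∈ Γ i) :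
    a ∈ (List.ofFn Γ).flatten :=
  List.mem_flatten.2 ⟨_, List.mem_ofFn.2 ⟨i, rfl⟩, h⟩

theorem Ctx.dom_append (Γ Γ' : Ctx D) : Ctx.dom (Γ ++ Γ') = Γ.dom ++ Γ'.dom :=
  List.map_append

/-- Freshening alone does not make the new variables of a pattern distinct; distinctness of the
generated context does. -/
theorem linear_of_nodup {n : ℕ} {q : Fin n → Pat I} {τ : Ty D} {Δ Γ' : Fin n → Ctx D}
    (hp : ∀ i, PatTy S (q i) τ (Δ i))
    (hd : (Ctx.dom (List.ofFn fun i => Δ i ++ Γ' i).flatten).Nodup) (i : Fin n) :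
    (q i).Linear := by
  rw [Ctx.dom, List.map_flatten, List.map_ofFn] at hd
  have := (List.nodup_flatten.1 hd).1 _ (List.mem_ofFn.2 ⟨i, rfl⟩)
  simp only [Function.comp, List.map_append] at this
  have := this.of_append_left
  rwa [(hp i).map_fst] at this

/-- The variables that formula generation introduces are new and distinct. -/
theorem Iso.fresh {Γ Γ' : Ctx D} {e₁ e₂ : Expr I} {σ : Formula I} {τ : Ty D}
    (h : Iso S Γ e₁ e₂ σ τ Γ') : Γ'.dom.Nodup ∧ ∀ x ∈ Γ'.dom, x ∉ Γ.dom := by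
  have cons : ∀ {x : Var} {τ : Ty D} {Γ Γ' : Ctx D}, x ∉ Γ.dom →
      (Γ'.dom.Nodup ∧ ∀ y ∈ Γ'.dom, y ∉ Ctx.dom ((x, τ) :: Γ)) →
      (Ctx.dom ((x, τ) :: Γ')).Nodup ∧ ∀ y ∈ Ctx.dom ((x, τ) :: Γ'), y ∉ Γ.dom := by
    rintro x τ Γ Γ' hx ⟨h₁, h₂⟩
    simp only [Ctx.dom, List.map_cons, List.mem_cons, not_or] at h₂ ⊢
    refine ⟨List.nodup_cons.2 ⟨fun h => (h₂ x h).1 rfl, h₁⟩, ?_⟩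
    rintro y (rfl | hy)
    · exact hx
    · exact (h₂ y hy).2
  have dom : ∀ {x : Var} {Γ : Ctx D} {e₁ e₂ : Expr I}, x ∉ inUse Γ e₁ e₂ → x ∉ Γ.dom :=
    fun hx h => hx (inUse_dom (List.mem_toFinset.2 h))
  have branches : ∀ {n : ℕ} {q : Fin n → Pat I} {τ : Ty D} {Γ : Ctx D} {L : Finset Var}
      {Δ Γ' : Fin n → Ctx D}, Γ.dom.toFinset ⊆ L → (∀ i, ∀ x ∈ (q i).vars, x ∉ L) →
      (∀ i, PatTy S (q i) τ (Δ i)) → (∀ i, ∀ x ∈ (Γ' i).dom, x ∉ Ctx.dom (Δ i ++ Γ)) →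
      ∀ x ∈ Ctx.dom (List.ofFn fun i => Δ i ++ Γ' i).flatten, x ∉ Γ.dom := by
    intro n q τ Γ L Δ Γ' hL hq hp h x hx hxΓ
    obtain ⟨i, hi⟩ := Ctx.mem_dom_flatten.1 hx
    rw [Ctx.dom_append, List.mem_append] at hi
    rcases hi with hi | hi
    · rw [Ctx.dom, (hp i).map_fst] at hi
      exact hq i x hi (hL (List.mem_toFinset.2 hxΓ))
    · refine h i x hi ?_
      rw [Ctx.dom_append, List.mem_append]
      exact Or.inr hxΓ
  refine Iso.rec
    (motive_1 := fun Γ _ _ _ _ Γ' _ => Γ'.dom.Nodup ∧ ∀ x ∈ Γ'.dom, x ∉ Γ.dom)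
    (motive_2 := fun Γ _ _ _ _ Γ' _ => Γ'.dom.Nodup ∧ ∀ x ∈ Γ'.dom, x ∉ Γ.dom)
    ?whnf ?atomic ?record ?proj ?inj ?lam ?fix ?app ?app_left ?app_right ?case_left ?case_right
    ?case_case ?case_shared_left ?case_shared_right h
  case whnf => intro Γ e₁ e₂ e₁' e₂' σ τ Γ' _ _ _ _ _ ih; exact ih
  case atomic => intros; simp [Ctx.dom]
  case record =>
    intro Γ n l e e' σ τ Γ' _ _ _ hd ih
    refine ⟨hd, fun x hx => ?_⟩
    obtain ⟨i, hi⟩ := Ctx.mem_dom_flatten.1 hx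
    exact (ih i).2 x hi
  case proj => intro Γ e₁ e₂ n l τ i σ Γ' _ _ _ ih; exact ih
  case inj => intro Γ i e₁ e₂ σ τ Γ' _ _ _ _ ih; exact ih
  case lam => intro Γ x x₁ x₂ e₁ e₂ σ τ τ' Γ' _ _ hx _ ih; exact cons (dom hx) ih
  case fix => intro Γ x x₁ x₂ e₁ e₂ σ τ Γ' _ _ hx _ ih; exact cons (dom hx) ih
  case app =>
    intro Γ e₁ e₁' e₂ e₂' σ σ' τ τ' Γ' Γ'' _ _ _ _ hd ih ih'
    refine ⟨hd, fun x hx => ?_⟩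
    rw [Ctx.dom_append, List.mem_append] at hx
    exact hx.elim (ih.2 x) (ih'.2 x)
  case app_left => intro Γ y f a e σ τ Γ' _ _ _ hy _ ih; exact cons (dom hy) ih
  case app_right => intro Γ y f a e σ τ Γ' _ _ _ hy _ ih; exact cons (dom hy) ih
  case case_left =>
    intro Γ e t n p p' b b' e' σ τ τ' Δ Γ' _ _ _ _ hf hp _ hd ih
    exact ⟨hd, branches inUse_dom (fun i => (hf i).refine.notMem) hp fun i => (ih i).2⟩
  case case_right =>
    intro Γ e t n p p' b b' e' σ τ τ' Δ Γ' _ _ _ _ hf hp _ hd ih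
    exact ⟨hd, branches inUse_dom (fun i => (hf i).refine.notMem) hp fun i => (ih i).2⟩
  case case_case =>
    intro Γ x e e' n m p b p' b' σ σ' τ τ' Γ' Γ'' _ _ _ hx _ hd ih ih'
    refine ⟨hd, fun y hy => ?_⟩
    rw [Ctx.dom_append, List.mem_append] at hy
    exact hy.elim (ih.2 y) ((cons (dom hx) ih').2 y)
  case case_shared_left =>
    intro Γ x n m p q b c p' q' b' c' s hs σ τ τ' Δ Γ' _ _ _ hf hp _ _ hd _ _ ih ih'
    refine ⟨hd, branches inUse_dom
      (fun i => (forall₂_branches hf.refine.1 i).notMem) hp fun i => ?_⟩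
    rcases lt_or_ge i.val s with hi | hi
    exacts [(ih i hi).2, (ih' i hi).2]
  case case_shared_right =>
    intro Γ x n m p q b c p' q' b' c' s hs σ τ τ' Δ Γ' _ _ _ hf hp _ _ hd _ _ ih ih'
    refine ⟨hd, branches inUse_dom
      (fun i => (forall₂_branches hf.refine.2.1 i).notMem) hp fun i => ?_⟩
    rcases le_or_gt s i.val with hi | hi
    exacts [(ih' i hi).2, (ih i hi).2]

/-- Two expressions are coherent under all substitutions for which the formula holds, whatever
the variables of `Γ'` stand for. Here `Ω` has the types of all variables. -/
def Sound (S : Signature D I) (Ω : Var → Ty D) (Γ : Ctx D) (e₁ e₂ : Expr I) (σ : Formula I)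
    (τ : Ty D) (Γ' : Ctx D) : Prop :=
  (∀ x τ, (x, τ) ∈ Γ → Ω x = τ) → (∀ x τ, (x, τ) ∈ Γ' → Ω x = τ) →
  ∀ (s : Var → Expr I) (θ₁ θ₂ : Ty D → Expr I → Set (Tok I)), Typed S Ω s → CohInterp S θ₁ θ₂ →
    (∀ s', Typed S Ω s' → (∀ x, x ∉ Γ'.dom → s' x = s x) → σ.Holds s') →
    CohSet S (Sem e₁ (denEnv S Ω θ₁ s)) τ (Sem e₂ (denEnv S Ω θ₂ s))

variable {Ω : Var → Ty D}

theorem Sound.symm {Γ Γ' : Ctx D} {e₁ e₂ : Expr I} {σ : Formula I} {τ : Ty D}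
    (h : Sound S Ω Γ e₁ e₂ σ τ Γ') : Sound S Ω Γ e₂ e₁ σ τ Γ' :=
  fun hΓ hΓ' s θ₁ θ₂ hs hθ H => (h hΓ hΓ' s θ₂ θ₁ hs hθ.symm H).symm

/-- Each term is equivalent to one value only, so the formula identifies the two values, and a
single value has coherent tokens under coherent interpretations. -/
theorem Sound.atomic {Γ : Ctx D} {e₁ e₂ : Expr I} {t₁ t₂ : Term I} {τ : Ty D}
    (ht₁ : HasType S Γ e₁ τ) (ht₂ : HasType S Γ e₂ τ) (h₁ : IsTerm e₁ t₁) (h₂ : IsTerm e₂ t₂) :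
    Sound S Ω Γ e₁ e₂ (.equiv t₁ t₂) τ [] := by
  intro hΓ _ s θ₁ θ₂ hs hθ H
  obtain ⟨v₁, -, -, hi₁, hd₁⟩ := h₁.exists_value hs ht₁ hΓ
  obtain ⟨v₂, -, -, hi₂, hd₂⟩ := h₂.exists_value hs ht₂ hΓ
  obtain ⟨w, hw₁, hw₂⟩ := H s hs fun _ _ => rfl
  rw [hi₁ s fun _ _ => rfl] at hw₁
  rw [hi₂ s fun _ _ => rfl] at hw₂
  subst hw₁
  subst hw₂
  exact fun t ht u hu => Den.coh hθ (hd₁ θ₁ ht) (hd₂ θ₂ hu)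

/-- Once a value has been chosen for the generated variable `y`, the formula remains true for all
values of the variables generated in the premise. -/
theorem holds_of_dom_subset {Γ Γ' : Ctx D} {σ : Formula I} {s s' : Var → Expr I} {y : Var}
    (H : ∀ s', Typed S Ω s' → (∀ x, x ∉ Γ'.dom → s' x = s x) → σ.Holds s')
    (hs : ∀ z, z ≠ y → s' z = s z) (hy : y ∈ Γ'.dom) (hsub : ∀ x ∈ Γ.dom, x ∈ Γ'.dom) :
    ∀ s'', Typed S Ω s'' → (∀ x, x ∉ Γ.dom → s'' x = s' x) → σ.Holds s'' := by
  intro s'' ht h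
  refine H s'' ht fun x hx => ?_
  rw [h x fun hx' => hx (hsub x hx'), hs x]
  rintro rfl
  exact hx hy

theorem forall_mem_cons {Γ : Ctx D} {x : Var} {τ : Ty D} (h : ∀ x τ, (x, τ) ∈ Γ → Ω x = τ)
    (hx : Ω x = τ) : ∀ y τ', (y, τ') ∈ (x, τ) :: Γ → Ω y = τ' := by
  intro y τ' hy
  rcases List.mem_cons.1 hy with hy | hy
  · cases hy; exact hx
  · exact h y τ' hy

theorem sem_update_subset_subst₁ {e : Expr I} {ρ ρ' : Env I} {x y : Var} {X : Set (Tok I)}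
    (hX : X ⊆ ρ' y) (h : ∀ z ∈ e.fv, z ≠ x → ρ z ⊆ ρ' z) :
    Sem e (Function.update ρ x X) ⊆ Sem (e.subst₁ x (.var y)) ρ' := by
  rw [Sem_subst₁]
  refine Sem_mono e fun z hz => ?_
  by_cases hzx : z = x
  · subst hzx; simpa [Sem] using hX
  · rw [Function.update_of_ne hzx, Function.update_of_ne hzx]
    exact h z hz hzx

/-- What the rules for functions and fixed points say about the bodies. -/
theorem Sound.body {Γ Γ' : Ctx D} {x x₁ x₂ : Var} {e₁ e₂ : Expr I} {σ : Formula I} {τ τ' : Ty D}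
    (ih : Sound S Ω ((x, τ) :: Γ) (e₁.subst₁ x₁ (.var x)) (e₂.subst₁ x₂ (.var x)) σ τ' Γ')
    (hx : x ∉ Γ.dom) (he₁ : ∀ z ∈ e₁.fv, z ≠ x₁ → z ∈ Γ.dom)
    (he₂ : ∀ z ∈ e₂.fv, z ≠ x₂ → z ∈ Γ.dom) (hΓ : ∀ x τ, (x, τ) ∈ Γ → Ω x = τ)
    (hΓ' : ∀ y τ', (y, τ') ∈ (x, τ) :: Γ' → Ω y = τ')
    {s : Var → Expr I} {θ₁ θ₂ : Ty D → Expr I → Set (Tok I)} (hs : Typed S Ω s)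
    (hθ : CohInterp S θ₁ θ₂)
    (H : ∀ s', Typed S Ω s' → (∀ y, y ∉ Ctx.dom ((x, τ) :: Γ') → s' y = s y) → σ.Holds s')
    {X₁ X₂ : Set (Tok I)} (h₁ : OkSet S X₁ τ) (h₂ : OkSet S X₂ τ) (h : CohSet S X₁ τ X₂)
    -- If just one set were empty, the tokens of the other need not have a common shape, and no
    -- value would realize them.
    (hne : X₁.Nonempty ∧ X₂.Nonempty ∨ X₁ = ∅ ∧ X₂ = ∅) :
    CohSet S (Sem e₁ (Function.update (denEnv S Ω θ₁ s) x₁ X₁)) τ'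
      (Sem e₂ (Function.update (denEnv S Ω θ₂ s) x₂ X₂)) := by
  have hΩ : Ω x = τ := hΓ' x τ (by simp)
  have hΓx := forall_mem_cons hΓ hΩ
  have hΓ'' : ∀ y τ', (y, τ') ∈ Γ' → Ω y = τ' := fun y τ' hy => hΓ' y τ' (by simp [hy])
  have hsub : ∀ y ∈ Γ'.dom, y ∈ Ctx.dom ((x, τ) :: Γ') := fun y hy => List.mem_cons_of_mem _ hy
  rcases hne with ⟨hne₁, hne₂⟩ | ⟨rfl, rfl⟩
  · subst hΩ
    obtain ⟨s', θ₁', θ₂', hs', hθ', hsz, hF₁, hF₂, hP₁, hP₂⟩ :=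
      exists_extension hs hθ Γ.dom.toFinset (y := x) (by simpa using hx) h₁ h₂ h hne₁ (Or.inl hne₂)
    refine (ih hΓx hΓ'' s' θ₁' θ₂' hs' hθ'
      (holds_of_dom_subset H hsz (by simp [Ctx.dom]) hsub)).mono ?_ ?_
    · exact sem_update_subset_subst₁ hP₁ fun z hz hzx =>
        hF₁ z (List.mem_toFinset.2 (he₁ z hz hzx))
    · exact sem_update_subset_subst₁ hP₂ fun z hz hzx =>
        hF₂ z (List.mem_toFinset.2 (he₂ z hz hzx))
  -- Nothing has to be realized: whatever value `s` has at `x`, its tokens include the empty set.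
  · refine (ih hΓx hΓ'' s θ₁ θ₂ hs hθ
      (holds_of_dom_subset H (fun _ _ => rfl) (y := x) (by simp [Ctx.dom]) hsub)).mono ?_ ?_
    · exact sem_update_subset_subst₁ (Set.empty_subset _) fun _ _ _ => subset_rfl
    · exact sem_update_subset_subst₁ (Set.empty_subset _) fun _ _ _ => subset_rfl

theorem Sound.lam {Γ Γ' : Ctx D} {x x₁ x₂ : Var} {e₁ e₂ : Expr I} {σ : Formula I} {τ τ' : Ty D}
    (ht₁ : HasType S Γ (.lam x₁ e₁) (.arrow τ τ')) (ht₂ : HasType S Γ (.lam x₂ e₂) (.arrow τ τ'))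
    (hx : x ∉ Γ.dom)
    (ih : Sound S Ω ((x, τ) :: Γ) (e₁.subst₁ x₁ (.var x)) (e₂.subst₁ x₂ (.var x)) σ τ' Γ') :
    Sound S Ω Γ (.lam x₁ e₁) (.lam x₂ e₂) σ (.arrow τ τ') ((x, τ) :: Γ') := by
  intro hΓ hΓ' s θ₁ θ₂ hs hθ H
  rintro t (rfl | ⟨n, A, b, rfl, hb⟩) u (rfl | ⟨m, A', b', rfl, hb'⟩)
  · exact ⟨⟨_, _, rfl⟩, Or.inl rfl⟩
  · exact ⟨⟨_, _, rfl⟩, Or.inr ⟨_, _, _, rfl⟩⟩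
  · exact ⟨_, _, rfl, Or.inl rfl⟩
  · refine ⟨_, _, rfl, Or.inr ⟨_, _, _, rfl, fun hA hA' hAA' => ?_⟩⟩
    exact Sound.body ih hx (fun z hz hzx => ht₁.mem_dom z (by simp [Expr.fv, hz, hzx]))
      (fun z hz hzx => ht₂.mem_dom z (by simp [Expr.fv, hz, hzx])) hΓ hΓ' hs hθ H
      (Set.forall_mem_range.2 hA) (Set.forall_mem_range.2 hA')
      (Set.forall_mem_range.2 fun i => Set.forall_mem_range.2 (hAA' i))
      (Or.inl ⟨Set.range_nonempty A, Set.range_nonempty A'⟩) b hb b' hb'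

theorem Sound.fix {Γ Γ' : Ctx D} {x x₁ x₂ : Var} {e₁ e₂ : Expr I} {σ : Formula I} {τ : Ty D}
    (ht₁ : HasType S Γ (.fix x₁ e₁) τ) (ht₂ : HasType S Γ (.fix x₂ e₂) τ) (hx : x ∉ Γ.dom)
    (ih : Sound S Ω ((x, τ) :: Γ) (e₁.subst₁ x₁ (.var x)) (e₂.subst₁ x₂ (.var x)) σ τ Γ') :
    Sound S Ω Γ (.fix x₁ e₁) (.fix x₂ e₂) σ τ ((x, τ) :: Γ') := by
  intro hΓ hΓ' s θ₁ θ₂ hs hθ H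
  have hρ₁ : EnvOk S Γ (denEnv S Ω θ₁ s) := denEnv_ok hθ.ok_left hΓ
  have hρ₂ : EnvOk S Γ (denEnv S Ω θ₂ s) := denEnv_ok hθ.ok_right hΓ
  have hX₂ := ht₂.okSet hρ₂
  have key := fun {X₁ X₂ : Set (Tok I)} => Sound.body ih hx
    (fun z hz hzx => ht₁.mem_dom z (by simp [Expr.fv, hz, hzx]))
    (fun z hz hzx => ht₂.mem_dom z (by simp [Expr.fv, hz, hzx])) hΓ hΓ' hs hθ H (X₁ := X₁)
    (X₂ := X₂)
  generalize denEnv S Ω θ₁ s = ρ₁ at *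
  generalize denEnv S Ω θ₂ s = ρ₂ at *
  have hb₁ : ∀ {X}, OkSet S X τ → OkSet S (Sem e₁ (Function.update ρ₁ x₁ X)) τ := fun hX => by
    cases ht₁ with | fix _ _ _ _ h => exact h.okSet (hρ₁.update hX)
  have hb₂ : ∀ {X}, OkSet S X τ → OkSet S (Sem e₂ (Function.update ρ₂ x₂ X)) τ := fun hX => by
    cases ht₂ with | fix _ _ _ _ h => exact h.okSet (hρ₂.update hX)
  have hok : OkSet S (∅ : Set (Tok I)) τ := fun _ h => absurd h (Set.notMem_empty _)
  have start : CohSet S (Sem e₁ (Function.update ρ₁ x₁ ∅)) τ (Sem (.fix x₂ e₂) ρ₂) := by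
    let Y := {u : Tok I | u.Ok S τ ∧ ∀ t ∈ Sem e₁ (Function.update ρ₁ x₁ ∅), t.Coh S τ u}
    have : Sem (.fix x₂ e₂) ρ₂ ⊆ Y := by
      have hY : OkSet S Y τ := fun _ h => h.1
      refine fixSet_subset fun u hu => ⟨hb₂ hY u hu, fun t ht => ?_⟩
      rcases Y.eq_empty_or_nonempty with hemp | hne
      · rw [hemp] at hu
        exact key hok hok (fun _ h => absurd h (Set.notMem_empty _)) (Or.inr ⟨rfl, rfl⟩) t ht u hu
      -- On the left, the empty set is replaced by one unfolding of it, which contains `t` and so is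
      -- not empty; `t` remains a token of the body by monotonicity.
      · exact key (hb₁ hok) hY (fun t ht u hu => hu.2 t ht) (Or.inl ⟨⟨t, ht⟩, hne⟩) t
          (monotone_Sem_update e₁ ρ₁ x₁ (Set.empty_subset _) ht) u hu
    exact fun t ht u hu => (this hu).2 t ht
  let Y := {t : Tok I | t.Ok S τ ∧ ∀ u ∈ Sem (.fix x₂ e₂) ρ₂, t.Coh S τ u}
  have : Sem (.fix x₁ e₁) ρ₁ ⊆ Y := by
    have hY : OkSet S Y τ := fun _ h => h.1
    refine fixSet_subset fun t ht => ⟨hb₁ hY t ht, fun u hu => ?_⟩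
    rcases Y.eq_empty_or_nonempty with hemp | hne
    -- With `Y` empty, `t` comes from the unfolding of the empty set, which `start` covers.
    · rw [hemp] at ht
      exact start t ht u hu
    · refine key hY hX₂ (fun t ht u hu => ht.2 u hu) (Or.inl ⟨hne, ⟨u, hu⟩⟩) t ht u ?_
      rwa [Sem_fix]
  exact fun t ht u hu => (this ht).2 u hu

/-- The application is coherent with itself under the two interpretations, so `y` can be realized by
tokens of `f a` on both sides. On the right all of them are taken, for the replaced occurrences in
`e`. On the left the token `t` at hand is enough; taking it alone allows the set on the right to be
empty. -/
theorem Sound.app_left {Γ Γ' : Ctx D} {y : Var} {f a e : Expr I} {σ : Formula I} {τ : Ty D}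
    (ht₁ : HasType S Γ (.app f a) τ) (ht₂ : HasType S Γ e τ) (hy : y ∉ Γ.dom) (hye : y ∉ e.vars)
    (ih : Sound S Ω ((y, τ) :: Γ) (.var y) (replaceApp f a y e) σ τ Γ') :
    Sound S Ω Γ (.app f a) e σ τ ((y, τ) :: Γ') := by
  intro hΓ hΓ' s θ₁ θ₂ hs hθ H t ht u hu
  have hΩ : Ω y = τ := hΓ' y τ (by simp)
  have hρ₁ : EnvOk S Γ (denEnv S Ω θ₁ s) := denEnv_ok hθ.ok_left hΓ
  have hρ₂ : EnvOk S Γ (denEnv S Ω θ₂ s) := denEnv_ok hθ.ok_right hΓ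
  have hP₁ := ht₁.okSet hρ₁
  have hP₂ := ht₁.okSet hρ₂
  have hP := ht₁.cohSet hρ₁ hρ₂ (denEnv_coh hθ hΓ)
  have hts : ({t} : Set (Tok I)) ⊆ Sem (.app f a) (denEnv S Ω θ₁ s) :=
    Set.singleton_subset_iff.2 ht
  have hyF : y ∉ Γ.dom.toFinset := by simpa using hy
  obtain ⟨s', θ₁', θ₂', hs', hθ', hsz, hF₁, hF₂, hP₁, hP₂⟩ :=
    exists_extension hs hθ Γ.dom.toFinset (y := y) hyF (P₁ := {t}) (hΩ ▸ fun t ht => hP₁ t (hts ht))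
      (hΩ ▸ hP₂) (hΩ ▸ hP.mono hts subset_rfl) ⟨t, rfl⟩ (Or.inr Set.subsingleton_singleton)
  refine ih (forall_mem_cons hΓ hΩ) (fun z τ' hz => hΓ' z τ' (by simp [hz])) s' θ₁' θ₂' hs' hθ'
    (holds_of_dom_subset H hsz (by simp [Ctx.dom]) fun z hz => List.mem_cons_of_mem _ hz)
    t (hP₁ rfl) u ?_
  exact sem_subset_replaceApp f a y e hye
    (fun z hz => hF₂ z (List.mem_toFinset.2 (ht₂.mem_dom z hz))) hP₂ hu

/-- One substitution `s'` does two things: it makes the pattern, read as a term, equivalent to the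
value, as the guard demands, and it gives the pattern variables at least the tokens they are bound
to in the branch. It works for all interpretations at once, so both sides can use it. -/
theorem exists_branch {s : Var → Expr I} (hs : Typed S Ω s) {q : Pat I} {τ : Ty D} {Δ : Ctx D}
    {v : Expr I} {u : Tok I} {θ : Ty D → Expr I → Set (Tok I)} (hp : PatTy S q τ Δ)
    (hl : q.Linear) (hv : Val v) (hvt : HasType S [] v τ) (hd : Den S θ v τ u) (hm : TMatch u q)
    (hΩ : ∀ x τ, (x, τ) ∈ Δ → Ω x = τ) :
    ∃ s', Typed S Ω s' ∧ (∀ z, z ∉ q.vars → s' z = s z) ∧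
      (∀ s'', (∀ x ∈ q.vars, s'' x = s' x) → q.toTerm.Is s'' v) ∧
      ∀ θ P, P ⊆ {u | Den S θ v τ u} → bindEnv (denEnv S Ω θ s) q P ≤ denEnv S Ω θ s' := by
  classical
  obtain ⟨B, hB, hi, hb⟩ := hp.exists_bindings hv hvt hl hd hm
  have hΔ : ∀ x ∈ q.vars, (x, Ω x) ∈ Δ := by
    intro x hx
    rw [← hp.map_fst] at hx
    obtain ⟨⟨_, τ'⟩, ha, rfl⟩ := List.mem_map.1 hx
    rwa [hΩ _ _ ha]
  refine ⟨fun x => if x ∈ q.vars then B x else s x, fun x => ?_, fun z hz => if_neg hz,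
    fun s'' hs'' => hi s'' fun x hx => ?_, fun θ P hP x => ?_⟩
  · dsimp only
    split_ifs with hx
    · exact hB x _ (hΔ x hx)
    · exact hs x
  · rw [hs'' x hx]
    exact if_pos hx
  · by_cases hx : x ∈ q.vars
    · simp only [bindEnv, denEnv, hx, if_true]
      rintro w ⟨u, hu, hbu⟩
      exact hb θ u x w _ (hP hu) hbu (hΔ x hx)
    · simp only [bindEnv, denEnv, hx, if_false]
      exact le_rfl

/-- A token of the case expression comes from a single branch `k`. After the substitution of
`exists_branch` the guard of `k` is true, because the token of the scrutinee that selected `k`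
matches no earlier pattern; so the formula yields `σ k`. The other side is unaffected, as it
contains no fresh variable. -/
theorem Sound.case_left {Γ : Ctx D} {e : Expr I} {t : Term I} {n : ℕ} {p p' : Fin n → Pat I}
    {b b' : Fin n → Expr I} {e' : Expr I} {σ : Fin n → Formula I} {τ τ' : Ty D}
    {Δ Γ' : Fin n → Ctx D} {L : Finset Var} (hL₁ : (Expr.case e p b).vars ⊆ L) (hL₂ : e'.vars ⊆ L)
    (hL : Γ.dom.toFinset ⊆ L)
    (ht₁ : HasType S Γ (.case e p b) τ) (ht : IsTerm e t) (hte : HasType S Γ e τ')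
    (hf : ∀ i, Refine L (p i) (b i) (p' i) (b' i)) (hp : ∀ i, PatTy S (p' i) τ' (Δ i))
    (hfr : ∀ i, ∀ x ∈ (Γ' i).dom, x ∉ Ctx.dom (Δ i ++ Γ))
    (hd : (Ctx.dom (List.ofFn fun i => Δ i ++ Γ' i).flatten).Nodup)
    (ih : ∀ i, Sound S Ω (Δ i ++ Γ) (b' i) e' (σ i) τ (Γ' i)) :
    Sound S Ω Γ (.case e p b) e' (.conj fun i => .imp (.guard t p' i) (σ i)) τ
      (List.ofFn fun i => Δ i ++ Γ' i).flatten := by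
  intro hΓ hΓ' s θ₁ θ₂ hs hθ H t₁ ht₁' t₂ ht₂'
  obtain ⟨k, ⟨u, hu, hm, hn⟩, hk⟩ := sem_case_subset_of_refine hf ht₁.case_linear hL₁ _ ht₁'
  obtain ⟨v, hv, hvt, hi, hden⟩ := ht.exists_value hs hte hΓ
  have hΩk : ∀ x τ, (x, τ) ∈ Δ k → Ω x = τ := fun x τ hx =>
    hΓ' x τ (Ctx.mem_flatten (i := k) (List.mem_append_left _ hx))
  obtain ⟨s', hs', hsz, his, hbe⟩ := exists_branch hs (hp k) (linear_of_nodup hp hd k) hv hvt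
    (hden θ₁ hu) hm hΩk
  have hvars : (Δ k).dom = (p' k).vars := (hp k).map_fst
  refine ih k ?_ (fun x τ hx => hΓ' x τ (Ctx.mem_flatten (i := k) (List.mem_append_right _ hx)))
    s' θ₁ θ₂ hs' hθ ?_ t₁ (Sem_monotone _ (hbe θ₁ _ (hden θ₁)) hk) t₂ ?_
  · intro x τ hx
    exact (List.mem_append.1 hx).elim (hΩk x τ) (hΓ x τ)
  · intro s'' hs'' hagree
    have hold : ∀ x, x ∈ Ctx.dom (Δ k ++ Γ) → s'' x = s' x := fun x hx =>
      hagree x fun hx' => hfr k x hx' hx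
    have hH := Formula.holds_conj.1 (H s'' hs'' fun x hx => ?_) k
    · refine hH (Formula.holds_guard (hi s'' fun x hx => ?_) (his s'' fun x hx => ?_) ?_)
      · have hxΓ := hte.mem_dom x hx
        rw [hold x (by rw [Ctx.dom_append]; exact List.mem_append_right _ hxΓ), hsz x]
        exact fun hx' => (hf k).notMem x hx' (hL (List.mem_toFinset.2 hxΓ))
      · exact hold x (by rw [Ctx.dom_append, hvars]; exact List.mem_append_left _ hx)
      · exact fun j hj hj' => hn j hj (TMatch.of_is _ hj' (hden θ₁ hu))
    · have hx' : x ∉ Ctx.dom (Δ k ++ Γ' k) := fun h => hx (Ctx.mem_dom_flatten.2 ⟨k, h⟩)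
      rw [Ctx.dom_append, List.mem_append, not_or, hvars] at hx'
      rw [hagree x hx'.2, hsz x hx'.1]
  · refine Sem_mono e' (fun z hz => ?_) ht₂'
    rw [denEnv, denEnv, hsz z fun hz' => (hf k).notMem z hz' (hL₂ (e'.fv_subset_vars hz))]

/-- The scrutinees are coherent by the first premise, and each has a token because its case
expression has one. Hence a single value for `x` can stand for both. -/
theorem Sound.case_case {Γ Γ' Γ'' : Ctx D} {x : Var} {e e' : Expr I} {n m : ℕ}
    {p : Fin n → Pat I} {b : Fin n → Expr I} {p' : Fin m → Pat I} {b' : Fin m → Expr I}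
    {σ σ' : Formula I} {τ τ' : Ty D}
    (ht₁ : HasType S Γ (.case e p b) τ) (ht₂ : HasType S Γ (.case e' p' b') τ)
    (he : HasType S Γ e τ') (he' : HasType S Γ e' τ') (hx : x ∉ Γ.dom)
    (ih : Sound S Ω Γ e e' σ τ' Γ')
    (ih' : Sound S Ω ((x, τ') :: Γ) (.case (.var x) p b) (.case (.var x) p' b') σ' τ Γ'') :
    Sound S Ω Γ (.case e p b) (.case e' p' b') (.and σ σ') τ (Γ' ++ (x, τ') :: Γ'') := by
  intro hΓ hΓ' s θ₁ θ₂ hs hθ H t ht u hu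
  have hΩ : Ω x = τ' := hΓ' x τ' (by simp)
  subst hΩ
  have hP := ih hΓ (fun y τ hy => hΓ' y τ (by simp [hy])) s θ₁ θ₂ hs hθ fun s' hs' h =>
    (H s' hs' fun y hy => h y fun hy' => hy (by
      rw [Ctx.dom_append]; exact List.mem_append_left _ hy')).1
  have hcase : ∀ {n : ℕ} {e : Expr I} {p : Fin n → Pat I} {b : Fin n → Expr I} {ρ ρ' : Env I},
      HasType S Γ (.case e p b) τ → Sem e ρ ⊆ ρ' x → (∀ z ∈ Γ.dom.toFinset, ρ z ⊆ ρ' z) →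
      Sem (.case e p b) ρ ⊆ Sem (.case (.var x) p b) ρ' := by
    rintro n e p b ρ ρ' hty hx hF t ⟨i, ⟨u, hu, hm⟩, ht⟩
    refine ⟨i, ⟨u, hx hu, hm⟩, Sem_mono _ (bindEnv_mono_on (fun z hz => ?_) hx) ht⟩
    refine hF z (List.mem_toFinset.2 (hty.mem_dom z ?_))
    simp only [Expr.fv, Finset.mem_union, Finset.mem_biUnion, Finset.mem_univ, true_and]
    exact Or.inr ⟨i, hz⟩
  have hne₁ : (Sem e (denEnv S Ω θ₁ s)).Nonempty := by
    obtain ⟨_, ⟨w, hw, -⟩, -⟩ := ht; exact ⟨w, hw⟩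
  have hne₂ : (Sem e' (denEnv S Ω θ₂ s)).Nonempty := by
    obtain ⟨_, ⟨w, hw, -⟩, -⟩ := hu; exact ⟨w, hw⟩
  obtain ⟨s', θ₁', θ₂', hs', hθ', hsz, hF₁, hF₂, hP₁, hP₂⟩ :=
    exists_extension hs hθ Γ.dom.toFinset (y := x) (by simpa using hx)
      (he.okSet (denEnv_ok hθ.ok_left hΓ)) (he'.okSet (denEnv_ok hθ.ok_right hΓ)) hP hne₁
      (Or.inl hne₂)
  refine ih' (forall_mem_cons hΓ rfl) (fun z τ' hz => hΓ' z τ' (by simp [hz])) s' θ₁' θ₂' hs' hθ'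
    (holds_of_dom_subset (fun s' h₁ h₂ => (H s' h₁ h₂).2) hsz (by simp [Ctx.dom])
      fun z hz => ?_) t (hcase ht₁ hP₁ hF₁ ht) u (hcase ht₂ hP₂ hF₂ hu)
  rw [Ctx.dom_append]
  exact List.mem_append_right _ (List.mem_cons_of_mem _ hz)

/-- If the left side takes a shared branch, so does the right side, and the same one: up to that
index the patterns coincide, and coherent tokens match the same patterns. The bodies are then
compared directly and `σ k` needs no guard. Any other branch is treated as in `Sound.case_left`,
with the whole freshened case expression on the other side. -/
theorem Sound.case_shared {Γ : Ctx D} {x : Var} {n m : ℕ} {p q : Fin n → Pat I}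
    {b c : Fin n → Expr I} {p' q' : Fin m → Pat I} {b' c' : Fin m → Expr I} {r : ℕ} (hr : r ≤ m)
    {σ : Fin n → Formula I} {τ τ' : Ty D} {Δ Γ' : Fin n → Ctx D} {L : Finset Var}
    (hL₁ : (Expr.case (.var x) p b).vars ⊆ L) (hL₂ : (Expr.case (.var x) p' b').vars ⊆ L)
    (hL : Γ.dom.toFinset ⊆ L)
    (ht₁ : HasType S Γ (.case (.var x) p b) τ) (ht₂ : HasType S Γ (.case (.var x) p' b') τ)
    (hx : HasType S Γ (.var x) τ')
    (hf : ∀ i, Refine L (p i) (b i) (q i) (c i)) (hf' : ∀ i, Refine L (p' i) (b' i) (q' i) (c' i))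
    (hq : ∀ (i : Fin n) (j : Fin m), i.val = j.val → i.val < r → q i = q' j)
    (hp : ∀ i, PatTy S (q i) τ' (Δ i))
    (hfr : ∀ i, ∀ x ∈ (Γ' i).dom, x ∉ Ctx.dom (Δ i ++ Γ))
    (hd : (Ctx.dom (List.ofFn fun i => Δ i ++ Γ' i).flatten).Nodup)
    (ih : ∀ (i : Fin n) (hi : i.val < r),
      Sound S Ω (Δ i ++ Γ) (c i) (c' ⟨i.val, hi.trans_le hr⟩) (σ i) τ (Γ' i))
    (ih' : ∀ i : Fin n, r ≤ i.val →
      Sound S Ω (Δ i ++ Γ) (c i) (.case (.var x) q' c') (σ i) τ (Γ' i)) :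
    Sound S Ω Γ (.case (.var x) p b) (.case (.var x) p' b') (.shared x q r σ) τ
      (List.ofFn fun i => Δ i ++ Γ' i).flatten := by
  intro hΓ hΓ' s θ₁ θ₂ hs hθ H t₁ ht₁' t₂ ht₂'
  obtain ⟨k, ⟨u, hu, hm, hn⟩, hk⟩ := sem_case_subset_of_refine hf ht₁.case_linear hL₁ _ ht₁'
  obtain ⟨v, hv, hvt, hi, hden⟩ := (IsTerm.var x).exists_value hs hx hΓ
  have hΩk : ∀ x τ, (x, τ) ∈ Δ k → Ω x = τ := fun x τ hx =>
    hΓ' x τ (Ctx.mem_flatten (i := k) (List.mem_append_left _ hx))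
  obtain ⟨s', hs', hsz, his, hbe⟩ := exists_branch hs (hp k) (linear_of_nodup hp hd k) hv hvt
    (hden θ₁ hu) hm hΩk
  have hvars : (Δ k).dom = (q k).vars := (hp k).map_fst
  have hΓk : ∀ x τ, (x, τ) ∈ Δ k ++ Γ → Ω x = τ := fun x τ hx =>
    (List.mem_append.1 hx).elim (hΩk x τ) (hΓ x τ)
  have hΓk' : ∀ x τ, (x, τ) ∈ Γ' k → Ω x = τ := fun x τ hx =>
    hΓ' x τ (Ctx.mem_flatten (i := k) (List.mem_append_right _ hx))
  have hk' := Sem_monotone _ (hbe θ₁ _ (hden θ₁)) hk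
  have hHk : ∀ s'', Typed S Ω s'' → (∀ x, x ∉ (Γ' k).dom → s'' x = s' x) →
      (if k.val < r then σ k else .imp (.guard (.var x) q k) (σ k) : Formula I).Holds s'' := by
    intro s'' hs'' hagree
    refine Formula.holds_conj.1 (H s'' hs'' fun x hx => ?_) k
    have hx' : x ∉ Ctx.dom (Δ k ++ Γ' k) := fun h => hx (Ctx.mem_dom_flatten.2 ⟨k, h⟩)
    rw [Ctx.dom_append, List.mem_append, not_or, hvars] at hx'
    rw [hagree x hx'.2, hsz x hx'.1]
  rcases lt_or_ge k.val r with hkr | hkr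
  · simp only [hkr, if_true] at hHk
    refine ih k hkr hΓk hΓk' s' θ₁ θ₂ hs' hθ hHk t₁ hk' t₂ ?_
    obtain ⟨j, ⟨w, hw, hmw, hnw⟩, hj⟩ := sem_case_subset_of_refine hf' ht₂.case_linear hL₂ _ ht₂'
    have hc := Den.coh hθ (hden θ₁ hu) (hden θ₂ hw)
    obtain rfl : j = ⟨k.val, hkr.trans_le hr⟩ := by
      rcases lt_trichotomy j.val k.val with hlt | heq | hlt
      · refine absurd (Tok.Coh.tmatch hmw ((Tok.coh_comm u).1 hc)) ?_
        rw [← hq ⟨j.val, hlt.trans k.isLt⟩ j rfl (hlt.trans hkr)]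
        exact hn _ hlt
      · exact Fin.ext heq
      · refine absurd (Tok.Coh.tmatch hm hc) ?_
        rw [hq k ⟨k.val, hkr.trans_le hr⟩ rfl hkr]
        exact hnw _ hlt
    rw [← hq k ⟨k.val, hkr.trans_le hr⟩ rfl hkr] at hj
    exact Sem_monotone _ (hbe θ₂ _ (hden θ₂)) hj
  · simp only [not_lt.2 hkr, if_false] at hHk
    refine ih' k hkr hΓk hΓk' s' θ₁ θ₂ hs' hθ (fun s'' hs'' hagree => ?_) t₁ hk' t₂ ?_
    · have hold : ∀ x, x ∈ Ctx.dom (Δ k ++ Γ) → s'' x = s' x := fun x hx =>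
        hagree x fun hx' => hfr k x hx' hx
      refine hHk s'' hs'' hagree
        (Formula.holds_guard (hi s'' fun y hy => ?_) (his s'' fun y hy => ?_) ?_)
      · have hyΓ := hx.mem_dom y hy
        rw [hold y (by rw [Ctx.dom_append]; exact List.mem_append_right _ hyΓ), hsz y]
        exact fun hy' => (hf k).notMem y hy' (hL (List.mem_toFinset.2 hyΓ))
      · exact hold y (by rw [Ctx.dom_append, hvars]; exact List.mem_append_left _ hy)
      · exact fun j hj hj' => hn j hj (TMatch.of_is _ hj' (hden θ₁ hu))
    · refine sem_case_subset_of_refine hf' ht₂.case_linear hL₂ _ (Sem_mono _ (fun z hz => ?_) ht₂')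
      rw [denEnv, denEnv, hsz z fun hz' => (hf k).notMem z hz' (hL₂ (Expr.fv_subset_vars _ hz))]

theorem Iso.sound {Γ Γ' : Ctx D} {e₁ e₂ : Expr I} {σ : Formula I} {τ : Ty D}
    (h : Iso S Γ e₁ e₂ σ τ Γ') : Sound S Ω Γ e₁ e₂ σ τ Γ' := by
  have dom : ∀ {x : Var} {Γ : Ctx D} {e₁ e₂ : Expr I}, x ∉ inUse Γ e₁ e₂ → x ∉ Γ.dom :=
    fun hx h => hx (inUse_dom (List.mem_toFinset.2 h))
  refine Iso.rec
    (motive_1 := fun Γ e₁ e₂ σ τ Γ' _ => Sound S Ω Γ e₁ e₂ σ τ Γ')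
    (motive_2 := fun Γ e₁ e₂ σ τ Γ' _ => Sound S Ω Γ e₁ e₂ σ τ Γ')
    ?whnf ?atomic ?record ?proj ?inj ?lam ?fix ?app ?app_left ?app_right ?case_left ?case_right
    ?case_case ?case_shared_left ?case_shared_right h
  case whnf =>
    intro Γ e₁ e₂ e₁' e₂' σ τ Γ' _ _ h₁ h₂ _ ih hΓ hΓ' s θ₁ θ₂ hs hθ H
    exact (ih hΓ hΓ' s θ₁ θ₂ hs hθ H).mono (h₁.sem_subset _) (h₂.sem_subset _)
  case atomic => intro Γ e₁ e₂ t₁ t₂ τ ht₁ ht₂ h₁ h₂; exact Sound.atomic ht₁ ht₂ h₁ h₂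
  case record =>
    intro Γ n l e e' σ τ Γ' _ _ _ hd ih hΓ hΓ' s θ₁ θ₂ hs hθ H
    rintro _ ⟨t, rfl, ht⟩ _ ⟨u, rfl, hu⟩
    refine ⟨τ, u, rfl, rfl, fun i => ih i hΓ (fun x τ hx => hΓ' x τ (Ctx.mem_flatten hx)) s θ₁ θ₂
      hs hθ (fun s' hs' h => ?_) _ (ht i) _ (hu i)⟩
    exact Formula.holds_conj.1 (H s' hs' fun x hx => h x fun hx' =>
      hx (Ctx.mem_dom_flatten.2 ⟨i, hx'⟩)) i
  case proj =>
    intro Γ e₁ e₂ n l τ i σ Γ' _ _ _ ih hΓ hΓ' s θ₁ θ₂ hs hθ H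
    rintro _ ⟨n, l₁, t, j, ht, hj, rfl⟩ _ ⟨m, l₂, u, k, hu, hk, rfl⟩
    exact (ih hΓ hΓ' s θ₁ θ₂ hs hθ H).proj ht hj hu hk
  case inj =>
    intro Γ i e₁ e₂ σ τ Γ' _ _ hi _ ih hΓ hΓ' s θ₁ θ₂ hs hθ H
    rintro _ ⟨t, rfl, ht⟩ _ ⟨u, rfl, hu⟩
    exact ⟨τ, u, hi, rfl, rfl, ih hΓ hΓ' s θ₁ θ₂ hs hθ H t ht u hu⟩
  case lam =>
    intro Γ x x₁ x₂ e₁ e₂ σ τ τ' Γ' ht₁ ht₂ hx _ ih; exact Sound.lam ht₁ ht₂ (dom hx) ih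
  case fix =>
    intro Γ x x₁ x₂ e₁ e₂ σ τ Γ' ht₁ ht₂ hx _ ih; exact Sound.fix ht₁ ht₂ (dom hx) ih
  case app =>
    intro Γ e₁ e₁' e₂ e₂' σ σ' τ τ' Γ' Γ'' _ _ _ h' _ ih ih' hΓ hΓ' s θ₁ θ₂ hs hθ H
    rintro t ⟨n, A, hA, hi⟩ u ⟨m, A', hA', hi'⟩
    have h₁ := ih hΓ (fun x τ hx => hΓ' x τ (List.mem_append_left _ hx)) s θ₁ θ₂ hs hθ
      fun s' hs' h => (H s' hs' fun x hx => h x fun hx' => hx (by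
        rw [Ctx.dom_append]; exact List.mem_append_left _ hx')).1
    have h₂ := ih' hΓ (fun x τ hx => hΓ' x τ (List.mem_append_right _ hx)) s θ₁ θ₂ hs hθ
      fun s' hs' h => (H s' hs' fun x hx => h x fun hx' => hx (by
        rw [Ctx.dom_append]; exact List.mem_append_right _ hx')).2
    exact h₁.app hA hA' (fun i => h'.hasType.1.okSet (denEnv_ok hθ.ok_left hΓ) _ (hi i))
      (fun i => h'.hasType.2.okSet (denEnv_ok hθ.ok_right hΓ) _ (hi' i))
      fun i j => h₂ _ (hi i) _ (hi' j)
  case app_left =>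
    intro Γ y f a e σ τ Γ' ht₁ ht₂ _ hy _ ih
    exact Sound.app_left ht₁ ht₂ (dom hy) (fun h => hy (inUse_right h)) ih
  case app_right =>
    intro Γ y f a e σ τ Γ' ht₁ ht₂ _ hy _ ih
    exact (Sound.app_left ht₂ ht₁ (dom hy) (fun h => hy (inUse_left h)) ih.symm).symm
  case case_left =>
    intro Γ e t n p p' b b' e' σ τ τ' Δ Γ' ht₁ _ ht hte hf hp h hd ih
    exact Sound.case_left inUse_left inUse_right inUse_dom ht₁ ht hte
      (fun i => (hf i).refine) hp (fun i => (h i).fresh.2) hd ih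
  case case_right =>
    intro Γ e t n p p' b b' e' σ τ τ' Δ Γ' _ ht₂ ht hte hf hp h hd ih
    exact (Sound.case_left inUse_right inUse_left inUse_dom ht₂ ht hte
      (fun i => (hf i).refine) hp (fun i => (h i).fresh.2) hd ih).symm
  case case_case =>
    intro Γ x e e' n m p b p' b' σ σ' τ τ' Γ' Γ'' ht₁ ht₂ h hx _ _ ih ih'
    exact Sound.case_case ht₁ ht₂ h.hasType.1 h.hasType.2 (dom hx) ih ih'
  case case_shared_left =>
    intro Γ x n m p q b c p' q' b' c' s hs σ τ τ' Δ Γ' ht₁ ht₂ hx hf hp h h' hd _ _ ih ih'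
    exact Sound.case_shared hs inUse_left inUse_right inUse_dom ht₁ ht₂ hx
      (forall₂_branches hf.refine.1) (forall₂_branches hf.refine.2.1)
      (fun i j hij hi => hf.shared hij hi) hp
      (fun i => (lt_or_ge i.val s).elim (fun hi => (h i hi).fresh.2) fun hi => (h' i hi).fresh.2)
      hd ih ih'
  case case_shared_right =>
    intro Γ x n m p q b c p' q' b' c' s hs σ τ τ' Δ Γ' ht₁ ht₂ hx hf hp h h' hd _ _ ih ih'
    exact (Sound.case_shared hs inUse_right inUse_left inUse_dom ht₂ ht₁ hx
      (forall₂_branches hf.refine.2.1) (forall₂_branches hf.refine.1)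
      (fun i j hij hi => (hf.shared hij.symm (hij ▸ hi)).symm) hp
      (fun i => (lt_or_ge i.val s).elim (fun hi => (h i hi).fresh.2) fun hi => (h' i hi).fresh.2)
      hd ih fun i hi => (ih' i hi).symm).symm

end Soundness

section Extensional

variable {D : Type u} {I : Type v} {S : Signature D I}

/-! ### Extensional equivalence of coherent expressions -/

/-- A value of the type of a pattern matches it or does not match it. -/
theorem PatTy.matches_or_noMatch {p : Pat I} {τ : Ty D} {Δ : Ctx D} (hp : PatTy S p τ Δ) :
    ∀ {v : Expr I}, Val v → HasType S [] v τ → (∃ B, Matches v p B) ∨ NoMatch v p := by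
  classical
  induction hp with
  | wild τ => intro v _ _; exact Or.inl ⟨_, .wild v⟩
  | var x τ => intro v _ _; exact Or.inl ⟨_, .var v x⟩
  | record l p τ Δ _ ih =>
    intro v hv ht
    cases hv with
    | record l' w hw =>
      cases ht with
      | record _ _ _ _ ht =>
        by_cases h : ∃ i, NoMatch (w i) (p i)
        · obtain ⟨i, hi⟩ := h
          exact Or.inr (.record l w p i hi)
        · choose B hB using fun i => (ih i (hw i) (ht i)).resolve_right fun hi => h ⟨i, hi⟩
          exact Or.inl ⟨_, .record l w p B hB⟩
    | prim o => have := ht.prim_inv; simp [PrimOp.ty] at this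
    | const c => generalize hτ : Ty.record l τ = τ₀ at ht; cases ht; cases hτ
    | _ => cases ht
  | asP x p τ Δ _ ih =>
    intro v hv ht
    rcases ih hv ht with ⟨B, hB⟩ | h
    · exact Or.inl ⟨_, .asP v x p B hB⟩
    · exact Or.inr (.asP v x p h)
  | const c =>
    intro v hv ht
    cases hv with
    | const c' =>
      by_cases h : c' = c
      · subst h; exact Or.inl ⟨_, .const c'⟩
      · exact Or.inr (.const c' c h)
    | prim o => have := ht.prim_inv; simp [PrimOp.ty] at this
    | _ => cases ht
  | inj₀ i hi =>
    intro v hv ht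
    cases hv with
    | inj₀ j =>
      by_cases h : j = i
      · subst h; exact Or.inl ⟨_, .inj₀ j⟩
      · exact Or.inr (.inj₀ j i h)
    | inj j w hw => exact Or.inr (.inj_inj₀ j i w)
    | prim o => have := ht.prim_inv; simp [PrimOp.ty] at this
    | const c => generalize hτ : Ty.data (S.res i) = τ₀ at ht; cases ht; cases hτ
    | _ => cases ht
  | inj i p τ Δ hi _ ih =>
    intro v hv ht
    cases hv with
    | inj₀ j => exact Or.inr (.inj₀_inj j i p)
    | inj j w hw =>
      by_cases h : j = i
      · subst h
        generalize hτ : Ty.data (S.res j) = τ₀ at ht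
        cases ht with
        | inj _ _ _ τ' hj ht =>
          cases hi.symm.trans hj
          rcases ih hw ht with ⟨B, hB⟩ | h
          · exact Or.inl ⟨_, .inj j w p B hB⟩
          · exact Or.inr (.inj j w p h)
      · exact Or.inr (.inj_ne j i w p h)
    | prim o => have := ht.prim_inv; simp [PrimOp.ty] at this
    | const c => generalize hτ : Ty.data (S.res i) = τ₀ at ht; cases ht; cases hτ
    | _ => cases ht

/-- Closed expressions of the type `τ` the tokens of which are coherent. -/
structure CohExpr (S : Signature D I) (τ : Ty D) (e₁ e₂ : Expr I) : Prop where
  hasType_left : HasType S [] e₁ τ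
  hasType_right : HasType S [] e₂ τ
  coh : CohSet S (Sem e₁ fun _ => ∅) τ (Sem e₂ fun _ => ∅)

theorem CohExpr.evals {τ : Ty D} {e₁ e₂ v₁ v₂ : Expr I} (h : CohExpr S τ e₁ e₂)
    (h₁ : Evals e₁ v₁) (h₂ : Evals e₂ v₂) : CohExpr S τ v₁ v₂ :=
  ⟨h₁.hasType h.hasType_left, h₂.hasType h.hasType_right,
    h.coh.mono (h₁.sem_subset _) (h₂.sem_subset _)⟩

theorem CohExpr.app {τ₁ τ₂ : Ty D} {e₁ e₂ a : Expr I} (h : CohExpr S (.arrow τ₁ τ₂) e₁ e₂)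
    (ha : HasType S [] a τ₁) : CohExpr S τ₂ (.app e₁ a) (.app e₂ a) := by
  have hok : EnvOk S [] (fun _ => (∅ : Set (Tok I))) := fun x τ hx => by simp at hx
  refine ⟨.app _ _ _ _ _ h.hasType_left ha, .app _ _ _ _ _ h.hasType_right ha, ?_⟩
  rintro t ⟨n, A, hA, hi⟩ u ⟨m, A', hA', hi'⟩
  exact h.coh.app hA hA' (fun i => ha.okSet hok _ (hi i)) (fun i => ha.okSet hok _ (hi' i))
    fun i j => ha.cohSet hok hok (fun x τ hx => by simp at hx) _ (hi i) _ (hi' j)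

theorem CohExpr.not_noMatch {τ : Ty D} {v₁ v₂ : Expr I} {p : Pat I} {B : Bindings I}
    (h : CohExpr S τ v₁ v₂) (h₁ : Val v₁) (h₂ : Val v₂) (hm : Matches v₁ p B) :
    ¬ NoMatch v₂ p := fun hn => by
  obtain ⟨t, ht⟩ := h₁.sem_nonempty fun _ => ∅
  obtain ⟨u, hu⟩ := h₂.sem_nonempty fun _ => ∅
  exact hn.not_tmatch hu (Tok.Coh.tmatch (hm.tmatch ht) (h.coh t ht u hu))

theorem CohExpr.symm {τ : Ty D} {e₁ e₂ : Expr I} (h : CohExpr S τ e₁ e₂) : CohExpr S τ e₂ e₁ :=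
  ⟨h.hasType_right, h.hasType_left, h.coh.symm⟩

/-- Values keep only tokens of the expressions they come from, an argument is coherent with itself,
and tokens of bound subvalues extend to tokens of the whole values; so coherence survives each
clause. -/
theorem isExtEq_cohExpr (S : Signature D I) : IsExtEq S (CohExpr S) := by
  intro τ e₁ e₂ h
  refine ⟨h.hasType_left, h.hasType_right, fun v₁ v₂ h₁ h₂ => ?_⟩
  have hv := h.evals h₁ h₂
  have hv₁ := h₁.val'
  have hv₂ := h₂.val'
  refine ⟨fun τ₁ τ₂ hτ a ha => ?_, fun _ p Δ hp hl => ?_⟩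
  · subst hτ
    exact hv.app ha
  · rcases hp.matches_or_noMatch hv₁ hv.hasType_left with ⟨B₁, hB₁⟩ | hn₁
    · rcases hp.matches_or_noMatch hv₂ hv.hasType_right with ⟨B₂, hB₂⟩ | hn₂
      · refine Or.inl ⟨B₁, B₂, hB₁, hB₂, fun x τ' hx => ?_⟩
        have hmem : ∀ {v B}, Matches v p B → ∃ w, (x, w) ∈ B := fun {v B} hB => by
          have := hp.mem_vars hx
          rw [← hB.map_fst] at this
          obtain ⟨w, hw⟩ := exists_lookup this
          exact ⟨w, mem_of_lookup hw⟩
        obtain ⟨w₁, hw₁⟩ := hmem hB₁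
        obtain ⟨w₂, hw₂⟩ := hmem hB₂
        refine ⟨w₁, w₂, hw₁, hw₂, hB₁.hasType hp hl hv.hasType_left hw₁ hx,
          hB₂.hasType hp hl hv.hasType_right hw₂ hx, fun t ht u hu => ?_⟩
        obtain ⟨t', ht', hbt⟩ := hB₁.exists_tbind ht hv₁ hw₁
        obtain ⟨u', hu', hbu⟩ := hB₂.exists_tbind hu hv₂ hw₂
        exact Tok.Coh.tbind hp hl (hv.coh t' ht' u' hu') hbt hbu hx
      · exact absurd hn₂ (hv.not_noMatch hv₁ hv₂ hB₁)
    · rcases hp.matches_or_noMatch hv₂ hv.hasType_right with ⟨B₂, hB₂⟩ | hn₂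
      · exact absurd hn₁ (hv.symm.not_noMatch hv₂ hv₁ hB₂)
      · exact Or.inr ⟨hn₁, hn₂⟩

/-- A function type always contains a function that never returns, so inhabitants have to be assumed
for data types only. -/
theorem Ty.exists_value (hinh : ∀ d : D, ∃ v : Expr I, Val v ∧ HasType S [] v (.data d))
    (τ : Ty D) : ∃ v : Expr I, Val v ∧ HasType S [] v τ := by
  induction τ with
  | base b =>
    cases b with
    | int => exact ⟨_, .const (.int 0), .const _ (.int 0)⟩
    | bool => exact ⟨_, .const (.bool true), .const _ (.bool true)⟩
  | data d => exact hinh d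
  | record l τ ih =>
    choose v hv ht using ih
    exact ⟨_, .record l v hv, .record _ l v τ ht⟩
  | arrow τ₁ τ₂ => exact ⟨atom 0, .lam _ _, atom_hasType 0 τ₁ τ₂⟩

theorem Iso.cohExpr (hinh : ∀ d : D, ∃ v : Expr I, Val v ∧ HasType S [] v (.data d))
    {e₁ e₂ : Expr I} {σ : Formula I} {τ : Ty D} {Γ' : Ctx D} (h : Iso S [] e₁ e₂ σ τ Γ')
    (hσ : σ.Valid S Γ') : CohExpr S τ e₁ e₂ := by
  refine ⟨h.hasType.1, h.hasType.2, ?_⟩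
  -- The variables of `Γ'` are distinct, so each finds its declared type; the type of all others is
  -- immaterial.
  let Ω : Var → Ty D := fun x => (Γ'.lookup x).getD (.base .int)
  have hΩ : ∀ x τ, (x, τ) ∈ Γ' → Ω x = τ := fun x τ hx => by
    simp only [Ω, lookup_of_mem h.fresh.1 hx, Option.getD_some]
  choose s hs using fun x => Ty.exists_value hinh (Ω x)
  -- Coherence is wanted in the empty environment only, so at the start all abstractions may be
  -- interpreted by no tokens at all.
  have hθ : CohInterp S (fun _ _ => ∅) (fun _ _ => ∅) :=
    ⟨fun _ _ _ h => h.elim, fun _ _ _ h => h.elim, fun _ _ _ h => h.elim⟩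
  refine CohSet.mono (h.sound (Ω := Ω) (by simp) hΩ s _ _ hs hθ fun s' hs' _ => hσ s' ?_)
    (Sem_monotone e₁ fun _ => Set.empty_subset _) (Sem_monotone e₂ fun _ => Set.empty_subset _)
  intro x τ hx
  rw [← hΩ x τ hx]
  exact hs' x

end Extensional

end LambdaPix

open LambdaPix in
theorem mainTheorem1 {D : Type*} {I : Type*} (S : Signature D I)
    (hinh : ∀ d : D, ∃ v : Expr I, Val v ∧ HasType S [] v (.data d))
    (e₁ e₂ : Expr I) (σ : Formula I) (τ : Ty D) (Γ' : Ctx D)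
    (hiso : Iso S [] e₁ e₂ σ τ Γ') (hσ : σ.Valid S Γ') :
    ExtEq S τ e₁ e₂ := by
  exact ⟨CohExpr S, isExtEq_cohExpr S, hiso.cohExpr hinh hσ⟩
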